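/- **Setting.** Let $0<q<1$ and $[x]:=\frac{q^x-q^{-x}}{q-q^{-1}}$. Let $\mathcal H$ be the Hilbert space with orthonormal basis $|j\mu n{\uparrow}\rangle$ ($j\in\{0,\tfrac12,1,\dots\}$, $\mu\in\{-j,\dots,j\}$, $n\in\{-j-\tfrac12,\dots,j+\tfrac12\}$) and $|j\mu n{\downarrow}\rangle$ ($j\in\{\tfrac12,1,\dots\}$, $\mu\in\{-j,\dots,j\}$, $n\in\{-j+\tfrac12,\dots,j-\tfrac12\}$); symbols $|j\mu n s\rangle$ with indices outside these ranges mean $0$. Write $x^\pm=x\pm\frac12$. Let $\pi$ be the spinorial $*$-representation on $\mathcal H$ of the $*$-algebra $\mathcal A(SU_q(2))$ generated by $a,b$ with $ba=qab$, $b^*a=qab^*$, $bb^*=b^*b$, $a^*a+q^2b^*b=1$, $aa^*+bb^*=1$, given by $$\pi(a)|j\mu n s\rangle=\sum_{t}(\alpha^+_{j\mu n})_{ts}|j^+\mu^+n^+t\rangle+\sum_t(\alpha^-_{j\mu n})_{ts}|j^-\mu^+n^+t\rangle,$$ $$\pi(b)|j\mu n s\rangle=\sum_{t}(\beta^+_{j\mu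 n})_{ts}|j^+\mu^+n^-t\rangle+\sum_t(\beta^-_{j\mu n})_{ts}|j^-\mu^+n^-t\rangle,$$ where $s,t\in\{\uparrow,\downarrow\}$ and (first row and column for $\uparrow$) $$\alpha^+_{j\mu n}=\sqrt{q^{\mu+n-1/2}[j+\mu+1]}\begin{pmatrix}q^{-j-1/2}\frac{\sqrt{[j+n+3/2]}}{[2j+2]}&0\\ q^{1/2}\frac{\sqrt{[j-n+1/2]}}{[2j+1][2j+2]}&q^{-j}\frac{\sqrt{[j+n+1/2]}}{[2j+1]}\end{pmatrix},$$ $$\alpha^-_{j\mu n}=\sqrt{q^{\mu+n-1/2}[j-\mu]}\begin{pmatrix}q^{j+1}\frac{\sqrt{[j-n+1/2]}}{[2j+1]}&-q^{1/2}\frac{\sqrt{[j+n+1/2]}}{[2j][2j+1]}\\0&q^{j+1/2}\frac{\sqrt{[j-n-1/2]}}{[2j]}\end{pmatrix},$$ $$\beta^+_{j\mu n}=\sqrt{q^{\mu+n-1/2}[j+\mu+1]}\begin{pmatrix}\frac{\sqrt{[j-n+3/2]}}{[2j+2]}&0\\-q^{-j-1}\frac{\sqrt{[j+n+1/2]}}{[2j+1][2j+2]}&q^{-1/2}\frac{\sqrt{[j-n+1/2]}}{[2j+1]}\end{pmatrix},$$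 $$\beta^-_{j\mu n}=\sqrt{q^{\mu+n-1/2}[j-\mu]}\begin{pmatrix}-q^{-1/2}\frac{\sqrt{[j+n+1/2]}}{[2j+1]}&-q^{j}\frac{\sqrt{[j-n+1/2]}}{[2j][2j+1]}\\0&-\frac{\sqrt{[j+n-1/2]}}{[2j]}\end{pmatrix}.$$ The Dirac operator $\mathcal D$ is diagonal in this basis, with eigenvalue $2j+\frac32$ on $|j\mu n{\uparrow}\rangle$ and $-(2j+\frac12)$ on $|j\mu n{\downarrow}\rangle$. The reality operator $J$ is the antiunitary operator with $J|j\mu n{\uparrow}\rangle=i^{2(2j+\mu+n)}|j,-\mu,-n,{\uparrow}\rangle$ and $J|j\mu n{\downarrow}\rangle=i^{2(2j-\mu-n)}|j,-\mu,-n,{\downarrow}\rangle$. Put $\delta(T):=[|\mathcal D|,T]$. A *$\delta$-one-form* is a finite sum $\sum_i\pi(x_i)\,\delta(\pi(y_i))$ with $x_i,y_i\in\mathcal A(SU_q(2))$. The *noncommutative integral* of an operator $P$ is $\fint P:=\operatorname{Res}_{s=0}\operatorname{Tr}(P|\mathcal D|^{-s})$, the residue at $s=0$ of the meromorphic continuation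 to $\mathbb C$ of the function $s\mapsto\operatorname{Tr}(P|\mathcal D|^{-s})$, which is defined for $\operatorname{Re}s$ large. **Theorem.** Let $A$ and $B$ be $\delta$-one-forms. Then $\delta(A)$ is bounded, all of the following noncommutative integrals exist, and (i) $\fint AJBJ^{-1}|\mathcal D|^{-3}=\tfrac12\,\fint A|\mathcal D|^{-3}\;\overline{\fint B|\mathcal D|^{-3}}$; (ii) $\fint AJBJ^{-1}|\mathcal D|^{-2}=\tfrac12\,\fint A|\mathcal D|^{-2}\;\overline{\fint B|\mathcal D|^{-3}}+\tfrac12\,\fint A|\mathcal D|^{-3}\;\overline{\fint B|\mathcal D|^{-2}}$; (iii) $\fint A^2JBJ^{-1}|\mathcal D|^{-3}=\tfrac12\,\fint A^2|\mathcal D|^{-3}\;\overline{\fint B|\mathcal D|^{-3}}$; (iv) $\fint \delta(A)A|\mathcal D|^{-3}=\fint \delta(A)JAJ^{-1}|\mathcal D|^{-3}=0$. -/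

import Mathlib

open scoped ComplexConjugate InnerProductSpace
open Filter Topology

noncomputable section

namespace SUq2

/-! ### The spinor Hilbert space -/

/-- Labels of the orthonormal basis vectors `|j μ n ↑⟩` and `|j μ n ↓⟩`.  A label is the tuple
`(2j, 2μ, 2n, s)` of integers, with `s = 0` for `↑` and `s = 1` for `↓`.  The conditions say that
`j ∈ {0, 1/2, 1, …}`, that `μ ∈ {-j, …, j}`, and that `n ∈ {-j-1/2, …, j+1/2}` for `↑` and
`n ∈ {-j+1/2, …, j-1/2}` for `↓` (so that there is no `↓` label with `j = 0`). -/
def IsLabel (x : ℤ × ℤ × ℤ × Fin 2) : Prop :=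
  0 ≤ x.1 ∧ |x.2.1| ≤ x.1 ∧ 2 ∣ x.1 - x.2.1 ∧
    |x.2.2.1| ≤ x.1 + (if x.2.2.2 = 0 then 1 else -1) ∧ 2 ∣ x.1 + 1 - x.2.2.1

/-- The index set of the orthonormal basis. -/
abbrev Label : Type := {x : ℤ × ℤ × ℤ × Fin 2 // IsLabel x}

/-- The Hilbert space of spinors: `ℓ²` of the set of labels. -/
abbrev Spinor : Type := lp (fun _ : Label => ℂ) 2

/-- The orthonormal basis vector with label `i`. -/
def basisVec (i : Label) : Spinor := lp.single 2 i (1 : ℂ)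

open Classical in
/-- The basis vector `|j μ n s⟩` with `(2j, 2μ, 2n, s) = x`, with the convention that it is zero
when `x` is not a label. -/
def ket (x : ℤ × ℤ × ℤ × Fin 2) : Spinor := if h : IsLabel x then basisVec ⟨x, h⟩ else 0

open Classical in
/-- The bounded operator with prescribed values `g i` on the basis vectors (it is unique; if there
is none, the value is `0`). -/
def opOfBasis (g : Label → Spinor) : Spinor →L[ℂ] Spinor :=
  if h : ∃ T : Spinor →L[ℂ] Spinor, ∀ i, T (basisVec i) = g i then h.choose else 0

theorem opOfBasis_spec {g : Label → Spinor}
    (h : ∃ T : Spinor →L[ℂ] Spinor, ∀ i, T (basisVec i) = g i) (i : Label) :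
    opOfBasis g (basisVec i) = g i := by
  rw [opOfBasis, dif_pos h]
  exact h.choose_spec i

theorem inner_basisVec_left (i : Label) (f : Spinor) : ⟪basisVec i, f⟫_ℂ = f i := by
  rw [basisVec, lp.inner_single_left]
  simp

theorem ext_basisVec {S T : Spinor →L[ℂ] Spinor} (h : ∀ i, S (basisVec i) = T (basisVec i)) :
    S = T := by
  have key : ∀ R : Spinor →L[ℂ] Spinor, (∀ i, R (basisVec i) = 0) → R = 0 := by
    intro R hR
    have hadj : ContinuousLinearMap.adjoint R = 0 := by
      ext f i
      have h1 : ⟪basisVec i, ContinuousLinearMap.adjoint R f⟫_ℂ = 0 := by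
        rw [ContinuousLinearMap.adjoint_inner_right, hR, inner_zero_left]
      rw [inner_basisVec_left] at h1
      simpa using h1
    have h2 := congrArg ContinuousLinearMap.adjoint hadj
    simpa using h2
  have h0 := key (S - T) (fun i => by simp [h i])
  exact sub_eq_zero.mp h0

/-- A weighted partial injection of the basis with bounded weights is a bounded operator. -/
theorem exists_weightedShift (c : Label → ℂ) (C : ℝ) (p : Label → Option Label)
    (hc : ∀ i, ‖c i‖ ≤ C)
    (hp : ∀ i i' k, p i = some k → p i' = some k → i = i') :
    ∃ T : Spinor →L[ℂ] Spinor, ∀ i,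
      T (basisVec i) = c i • (p i).elim (0 : Spinor) basisVec := by
  classical
  by_cases hL : IsEmpty Label
  · exact ⟨0, fun i => hL.elim i⟩
  have hC : 0 ≤ C := by
    rw [not_isEmpty_iff] at hL
    exact (norm_nonneg _).trans (hc hL.some)
  let s : Spinor → Label → ℂ := fun f i => conj (c i) * (p i).elim (0 : ℂ) (fun k => f k)
  have hsum : ∀ (f : Spinor) (F : Finset Label),
      ∑ i ∈ F, ‖s f i‖ ^ (2 : ENNReal).toReal ≤ (C * ‖f‖) ^ (2 : ENNReal).toReal := by
    intro f F
    have hle : ∑ i ∈ F, ‖s f i‖ ^ (2 : ENNReal).toReal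
        ≤ ∑ i ∈ F, C ^ (2 : ENNReal).toReal *
            (p i).elim (0 : ℝ) (fun k => ‖f k‖ ^ (2 : ENNReal).toReal) := by
      refine Finset.sum_le_sum fun i _ => ?_
      rcases hpi : p i with _ | k
      · simp [s, hpi]
      · simp only [s, hpi, Option.elim, norm_mul, RCLike.norm_conj]
        rw [Real.mul_rpow (norm_nonneg _) (norm_nonneg _)]
        gcongr
        exact hc i
    refine hle.trans ?_
    rw [← Finset.mul_sum, Real.mul_rpow hC (norm_nonneg _)]
    gcongr
    have hfil : ∑ i ∈ F, (p i).elim (0 : ℝ) (fun k => ‖f k‖ ^ (2 : ENNReal).toReal)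
        = ∑ k ∈ F.biUnion (fun i => (p i).toFinset), ‖f k‖ ^ (2 : ENNReal).toReal := by
      rw [Finset.sum_biUnion]
      · refine Finset.sum_congr rfl fun i _ => ?_
        rcases hpi : p i with _ | k <;> simp
      · intro i _ i' _ hne
        rw [Function.onFun, Finset.disjoint_left]
        intro k hk hk'
        rw [Option.mem_toFinset, Option.mem_def] at hk hk'
        exact hne (hp i i' k hk hk')
    rw [hfil]
    exact lp.sum_rpow_le_norm_rpow (by norm_num) f _
  let S : Spinor →ₗ[ℂ] Spinor :=
    { toFun := fun f => ⟨s f, memℓp_gen' (C := (C * ‖f‖) ^ (2 : ENNReal).toReal) (hsum f)⟩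
      map_add' := by
        intro f g
        ext i
        change s (f + g) i = s f i + s g i
        rcases hpi : p i with _ | k <;> simp [s, hpi, mul_add]
      map_smul' := by
        intro a f
        ext i
        rcases hpi : p i with _ | k <;> simp [s, hpi]
        ring }
  let S' : Spinor →L[ℂ] Spinor := S.mkContinuous C (fun f => by
    refine lp.norm_le_of_forall_sum_le (by norm_num) (by positivity) (fun F => ?_)
    exact hsum f F)
  refine ⟨ContinuousLinearMap.adjoint S', fun i => ?_⟩
  refine ext_inner_right ℂ fun f => ?_
  rw [ContinuousLinearMap.adjoint_inner_left, inner_basisVec_left, inner_smul_left]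
  change s f i = _
  rcases hpi : p i with _ | k
  · simp [s, hpi]
  · simp [s, hpi, inner_basisVec_left]

/-! ### The spinorial representation -/

/-- The `q`-number `[x] = (q^x - q^{-x}) / (q - q⁻¹)`. -/
def qnum (q x : ℝ) : ℝ := (q ^ x - q ^ (-x)) / (q - q⁻¹)

/-- The matrix `α⁺_{jμn}`. -/
def alphaPlus (q j μ n : ℝ) : Matrix (Fin 2) (Fin 2) ℝ :=
  √(q ^ (μ + n - 1 / 2) * qnum q (j + μ + 1)) •
    !![q ^ (-j - 1 / 2) * √(qnum q (j + n + 3 / 2)) / qnum q (2 * j + 2),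
       0;
       q ^ (1 / 2 : ℝ) * √(qnum q (j - n + 1 / 2)) / (qnum q (2 * j + 1) * qnum q (2 * j + 2)),
       q ^ (-j) * √(qnum q (j + n + 1 / 2)) / qnum q (2 * j + 1)]

/-- The matrix `α⁻_{jμn}`. -/
def alphaMinus (q j μ n : ℝ) : Matrix (Fin 2) (Fin 2) ℝ :=
  √(q ^ (μ + n - 1 / 2) * qnum q (j - μ)) •
    !![q ^ (j + 1) * √(qnum q (j - n + 1 / 2)) / qnum q (2 * j + 1),
       -(q ^ (1 / 2 : ℝ) * √(qnum q (j + n + 1 / 2)) / (qnum q (2 * j) * qnum q (2 * j + 1)));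
       0,
       q ^ (j + 1 / 2) * √(qnum q (j - n - 1 / 2)) / qnum q (2 * j)]

/-- The matrix `β⁺_{jμn}`. -/
def betaPlus (q j μ n : ℝ) : Matrix (Fin 2) (Fin 2) ℝ :=
  √(q ^ (μ + n - 1 / 2) * qnum q (j + μ + 1)) •
    !![√(qnum q (j - n + 3 / 2)) / qnum q (2 * j + 2),
       0;
       -(q ^ (-j - 1) * √(qnum q (j + n + 1 / 2)) / (qnum q (2 * j + 1) * qnum q (2 * j + 2))),
       q ^ (-1 / 2 : ℝ) * √(qnum q (j - n + 1 / 2)) / qnum q (2 * j + 1)]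

/-- The matrix `β⁻_{jμn}`. -/
def betaMinus (q j μ n : ℝ) : Matrix (Fin 2) (Fin 2) ℝ :=
  √(q ^ (μ + n - 1 / 2) * qnum q (j - μ)) •
    !![-(q ^ (-1 / 2 : ℝ) * √(qnum q (j + n + 1 / 2)) / qnum q (2 * j + 1)),
       -(q ^ j * √(qnum q (j - n + 1 / 2)) / (qnum q (2 * j) * qnum q (2 * j + 1)));
       0,
       -(√(qnum q (j + n - 1 / 2)) / qnum q (2 * j))]

/-- The vector
`∑_t c⁺_{ts} |j+1/2, μ+1/2, n+ν/2, t⟩ + ∑_t c⁻_{ts} |j-1/2, μ+1/2, n+ν/2, t⟩`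
attached to the label of `|j μ n s⟩`, for two families of matrices `c^±_{jμn}` and `ν = ±1`. -/
def stepVec (cp cm : ℝ → ℝ → ℝ → Matrix (Fin 2) (Fin 2) ℝ) (ν : ℤ) (i : Label) : Spinor :=
  let J := i.1.1
  let M := i.1.2.1
  let N := i.1.2.2.1
  let s := i.1.2.2.2
  ∑ t : Fin 2,
    (((cp (J / 2) (M / 2) (N / 2) t s : ℝ) : ℂ) • ket (J + 1, M + 1, N + ν, t) +
     ((cm (J / 2) (M / 2) (N / 2) t s : ℝ) : ℂ) • ket (J - 1, M + 1, N + ν, t))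

/-- The operator `π(a)`. -/
def piA (q : ℝ) : Spinor →L[ℂ] Spinor := opOfBasis (stepVec (alphaPlus q) (alphaMinus q) 1)

/-- The operator `π(b)`. -/
def piB (q : ℝ) : Spinor →L[ℂ] Spinor := opOfBasis (stepVec (betaPlus q) (betaMinus q) (-1))

theorem exists_stepVec (cp cm : ℝ → ℝ → ℝ → Matrix (Fin 2) (Fin 2) ℝ) (ν : ℤ) (C : ℝ)
    (hp : ∀ i : Label, ∀ t, |cp (i.1.1 / 2) (i.1.2.1 / 2) (i.1.2.2.1 / 2) t i.1.2.2.2| ≤ C)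
    (hm : ∀ i : Label, ∀ t, |cm (i.1.1 / 2) (i.1.2.1 / 2) (i.1.2.2.1 / 2) t i.1.2.2.2| ≤ C) :
    ∃ T : Spinor →L[ℂ] Spinor, ∀ i, T (basisVec i) = stepVec cp cm ν i := by
  classical
  have key : ∀ (c : ℝ → ℝ → ℝ → Matrix (Fin 2) (Fin 2) ℝ) (ε : ℤ) (s t : Fin 2),
      (∀ i : Label, ∀ t, |c (i.1.1 / 2) (i.1.2.1 / 2) (i.1.2.2.1 / 2) t i.1.2.2.2| ≤ C) →
      ∃ T : Spinor →L[ℂ] Spinor, ∀ i : Label, T (basisVec i) =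
        if i.1.2.2.2 = s then
          ((c (i.1.1 / 2) (i.1.2.1 / 2) (i.1.2.2.1 / 2) t i.1.2.2.2 : ℝ) : ℂ) •
            ket (i.1.1 + ε, i.1.2.1 + 1, i.1.2.2.1 + ν, t)
        else 0 := by
    intro c ε s t hc
    obtain ⟨T, hT⟩ := exists_weightedShift
      (fun i => ((c (i.1.1 / 2) (i.1.2.1 / 2) (i.1.2.2.1 / 2) t i.1.2.2.2 : ℝ) : ℂ)) C
      (fun i => if h : i.1.2.2.2 = s ∧
          IsLabel (i.1.1 + ε, i.1.2.1 + 1, i.1.2.2.1 + ν, t) then some ⟨_, h.2⟩ else none)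
      (fun i => by simpa using hc i t)
      (by
        rintro ⟨⟨J, M, N, u⟩, h⟩ ⟨⟨J', M', N', u'⟩, h'⟩ ⟨⟨a, b, d, e⟩, hk⟩ h1 h2
        simp only [Option.dite_none_right_eq_some, Option.some.injEq, Subtype.mk.injEq,
          Prod.mk.injEq] at h1 h2
        obtain ⟨⟨h11, -⟩, h12, h13, h14, -⟩ := h1
        obtain ⟨⟨h21, -⟩, h22, h23, h24, -⟩ := h2
        subst h11 h21
        simp only [Subtype.mk.injEq, Prod.mk.injEq]
        refine ⟨by omega, by omega, by omega, by simp_all⟩)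
    refine ⟨T, fun i => ?_⟩
    rw [hT]
    by_cases h1 : i.1.2.2.2 = s
    · by_cases h2 : IsLabel (i.1.1 + ε, i.1.2.1 + 1, i.1.2.2.1 + ν, t)
      · simp only [h2, and_true, h1, ↓reduceDIte, Option.elim, ↓reduceIte, ket]
      · simp only [h2, and_false, ↓reduceDIte, Option.elim, smul_zero, ket, ite_self]
    · simp [h1]
  choose Tp hTp using fun s t : Fin 2 => key cp 1 s t hp
  choose Tm hTm using fun s t : Fin 2 => key cm (-1) s t hm
  refine ⟨∑ s, ∑ t, (Tp s t + Tm s t), fun i => ?_⟩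
  rw [stepVec]
  simp only [sum_apply, add_apply, hTp, hTm]
  rw [Finset.sum_comm]
  refine Finset.sum_congr rfl fun t _ => ?_
  simp [Finset.sum_add_distrib, sub_eq_add_neg]

theorem coef_bound {q : ℝ} (hq0 : 0 < q) (hq1 : q < 1) {e x y f g w K : ℝ}
    (hK : K = (q⁻¹ - q)⁻¹) (hw0 : 0 ≤ w) (hw : w ≤ q ^ g)
    (h : -5 ≤ (e - x) / 2 + f - y / 2 + g) :
    √(q ^ e * qnum q x) * (q ^ f * √(qnum q y) * w) ≤ K * q ^ (-5 : ℝ) := by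
  have hqi : 1 < q⁻¹ := (one_lt_inv₀ hq0).mpr hq1
  have hd : 0 < q⁻¹ - q := by linarith
  have hK0 : 0 < K := by rw [hK]; positivity
  have hup : ∀ z, qnum q z ≤ K * q ^ (-z) := by
    intro z
    have h1 : qnum q z = (q ^ (-z) - q ^ z) * K := by
      rw [qnum, hK, ← neg_sub (q ^ (-z)), ← neg_sub q⁻¹ q, neg_div_neg_eq, div_eq_mul_inv]
    rw [h1]
    have h2 : 0 < q ^ z := by positivity
    nlinarith [mul_pos h2 hK0]
  have hroot : ∀ z : ℝ, √(q ^ z) = q ^ (z / 2) := by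
    intro z
    rw [Real.sqrt_eq_rpow, ← Real.rpow_mul hq0.le]
    ring_nf
  have h1 : √(q ^ e * qnum q x) ≤ √K * q ^ ((e - x) / 2) := by
    rw [← hroot, ← Real.sqrt_mul hK0.le]
    apply Real.sqrt_le_sqrt
    have := mul_le_mul_of_nonneg_left (hup x) (by positivity : 0 ≤ q ^ e)
    refine this.trans (le_of_eq ?_)
    rw [sub_eq_add_neg, Real.rpow_add hq0]
    ring
  have h2 : √(qnum q y) ≤ √K * q ^ (-y / 2) := by
    rw [← hroot, ← Real.sqrt_mul hK0.le]
    exact Real.sqrt_le_sqrt (hup y)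
  calc √(q ^ e * qnum q x) * (q ^ f * √(qnum q y) * w)
      ≤ (√K * q ^ ((e - x) / 2)) * (q ^ f * (√K * q ^ (-y / 2)) * q ^ g) := by gcongr
    _ = (√K * √K) * (q ^ ((e - x) / 2) * q ^ f * q ^ (-y / 2) * q ^ g) := by ring
    _ = K * q ^ ((e - x) / 2 + f - y / 2 + g) := by
        rw [Real.mul_self_sqrt hK0.le, ← Real.rpow_add hq0, ← Real.rpow_add hq0,
          ← Real.rpow_add hq0]
        ring_nf
    _ ≤ K * q ^ (-5 : ℝ) := by
        gcongr 1
        exact Real.rpow_le_rpow_of_exponent_ge hq0 hq1.le h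

theorem one_div_qnum {q : ℝ} (hq0 : 0 < q) (hq1 : q < 1) {z : ℝ} (hz : 1 ≤ z) :
    0 ≤ (qnum q z)⁻¹ ∧ (qnum q z)⁻¹ ≤ q ^ (z - 1) := by
  have hqi : 1 < q⁻¹ := (one_lt_inv₀ hq0).mpr hq1
  have hd : 0 < q⁻¹ - q := by linarith
  have h1 : qnum q z = (q ^ (-z) - q ^ z) / (q⁻¹ - q) := by
    rw [qnum, ← neg_sub (q ^ (-z)), ← neg_sub q⁻¹ q, neg_div_neg_eq]
  have h2 : q ^ (1 - z) ≤ qnum q z := by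
    rw [h1, le_div_iff₀ hd, mul_sub]
    have e1 : q ^ (1 - z) * q⁻¹ = q ^ (-z) := by
      rw [← Real.rpow_neg_one, ← Real.rpow_add hq0]; ring_nf
    have e2 : q ^ (1 - z) * q = q ^ (2 - z) := by
      nth_rewrite 2 [← Real.rpow_one q]
      rw [← Real.rpow_add hq0]; ring_nf
    have e3 : q ^ z ≤ q ^ (2 - z) := Real.rpow_le_rpow_of_exponent_ge hq0 hq1.le (by linarith)
    rw [e1, e2]; linarith
  have h3 : 0 < q ^ (1 - z) := by positivity
  refine ⟨inv_nonneg.mpr (h3.le.trans h2), ?_⟩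
  calc (qnum q z)⁻¹ ≤ (q ^ (1 - z))⁻¹ := inv_anti₀ h3 h2
    _ = q ^ (z - 1) := by rw [← Real.rpow_neg hq0.le]; ring_nf

theorem one_div_qnum_mul {q : ℝ} (hq0 : 0 < q) (hq1 : q < 1) {z z' : ℝ} (hz : 1 ≤ z)
    (hz' : 1 ≤ z') :
    0 ≤ (qnum q z * qnum q z')⁻¹ ∧ (qnum q z * qnum q z')⁻¹ ≤ q ^ (z - 1 + (z' - 1)) := by
  obtain ⟨h1, h2⟩ := one_div_qnum hq0 hq1 hz
  obtain ⟨h3, h4⟩ := one_div_qnum hq0 hq1 hz'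
  rw [mul_inv, Real.rpow_add hq0]
  exact ⟨mul_nonneg h1 h3, mul_le_mul h2 h4 h3 (by positivity)⟩

theorem label_real (i : Label) :
    0 ≤ (i.1.1 : ℝ) / 2 ∧ |(i.1.2.1 : ℝ) / 2| ≤ (i.1.1 : ℝ) / 2 ∧
      |(i.1.2.2.1 : ℝ) / 2| ≤ (i.1.1 : ℝ) / 2 + 1 / 2 ∧
      (i.1.2.2.2 = 1 → 1 ≤ 2 * ((i.1.1 : ℝ) / 2)) := by
  obtain ⟨⟨J, M, N, s⟩, h1, h2, h3, h4, h5⟩ := i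
  simp only at h1 h2 h3 h4 h5 ⊢
  have hN : |N| ≤ J + 1 := by split_ifs at h4 <;> linarith
  have a1 : (0 : ℝ) ≤ J := by exact_mod_cast h1
  have a2 : |(M : ℝ)| ≤ J := by exact_mod_cast h2
  have a3 : |(N : ℝ)| ≤ J + 1 := by exact_mod_cast hN
  rw [abs_div, abs_div, abs_two]
  refine ⟨by linarith, by linarith, by linarith, ?_⟩
  rintro rfl
  have h6 : 1 ≤ J := by
    have := abs_nonneg N
    simp at h4
    linarith
  have : (1 : ℝ) ≤ J := by exact_mod_cast h6
  linarith

theorem piA_basisVec {q : ℝ} (hq0 : 0 < q) (hq1 : q < 1) (i : Label) :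
    piA q (basisVec i) = stepVec (alphaPlus q) (alphaMinus q) 1 i := by
  refine opOfBasis_spec (exists_stepVec _ _ _ ((q⁻¹ - q)⁻¹ * q ^ (-5 : ℝ)) ?_ ?_) i <;>
  · intro i t
    obtain ⟨hj, hμ, hn, hs⟩ := label_real i
    generalize (i.1.1 : ℝ) / 2 = j at *
    generalize (i.1.2.1 : ℝ) / 2 = μ at *
    generalize (i.1.2.2.1 : ℝ) / 2 = n at *
    generalize i.1.2.2.2 = s at *
    rw [abs_le] at hμ hn
    have hK : 0 ≤ (q⁻¹ - q)⁻¹ * q ^ (-5 : ℝ) := by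
      have : 1 < q⁻¹ := (one_lt_inv₀ hq0).mpr hq1
      have : 0 ≤ q⁻¹ - q := by linarith
      positivity
    fin_cases t <;> fin_cases s <;>
      simp only [alphaPlus, alphaMinus, Matrix.smul_apply, Matrix.of_apply, Matrix.cons_val',
        Matrix.cons_val_zero, Matrix.cons_val_one, Matrix.cons_val_fin_one, smul_eq_mul,
        Fin.zero_eta, Fin.mk_one, mul_neg, abs_neg, mul_zero, abs_zero, div_eq_mul_inv _ (qnum _ _),
        div_eq_mul_inv _ (_ * _)] <;>
      first
      | exact hK
      | (have h2j := hs rfl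
         obtain ⟨hw0, hw⟩ := one_div_qnum_mul hq0 hq1 (z := 2 * j) (z' := 2 * j + 1) (by linarith)
           (by linarith)
         rw [abs_of_nonneg (by positivity)]
         exact coef_bound hq0 hq1 rfl hw0 hw (by linarith))
      | (have h2j := hs rfl
         obtain ⟨hw0, hw⟩ := one_div_qnum hq0 hq1 (z := 2 * j) (by linarith)
         rw [abs_of_nonneg (by positivity)]
         exact coef_bound hq0 hq1 rfl hw0 hw (by linarith))
      | (obtain ⟨hw0, hw⟩ := one_div_qnum hq0 hq1 (z := 2 * j + 1) (by linarith)
         rw [abs_of_nonneg (by positivity)]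
         exact coef_bound hq0 hq1 rfl hw0 hw (by linarith))
      | (obtain ⟨hw0, hw⟩ := one_div_qnum hq0 hq1 (z := 2 * j + 2) (by linarith)
         rw [abs_of_nonneg (by positivity)]
         exact coef_bound hq0 hq1 rfl hw0 hw (by linarith))
      | (obtain ⟨hw0, hw⟩ := one_div_qnum_mul hq0 hq1 (z := 2 * j + 1) (z' := 2 * j + 2)
           (by linarith) (by linarith)
         rw [abs_of_nonneg (by positivity)]
         exact coef_bound hq0 hq1 rfl hw0 hw (by linarith))

theorem piB_basisVec {q : ℝ} (hq0 : 0 < q) (hq1 : q < 1) (i : Label) :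
    piB q (basisVec i) = stepVec (betaPlus q) (betaMinus q) (-1) i := by
  refine opOfBasis_spec (exists_stepVec _ _ _ ((q⁻¹ - q)⁻¹ * q ^ (-5 : ℝ)) ?_ ?_) i <;>
  · intro i t
    obtain ⟨hj, hμ, hn, hs⟩ := label_real i
    generalize (i.1.1 : ℝ) / 2 = j at *
    generalize (i.1.2.1 : ℝ) / 2 = μ at *
    generalize (i.1.2.2.1 : ℝ) / 2 = n at *
    generalize i.1.2.2.2 = s at *
    rw [abs_le] at hμ hn
    have hK : 0 ≤ (q⁻¹ - q)⁻¹ * q ^ (-5 : ℝ) := by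
      have : 1 < q⁻¹ := (one_lt_inv₀ hq0).mpr hq1
      have : 0 ≤ q⁻¹ - q := by linarith
      positivity
    have hz : ∀ y : ℝ, √y = q ^ (0 : ℝ) * √y := fun y => by simp
    fin_cases t <;> fin_cases s <;>
      simp only [betaPlus, betaMinus, Matrix.smul_apply, Matrix.of_apply, Matrix.cons_val',
        Matrix.cons_val_zero, Matrix.cons_val_one, Matrix.cons_val_fin_one, smul_eq_mul,
        Fin.zero_eta, Fin.mk_one, mul_neg, abs_neg, mul_zero, abs_zero, div_eq_mul_inv _ (qnum _ _),
        div_eq_mul_inv _ (_ * _)] <;>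
      first
      | exact hK
      | (have h2j := hs rfl
         obtain ⟨hw0, hw⟩ := one_div_qnum_mul hq0 hq1 (z := 2 * j) (z' := 2 * j + 1) (by linarith)
           (by linarith)
         rw [abs_of_nonneg (by positivity)]
         exact coef_bound hq0 hq1 rfl hw0 hw (by linarith))
      | (have h2j := hs rfl
         obtain ⟨hw0, hw⟩ := one_div_qnum hq0 hq1 (z := 2 * j) (by linarith)
         rw [abs_of_nonneg (by positivity), hz (qnum q (j + n - 1 / 2))]
         exact coef_bound hq0 hq1 rfl hw0 hw (by linarith))
      | (obtain ⟨hw0, hw⟩ := one_div_qnum hq0 hq1 (z := 2 * j + 1) (by linarith)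
         rw [abs_of_nonneg (by positivity)]
         exact coef_bound hq0 hq1 rfl hw0 hw (by linarith))
      | (obtain ⟨hw0, hw⟩ := one_div_qnum hq0 hq1 (z := 2 * j + 2) (by linarith)
         rw [abs_of_nonneg (by positivity), hz (qnum q (j - n + 3 / 2))]
         exact coef_bound hq0 hq1 rfl hw0 hw (by linarith))
      | (obtain ⟨hw0, hw⟩ := one_div_qnum_mul hq0 hq1 (z := 2 * j + 1) (z' := 2 * j + 2)
           (by linarith) (by linarith)
         rw [abs_of_nonneg (by positivity)]
         exact coef_bound hq0 hq1 rfl hw0 hw (by linarith))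

/-- The `*`-algebra `π(A(SU_q(2)))`: as `A(SU_q(2))` is generated by `a` and `b` as a `*`-algebra,
it is the `*`-subalgebra of `B(H)` generated by `π(a)` and `π(b)`. -/
def piAlgebra (q : ℝ) : StarSubalgebra ℂ (Spinor →L[ℂ] Spinor) :=
  StarAlgebra.adjoin ℂ {piA q, piB q}

/-! ### The Dirac operator -/

/-- The eigenvalue of the Dirac operator `D` on the basis vector `|j μ n s⟩`: it is `2j + 3/2` on
`↑` and `-(2j + 1/2)` on `↓`. -/
def diracEigenvalue (i : Label) : ℝ :=
  if i.1.2.2.2 = 0 then (i.1.1 : ℝ) + 3 / 2 else -((i.1.1 : ℝ) + 1 / 2)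

/-- The selfadjoint operator `|D|`, on its natural domain. -/
def absDirac : Spinor →ₗ.[ℂ] Spinor where
  domain :=
    { carrier := {f | Memℓp (fun i => ((|diracEigenvalue i| : ℝ) : ℂ) * f i) 2}
      add_mem' := fun {f g} hf hg => by
        have h := Memℓp.add hf hg
        have e : (fun i => ((|diracEigenvalue i| : ℝ) : ℂ) * (f + g) i) =
            (fun i => ((|diracEigenvalue i| : ℝ) : ℂ) * f i) +
              fun i => ((|diracEigenvalue i| : ℝ) : ℂ) * g i := by
          funext i
          simp [mul_add]
        simpa only [Set.mem_ofPred_eq, e] using h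
      zero_mem' := by
        have e : (fun i => ((|diracEigenvalue i| : ℝ) : ℂ) * (0 : Spinor) i) = 0 := by
          funext i
          simp
        simpa only [Set.mem_ofPred_eq, e] using zero_memℓp
      smul_mem' := fun c f hf => by
        have h := Memℓp.const_smul hf c
        have e : (fun i => ((|diracEigenvalue i| : ℝ) : ℂ) * (c • f) i) =
            c • fun i => ((|diracEigenvalue i| : ℝ) : ℂ) * f i := by
          funext i
          simp
          ring
        simpa only [Set.mem_ofPred_eq, e] using h }
  toFun :=
    { toFun := fun f => ⟨fun i => ((|diracEigenvalue i| : ℝ) : ℂ) * (f : Spinor) i, f.2⟩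
      map_add' := fun f g => by
        ext i
        exact mul_add _ _ _
      map_smul' := fun c f => by
        ext i
        exact mul_left_comm _ _ _ }

/-- `IsDelta T S` says that `S = δ(T) = [|D|, T]`: the bounded operator `T` maps the domain of
`|D|` to itself, and `S` is the bounded operator that extends the commutator `|D|T - T|D|`. -/
def IsDelta (T S : Spinor →L[ℂ] Spinor) : Prop :=
  ∀ v : absDirac.domain, ∃ h : T v ∈ absDirac.domain,
    absDirac ⟨T v, h⟩ - T (absDirac v) = S v

/-- A `δ`-one-form: a finite sum `∑ xᵢ δ(yᵢ)` with `xᵢ, yᵢ` in `π(A(SU_q(2)))`. -/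
def IsDeltaOneForm (q : ℝ) (A : Spinor →L[ℂ] Spinor) : Prop :=
  ∃ (n : ℕ) (x y d : Fin n → Spinor →L[ℂ] Spinor),
    (∀ k, x k ∈ piAlgebra q) ∧ (∀ k, y k ∈ piAlgebra q) ∧ (∀ k, IsDelta (y k) (d k)) ∧
      A = ∑ k, x k * d k

/-- The operator `|D|^{-s}`, for `Re s ≥ 0` (otherwise no bounded operator has these values on the
basis). -/
def absDiracPow (s : ℂ) : Spinor →L[ℂ] Spinor :=
  opOfBasis fun i => ((|diracEigenvalue i| : ℝ) : ℂ) ^ (-s) • basisVec i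

theorem one_le_abs_diracEigenvalue (i : Label) : 1 ≤ |diracEigenvalue i| := by
  obtain ⟨hj, -, -, hs⟩ := label_real i
  rw [diracEigenvalue]
  split_ifs with h
  · rw [abs_of_nonneg (by linarith)]
    linarith
  · have h1 : i.1.2.2.2 = 1 := by omega
    have := hs h1
    rw [abs_neg, abs_of_nonneg (by linarith)]
    linarith

theorem absDiracPow_basisVec {s : ℂ} (hs : 0 ≤ s.re) (i : Label) :
    absDiracPow s (basisVec i) = ((|diracEigenvalue i| : ℝ) : ℂ) ^ (-s) • basisVec i := by
  refine opOfBasis_spec ?_ i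
  refine (exists_weightedShift (fun i => ((|diracEigenvalue i| : ℝ) : ℂ) ^ (-s)) 1 some
    (fun i => ?_) (fun i i' k h h' => by simp_all))
  have h1 := one_le_abs_diracEigenvalue i
  rw [Complex.norm_cpow_eq_rpow_re_of_pos (by linarith), Complex.neg_re]
  exact Real.rpow_le_one_of_one_le_of_nonpos h1 (by linarith)

/-! ### The reality operator -/

/-- The label of `|j, -μ, -n, s⟩`, for the label of `|j μ n s⟩`. -/
def negLabel (i : Label) : Label :=
  ⟨(i.1.1, -i.1.2.1, -i.1.2.2.1, i.1.2.2.2), by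
    obtain ⟨⟨J, M, N, s⟩, h1, h2, h3, h4, h5⟩ := i
    simp only at h1 h2 h3 h4 h5
    refine ⟨h1, by simpa using h2, ?_, by simpa using h4, ?_⟩
    · change 2 ∣ J - -M
      omega
    · change 2 ∣ J + 1 - -N
      omega⟩

theorem negLabel_negLabel (i : Label) : negLabel (negLabel i) = i := by
  obtain ⟨⟨J, M, N, s⟩, h⟩ := i
  simp [negLabel]

/-- The phase of `J |j μ n s⟩`: it is `i^{2(2j+μ+n)}` on `↑` and `i^{2(2j-μ-n)}` on `↓`. -/
def phase (i : Label) : ℂ :=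
  if i.1.2.2.2 = 0 then Complex.I ^ (2 * i.1.1 + i.1.2.1 + i.1.2.2.1)
  else Complex.I ^ (2 * i.1.1 - i.1.2.1 - i.1.2.2.1)

theorem norm_phase (i : Label) : ‖phase i‖ = 1 := by
  rw [phase]
  split_ifs <;> simp

theorem phase_mul_conj (i : Label) : phase i * conj (phase i) = 1 := by
  rw [Complex.mul_conj, Complex.normSq_eq_norm_sq, norm_phase]
  simp

theorem memℓp_negLabel (c : Label → ℂ) (hc : ∀ i, ‖c i‖ = 1) (f : Spinor) :
    Memℓp (fun i => c i * conj (f (negLabel i))) 2 := by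
  have e : Function.Involutive negLabel := negLabel_negLabel
  have h := (lp.memℓp f).summable (by norm_num)
  refine memℓp_gen ?_
  simpa [hc, Function.comp_def] using
    (e.toPerm.summable_iff (f := fun i => ‖f i‖ ^ (2 : ENNReal).toReal)).mpr h

/-- The reality operator `J`: the antilinear isometry of `H` with
`J |j μ n ↑⟩ = i^{2(2j+μ+n)} |j,-μ,-n,↑⟩` and `J |j μ n ↓⟩ = i^{2(2j-μ-n)} |j,-μ,-n,↓⟩`. -/
def realityJ : Spinor ≃ₗᵢ⋆[ℂ] Spinor where
  toFun f := ⟨fun i => phase (negLabel i) * conj (f (negLabel i)),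
    memℓp_negLabel _ (fun _ => norm_phase _) f⟩
  invFun f := ⟨fun i => phase i * conj (f (negLabel i)),
    memℓp_negLabel _ (fun _ => norm_phase _) f⟩
  map_add' f g := by
    ext i
    change phase (negLabel i) * conj (f (negLabel i) + g (negLabel i)) =
      phase (negLabel i) * conj (f (negLabel i)) + phase (negLabel i) * conj (g (negLabel i))
    rw [map_add, mul_add]
  map_smul' c f := by
    ext i
    change phase (negLabel i) * conj (c * f (negLabel i)) =
      conj c * (phase (negLabel i) * conj (f (negLabel i)))
    rw [map_mul]
    ring
  left_inv f := by
    ext i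
    change phase i * conj (phase (negLabel (negLabel i)) * conj (f (negLabel (negLabel i)))) = f i
    rw [negLabel_negLabel, map_mul, Complex.conj_conj, ← mul_assoc, phase_mul_conj, one_mul]
  right_inv f := by
    ext i
    change phase (negLabel i) * conj (phase (negLabel i) * conj (f (negLabel (negLabel i)))) = f i
    rw [negLabel_negLabel, map_mul, Complex.conj_conj, ← mul_assoc, phase_mul_conj, one_mul]
  norm_map' f := by
    have e : Function.Involutive negLabel := negLabel_negLabel
    rw [lp.norm_eq_tsum_rpow (by norm_num), lp.norm_eq_tsum_rpow (by norm_num)]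
    congr 1
    rw [← e.toPerm.tsum_eq (fun i => ‖f i‖ ^ (2 : ENNReal).toReal)]
    refine tsum_congr fun i => ?_
    change ‖phase (negLabel i) * conj (f (negLabel i))‖ ^ _ = ‖f (negLabel i)‖ ^ _
    rw [norm_mul, norm_phase, one_mul, RCLike.norm_conj]

theorem realityJ_basisVec (i : Label) :
    realityJ (basisVec i) = phase i • basisVec (negLabel i) := by
  classical
  ext k
  change phase (negLabel k) * conj (basisVec i (negLabel k)) = phase i * basisVec (negLabel i) k
  by_cases h : k = negLabel i
  · subst h
    simp [negLabel_negLabel, basisVec]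
  · have h' : negLabel k ≠ i := fun hk => h (by rw [← hk, negLabel_negLabel])
    simp [basisVec, h, h']

/-- The operator `J B J⁻¹`. -/
def conjJ (B : Spinor →L[ℂ] Spinor) : Spinor →L[ℂ] Spinor :=
  (realityJ.toContinuousLinearEquiv : Spinor →L⋆[ℂ] Spinor).comp
    (B.comp (realityJ.symm.toContinuousLinearEquiv : Spinor →L⋆[ℂ] Spinor))

theorem conjJ_apply (B : Spinor →L[ℂ] Spinor) (v : Spinor) :
    conjJ B v = realityJ (B (realityJ.symm v)) := rfl

/-! ### The noncommutative integral -/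

/-- `HasTrace R t` says that the operator `R` is of trace class with trace `t`: it is a sum
`∑_k ⟪y_k, ·⟫ x_k` of operators of rank one with `∑_k ‖x_k‖ ‖y_k‖ < ∞`, and
`t = ∑_k ⟪y_k, x_k⟫`. -/
def HasTrace (R : Spinor →L[ℂ] Spinor) (t : ℂ) : Prop :=
  ∃ (κ : Type) (x y : κ → Spinor), Summable (fun k => ‖x k‖ * ‖y k‖) ∧
    (∀ v, HasSum (fun k => ⟪y k, v⟫_ℂ • x k) (R v)) ∧
    HasSum (fun k => ⟪y k, x k⟫_ℂ) t

/-- `HasResidue f z r` says, for a function `f` that is meromorphic at `z`, that its residue at `z`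
is `r`: the integral of `f` over every small circle around `z` is `2πi r`. -/
def HasResidue (f : ℂ → ℂ) (z r : ℂ) : Prop :=
  ∀ᶠ ρ : ℝ in 𝓝[>] 0, (∮ w in C(z, ρ), f w) = 2 * Real.pi * Complex.I * r

/-- `HasNCIntegral P r` says that the noncommutative integral `⨍ P` exists and is `r`: the zeta
function `ζ(s) = Tr(P |D|^{-s})` is defined for `Re s` large, it has a meromorphic continuation
to the complex plane, and the residue of the continuation at `s = 0` is `r`. -/
def HasNCIntegral (P : Spinor →L[ℂ] Spinor) (r : ℂ) : Prop :=
  ∃ f : ℂ → ℂ, (∀ z, MeromorphicAt f z) ∧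
    (∃ σ : ℝ, ∀ s : ℂ, σ < s.re → HasTrace (P * absDiracPow s) (f s)) ∧
    HasResidue f 0 r

theorem HasTrace.hasSum {R : Spinor →L[ℂ] Spinor} {t : ℂ} (h : HasTrace R t) :
    HasSum (fun i => ⟪basisVec i, R (basisVec i)⟫_ℂ) t := by
  obtain ⟨κ, x, y, hs, hR, ht⟩ := h
  have hfib : ∀ k, Summable (fun i => ‖⟪y k i, x k i⟫_ℂ‖) ∧
      ∑' i, ‖⟪y k i, x k i⟫_ℂ‖ ≤ ‖x k‖ * ‖y k‖ := by
    intro k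
    have hx := (lp.memℓp (x k)).summable (by norm_num)
    have hy := (lp.memℓp (y k)).summable (by norm_num)
    have h2 : (2 : ENNReal).toReal = 2 := by norm_num
    rw [h2] at hx hy
    have h := Real.inner_le_Lp_mul_Lq_tsum_of_nonneg (p := 2) (q := 2)
      (by constructor <;> norm_num)
      (fun i => norm_nonneg (x k i)) (fun i => norm_nonneg (y k i)) hx hy
    rw [lp.norm_eq_tsum_rpow (by norm_num), lp.norm_eq_tsum_rpow (by norm_num), h2]
    have e : ∀ i, ‖⟪y k i, x k i⟫_ℂ‖ = ‖x k i‖ * ‖y k i‖ := by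
      intro i
      simp
    simp only [e]
    exact ⟨Real.summable_mul_of_Lp_Lq_of_nonneg (p := 2) (q := 2) (by constructor <;> norm_num)
      (fun i => norm_nonneg (x k i)) (fun i => norm_nonneg (y k i)) hx hy, h⟩
  have hsum : Summable (fun z : κ × Label => ⟪y z.1 z.2, x z.1 z.2⟫_ℂ) := by
    refine Summable.of_norm ?_
    rw [summable_prod_of_nonneg (fun z => norm_nonneg _)]
    refine ⟨fun k => (hfib k).1, ?_⟩
    exact Summable.of_nonneg_of_le (fun k => tsum_nonneg fun i => norm_nonneg _)
      (fun k => (hfib k).2) hs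
  have h1 := hsum.hasSum.prod_fiberwise (fun k => lp.hasSum_inner (y k) (x k))
  have h2 : ∀ i, HasSum (fun k => ⟪y k i, x k i⟫_ℂ) ⟪basisVec i, R (basisVec i)⟫_ℂ := by
    intro i
    have h3 := (hR (basisVec i)).mapL (innerSL ℂ (basisVec i))
    rw [innerSL_apply_apply] at h3
    have e : (fun k => ⟪y k i, x k i⟫_ℂ) =
        fun k => innerSL ℂ (basisVec i) (⟪y k, basisVec i⟫_ℂ • x k) := by
      funext k
      rw [innerSL_apply_apply, inner_smul_right, inner_basisVec_left,
        ← inner_conj_symm (y k) (basisVec i), inner_basisVec_left, RCLike.inner_apply]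
      ring
    rw [e]
    exact h3
  have h4 := (hsum.prod_symm.hasSum).prod_fiberwise h2
  have h5 := (Equiv.prodComm κ Label).tsum_eq
    (fun z : Label × κ => ⟪y z.2 z.1, x z.2 z.1⟫_ℂ)
  have h6 := ht.unique h1
  rw [h6, show (∑' z : κ × Label, ⟪y z.1 z.2, x z.1 z.2⟫_ℂ) = _ from h5]
  exact h4

theorem HasNCIntegral.unique {P : Spinor →L[ℂ] Spinor} {r r' : ℂ} (h : HasNCIntegral P r)
    (h' : HasNCIntegral P r') : r = r' := by
  obtain ⟨f, hf, ⟨σ, hσ⟩, hr⟩ := h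
  obtain ⟨f', hf', ⟨σ', hσ'⟩, hr'⟩ := h'
  have hg : MeromorphicOn (f - f') Set.univ := fun z _ => (hf z).sub (hf' z)
  have hzero : ∀ s : ℂ, max σ σ' < s.re → (f - f') s = 0 := by
    intro s hs
    have h1 := (hσ s ((le_max_left _ _).trans_lt hs)).hasSum
    have h2 := (hσ' s ((le_max_right _ _).trans_lt hs)).hasSum
    exact sub_eq_zero.mpr (h1.unique h2)
  have htop : meromorphicOrderAt (f - f') ((max σ σ' + 1 : ℝ) : ℂ) = ⊤ := by
    rw [meromorphicOrderAt_eq_top_iff]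
    refine Filter.Eventually.filter_mono nhdsWithin_le_nhds ?_
    have hopen : IsOpen {s : ℂ | max σ σ' < s.re} := isOpen_lt continuous_const Complex.continuous_re
    filter_upwards [hopen.mem_nhds (by
      change max σ σ' < ((max σ σ' + 1 : ℝ) : ℂ).re
      rw [Complex.ofReal_re]
      linarith)] with s hs using hzero s hs
  have h0 : meromorphicOrderAt (f - f') 0 = ⊤ := by
    by_contra hne
    have h1 := (hg.exists_meromorphicOrderAt_ne_top_iff_forall isConnected_univ).mp
      ⟨⟨0, trivial⟩, hne⟩
    exact h1 ⟨_, trivial⟩ htop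
  rw [meromorphicOrderAt_eq_top_iff, eventually_nhdsWithin_iff, Metric.eventually_nhds_iff] at h0
  obtain ⟨ε, hε, hball⟩ := h0
  have hsmall : ∀ᶠ ρ : ℝ in 𝓝[>] 0, ρ < ε ∧ 0 < ρ := by
    filter_upwards [Ioo_mem_nhdsGT hε] with ρ hρ using ⟨hρ.2, hρ.1⟩
  obtain ⟨ρ, ⟨h1, h2⟩, h3, h4⟩ := (hr.and (hr'.and hsmall)).exists.imp
    (fun ρ h => (⟨⟨h.1, h.2.1⟩, h.2.2.1, h.2.2.2⟩ : (_ ∧ _) ∧ _ ∧ _))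
  have hcongr : (∮ w in C(0, ρ), f w) = ∮ w in C(0, ρ), f' w := by
    refine circleIntegral.integral_congr h4.le fun w hw => ?_
    have hw' : dist w 0 = ρ := hw
    have hw0 : w ≠ 0 := by
      rintro rfl
      simp at hw'
      linarith
    exact sub_eq_zero.mp (hball (by rw [hw']; exact h3) hw0)
  have hfin := (h1.symm.trans hcongr).trans h2
  exact mul_left_cancel₀ Complex.two_pi_I_ne_zero hfin

/-- `NCIntegrable P` says that the noncommutative integral of `P` exists. -/
def NCIntegrable (P : Spinor →L[ℂ] Spinor) : Prop := ∃ r, HasNCIntegral P r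

open Classical in
/-- The noncommutative integral `⨍ P`, the residue at `s = 0` of `Tr(P |D|^{-s})`. -/
def ncIntegral (P : Spinor →L[ℂ] Spinor) : ℂ :=
  if h : NCIntegrable P then h.choose else 0

theorem HasNCIntegral.ncIntegral_eq {P : Spinor →L[ℂ] Spinor} {r : ℂ} (h : HasNCIntegral P r) :
    ncIntegral P = r := by
  have h' : NCIntegrable P := ⟨r, h⟩
  rw [ncIntegral, dif_pos h']
  exact h'.choose_spec.unique h

end SUq2

end

open SUq2

namespace SUq2

/-! ### Dirichlet series of sequences with an asymptotic expansion -/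

/-! Write D for the eigenvalues n + 3/2 of |D|. The zeta function Tr(T|D|^{-s}) is the Dirichlet
series of the traces of T over the eigenspaces of |D|. If these traces are c₂D² + c₁D + c₀ plus a
rapidly decaying error, the zeta function is a combination of shifted Hurwitz zeta functions plus an
entire function. Hence ⨍T|D|^{-3} = c₂ and ⨍T|D|^{-2} = c₁ (`HasLevelExpansion.hasNCIntegral`), and
the theorem becomes a statement about these two coefficients.

To compute them, label the basis by (d, m, l, s), where |D| = d + 1/2 and (m, l) fills a rectangle
with corner (0, 0), of size d × (d+1) for ↑ and (d+1) × d for ↓. Up to errors O(q^d), the generators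
are sums of shifts in these coordinates with coefficients f(m)g(l). Here f and g converge
exponentially, and each limit vanishes unless the shift preserves the distance to the upper end of
that coordinate (`Symb`, `IsElem`, `piA_mem`, `piB_mem`). Spin flips are negligible. The span of
such operators is a *-algebra stable under δ, so it contains all δ-one-forms; everything is proved
on this span.

Only the zero shift contributes to level traces, and there the trace is a product of sums Σ_{m<N}
f(m) = NL + Σ(f − L) + O(q^N). Conjugation by J reflects m and l to their distances from the upper
ends. The diagonal of A J B J⁻¹ therefore gives convolutions Σ f(m)h(N−1−m) = NLL' + L'Σ(f − L) +
LΣ(h − L') + O(Nq^N) (`ExpLim.sum_convolution`). Multiplying these out gives (i) and (ii); the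
factor 1/2 arises because the two spins contribute one 2 on the left and two on the right. If a
shift is nonzero, the conditions on the limits make both coefficients vanish
(`IsElem.hasExpansion_mul_conjJ_zero`).

Claim (iii) is (i) for A², which lies in the span. For (iv), δ(A) and δ(A²) = δ(A)A + Aδ(A) have
zero diagonal. The first fact with (i) gives the integral involving J. The second gives the other
integral because c₂ is a trace (`hasExpansion_commutator`). -/

/-- A sequence that decays faster than every power of the index. -/
def RapidDecay (e : ℕ → ℂ) : Prop := ∀ k : ℕ, ∃ C : ℝ, ∀ n : ℕ, ‖e n‖ * ((n : ℝ) + 1) ^ k ≤ C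

/-- `t n = c₂ D² + c₁ D + c₀ + O(D^{-∞})` with `D = n + 3/2`. -/
def HasLevelExpansion (t : ℕ → ℂ) (c₂ c₁ : ℂ) : Prop :=
  ∃ c₀ : ℂ, RapidDecay fun n =>
    t n - (c₂ * ((n : ℂ) + 3 / 2) ^ 2 + c₁ * ((n : ℂ) + 3 / 2) + c₀)

theorem RapidDecay.add {e e' : ℕ → ℂ} (h : RapidDecay e) (h' : RapidDecay e') :
    RapidDecay fun n => e n + e' n := by
  intro k
  obtain ⟨C, hC⟩ := h k
  obtain ⟨C', hC'⟩ := h' k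
  refine ⟨C + C', fun n => ?_⟩
  have := mul_le_mul_of_nonneg_right (norm_add_le (e n) (e' n))
    (by positivity : 0 ≤ ((n : ℝ) + 1) ^ k)
  linarith [hC n, hC' n]

theorem RapidDecay.mono {e e' : ℕ → ℂ} (h : RapidDecay e) {K : ℝ} (j : ℕ)
    (hK : ∀ n, ‖e' n‖ ≤ K * ((n : ℝ) + 1) ^ j * ‖e n‖) : RapidDecay e' := by
  intro k
  obtain ⟨C, hC⟩ := h (j + k)
  have hC0 : 0 ≤ C := le_trans (by positivity) (hC 0)
  refine ⟨|K| * C, fun n => ?_⟩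
  calc ‖e' n‖ * ((n : ℝ) + 1) ^ k ≤ K * ((n : ℝ) + 1) ^ j * ‖e n‖ * ((n : ℝ) + 1) ^ k := by
        gcongr; exact hK n
    _ = K * (‖e n‖ * ((n : ℝ) + 1) ^ (j + k)) := by ring
    _ ≤ |K| * (‖e n‖ * ((n : ℝ) + 1) ^ (j + k)) := by gcongr; exact le_abs_self K
    _ ≤ |K| * C := by gcongr; exact hC n

theorem RapidDecay.const_mul {e : ℕ → ℂ} (h : RapidDecay e) (c : ℂ) :
    RapidDecay fun n => c * e n :=
  h.mono (K := ‖c‖) 0 fun n => by simp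

theorem rapidDecay_geometric {q : ℝ} (hq0 : 0 < q) (hq1 : q < 1) :
    RapidDecay fun n => ((q ^ n : ℝ) : ℂ) := by
  intro k
  have h1 := (tendsto_pow_const_mul_const_pow_of_lt_one k hq0.le hq1).comp (tendsto_add_atTop_nat 1)
  obtain ⟨C, hC⟩ := h1.bddAbove_range
  refine ⟨q⁻¹ * C, fun n => ?_⟩
  have h2 := hC ⟨n, rfl⟩
  simp only [Function.comp, Nat.cast_add, Nat.cast_one] at h2
  rw [Complex.norm_real, Real.norm_of_nonneg (by positivity), le_inv_mul_iff₀ hq0]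
  calc _ = ((n : ℝ) + 1) ^ k * q ^ (n + 1) := by ring
    _ ≤ C := h2

theorem RapidDecay.of_le_geometric {q : ℝ} (hq0 : 0 < q) (hq1 : q < 1) {e : ℕ → ℂ} {K : ℝ} (j : ℕ)
    (h : ∀ n, ‖e n‖ ≤ K * ((n : ℝ) + 1) ^ j * q ^ n) : RapidDecay e := by
  refine (rapidDecay_geometric hq0 hq1).mono (K := K) j fun n => ?_
  rw [Complex.norm_real, Real.norm_of_nonneg (by positivity)]
  exact h n

theorem HasLevelExpansion.add {t t' : ℕ → ℂ} {c₂ c₁ c₂' c₁' : ℂ} (h : HasLevelExpansion t c₂ c₁)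
    (h' : HasLevelExpansion t' c₂' c₁') :
    HasLevelExpansion (fun n => t n + t' n) (c₂ + c₂') (c₁ + c₁') := by
  obtain ⟨c₀, h⟩ := h
  obtain ⟨c₀', h'⟩ := h'
  refine ⟨c₀ + c₀', ?_⟩
  convert! h.add h' using 2
  ring

theorem HasLevelExpansion.const_mul {t : ℕ → ℂ} {c₂ c₁ : ℂ} (h : HasLevelExpansion t c₂ c₁)
    (a : ℂ) : HasLevelExpansion (fun n => a * t n) (a * c₂) (a * c₁) := by
  obtain ⟨c₀, h⟩ := h
  refine ⟨a * c₀, ?_⟩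
  convert! h.const_mul a using 2
  ring

theorem RapidDecay.hasLevelExpansion {t : ℕ → ℂ} (h : RapidDecay t) : HasLevelExpansion t 0 0 :=
  ⟨0, by simpa using h⟩

/-- The function `∑ (n + 3/2)^{-s}`. -/
noncomputable def levelZeta (s : ℂ) : ℂ :=
  HurwitzZeta.hurwitzZeta ((1 / 2 : ℝ) : UnitAddCircle) s - (1 / 2 : ℂ) ^ (-s)

/-- The Hurwitz parameter lives in ℝ/ℤ and is represented by 1/2, so the Hurwitz series starts with
(1/2)^{-s}. That term is removed to start at 3/2. -/
theorem hasSum_levelZeta {s : ℂ} (hs : 1 < s.re) :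
    HasSum (fun n : ℕ => ((n : ℂ) + 3 / 2) ^ (-s)) (levelZeta s) := by
  have h := HurwitzZeta.hasSum_hurwitzZeta_of_one_lt_re (a := 1 / 2) (by norm_num) hs
  have h1 := (hasSum_nat_add_iff (f := fun n : ℕ => ((n : ℂ) + (1 / 2 : ℝ)) ^ (-s)) 1
    (g := levelZeta s)).mpr (by
      convert! h using 1
      · funext n
        rw [Complex.cpow_neg]
        simp only [one_div]
      · simp [levelZeta])
  convert! h1 using 3
  push_cast
  ring

theorem differentiableAt_half_cpow (s : ℂ) :
    DifferentiableAt ℂ (fun s : ℂ => (1 / 2 : ℂ) ^ (-s)) s :=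
  (differentiableAt_id.neg).const_cpow (Or.inl (by norm_num))

theorem differentiableAt_levelZeta {s : ℂ} (hs : s ≠ 1) : DifferentiableAt ℂ levelZeta s :=
  (HurwitzZeta.differentiableAt_hurwitzZeta _ hs).sub (differentiableAt_half_cpow s)

/-- The function `(s - 1) ∑ (n + 3/2)^{-s}`, with its value at `1`. -/
noncomputable def levelZetaReg : ℂ → ℂ := Function.update (fun s => (s - 1) * levelZeta s) 1 1

theorem levelZetaReg_one : levelZetaReg 1 = 1 := by simp [levelZetaReg]

theorem levelZeta_eq {s : ℂ} (hs : s ≠ 1) : levelZeta s = (s - 1)⁻¹ * levelZetaReg s := by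
  rw [levelZetaReg, Function.update_of_ne hs, inv_mul_cancel_left₀ (sub_ne_zero.mpr hs)]

/-- Removable singularity at 1: the Hurwitz zeta function has residue 1 there, and the subtracted
term (1/2)^{-s} is regular. -/
theorem differentiable_levelZetaReg : Differentiable ℂ levelZetaReg := by
  have hoff : ∀ s : ℂ, s ≠ 1 → DifferentiableAt ℂ levelZetaReg s := by
    intro s hs
    have h : DifferentiableAt ℂ (fun s => (s - 1) * levelZeta s) s :=
      (differentiableAt_id.sub_const 1).mul (differentiableAt_levelZeta hs)
    refine h.congr_of_eventuallyEq ?_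
    filter_upwards [isOpen_ne.mem_nhds hs] with z hz
    exact Function.update_of_ne hz _ _
  intro s
  by_cases hs : s = 1
  · subst hs
    refine (Complex.analyticAt_of_differentiable_on_punctured_nhds_of_continuousAt ?_
      ?_).differentiableAt
    · filter_upwards [self_mem_nhdsWithin] with z hz using hoff z hz
    · rw [levelZetaReg, continuousAt_update_same]
      have h1 := HurwitzZeta.hurwitzZeta_residue_one ((1 / 2 : ℝ) : UnitAddCircle)
      have h2 : Tendsto (fun s : ℂ => (s - 1) * (1 / 2 : ℂ) ^ (-s)) (𝓝[≠] 1) (𝓝 0) := by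
        have h3 : ContinuousAt (fun s : ℂ => (s - 1) * (1 / 2 : ℂ) ^ (-s)) 1 :=
          (continuousAt_id.sub continuousAt_const).mul
            (differentiableAt_half_cpow 1).continuousAt
        have h4 := h3.tendsto
        simp only [sub_self, zero_mul] at h4
        exact h4.mono_left nhdsWithin_le_nhds
      have h5 := h1.sub h2
      simp only [sub_zero] at h5
      refine h5.congr fun s => ?_
      rw [levelZeta]
      ring
  · exact hoff s hs

theorem meromorphicAt_levelZeta (s : ℂ) : MeromorphicAt levelZeta s := by
  have h1 : MeromorphicAt (fun z : ℂ => (z - 1)⁻¹ * levelZetaReg z) s :=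
    (((analyticAt_id.sub analyticAt_const).meromorphicAt).inv).mul
      (differentiable_levelZetaReg.analyticAt s).meromorphicAt
  refine h1.congr ?_
  by_cases hs : s = 1
  · subst hs
    filter_upwards [self_mem_nhdsWithin] with z hz using (levelZeta_eq hz).symm
  · refine Filter.Eventually.filter_mono nhdsWithin_le_nhds ?_
    filter_upwards [isOpen_ne.mem_nhds hs] with z hz using (levelZeta_eq hz).symm

theorem meromorphicAt_levelZeta_add (a s : ℂ) : MeromorphicAt (fun z => levelZeta (z + a)) s :=
  (meromorphicAt_levelZeta (s + a)).comp_analyticAt (g := fun z => z + a)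
    (analyticAt_id.add analyticAt_const)

/-- On the punctured unit disc s f(s) agrees with a holomorphic function whose value at 0 is c;
Cauchy's formula on circles of radius less than 1 gives the residue. -/
theorem hasResidue_levelZeta {f g : ℂ → ℂ} {c : ℂ} (hf : ∀ s, f s = c * levelZeta (s + 1) + g s)
    (hg : DifferentiableOn ℂ g (Metric.ball 0 1)) : HasResidue f 0 c := by
  filter_upwards [Ioo_mem_nhdsGT (zero_lt_one (α := ℝ))] with ρ hρ
  have hsub : Metric.closedBall (0 : ℂ) ρ ⊆ Metric.ball 0 1 := Metric.closedBall_subset_ball hρ.2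
  have hd : DifferentiableOn ℂ (fun s => c * levelZetaReg (s + 1) + s * g s)
      (Metric.ball 0 1) := by
    refine DifferentiableOn.add (Differentiable.differentiableOn ?_) (differentiableOn_id.mul hg)
    exact (differentiable_levelZetaReg.comp (differentiable_id.add_const 1)).const_mul c
  have hcl : DiffContOnCl ℂ (fun s => c * levelZetaReg (s + 1) + s * g s) (Metric.ball 0 ρ) := by
    refine DifferentiableOn.diffContOnCl ?_
    rw [closure_ball _ hρ.1.ne']
    exact hd.mono hsub
  have h := hcl.circleIntegral_sub_inv_smul (w := 0) (by simpa using hρ.1)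
  simp only [sub_zero, zero_add, levelZetaReg_one, mul_one, zero_mul, add_zero, smul_eq_mul] at h
  rw [← h]
  refine circleIntegral.integral_congr hρ.1.le fun w hw => ?_
  have hw0 : w ≠ 0 := by
    rintro rfl
    simp at hw
    linarith [hρ.1]
  rw [hf, levelZeta_eq (by simpa using hw0), add_sub_cancel_right]
  field_simp

theorem norm_level_cpow (n : ℕ) (z : ℂ) :
    ‖((n : ℂ) + 3 / 2) ^ z‖ = ((n : ℝ) + 3 / 2) ^ z.re := by
  rw [← Complex.norm_cpow_eq_rpow_re_of_pos (by positivity)]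
  push_cast
  rfl

/-- Of the available decay of order k + 2, k powers absorb D^{-z} on the half-plane Re z > −k and
two leave a summable majorant. This is the input for the Weierstrass test. -/
theorem level_term_bound {e : ℕ → ℂ} (he : RapidDecay e) (k : ℕ) :
    ∃ u : ℕ → ℝ, Summable u ∧
      ∀ (n : ℕ) (z : ℂ), -(k : ℝ) < z.re → ‖e n * ((n : ℂ) + 3 / 2) ^ (-z)‖ ≤ u n := by
  obtain ⟨C, hC⟩ := he (k + 2)
  refine ⟨fun n => C * 2 ^ k * (1 / ((n : ℝ) + 1) ^ 2), ?_, fun n z hz => ?_⟩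
  · refine Summable.mul_left _ ?_
    have := (summable_nat_add_iff 1).mpr (Real.summable_one_div_nat_pow.mpr one_lt_two)
    simpa using this
  · change _ ≤ C * 2 ^ k * (1 / ((n : ℝ) + 1) ^ 2)
    rw [norm_mul, norm_level_cpow, mul_one_div, le_div_iff₀ (by positivity)]
    have h1 : ((n : ℝ) + 3 / 2) ^ (-z).re ≤ 2 ^ k * ((n : ℝ) + 1) ^ k := by
      calc ((n : ℝ) + 3 / 2) ^ (-z).re ≤ ((n : ℝ) + 3 / 2) ^ (k : ℝ) :=
            Real.rpow_le_rpow_of_exponent_le (by linarith [n.cast_nonneg (α := ℝ)])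
              (by rw [Complex.neg_re]; linarith)
        _ = ((n : ℝ) + 3 / 2) ^ k := Real.rpow_natCast _ _
        _ ≤ (2 * ((n : ℝ) + 1)) ^ k := by gcongr; linarith [n.cast_nonneg (α := ℝ)]
        _ = 2 ^ k * ((n : ℝ) + 1) ^ k := mul_pow _ _ _
    calc ‖e n‖ * ((n : ℝ) + 3 / 2) ^ (-z).re * ((n : ℝ) + 1) ^ 2
        ≤ ‖e n‖ * (2 ^ k * ((n : ℝ) + 1) ^ k) * ((n : ℝ) + 1) ^ 2 := by gcongr
      _ = (‖e n‖ * ((n : ℝ) + 1) ^ (k + 2)) * 2 ^ k := by ring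
      _ ≤ C * 2 ^ k := by gcongr; exact hC n

theorem RapidDecay.differentiable_tsum {e : ℕ → ℂ} (he : RapidDecay e) :
    Differentiable ℂ fun z : ℂ => ∑' n : ℕ, e n * ((n : ℂ) + 3 / 2) ^ (-z) := by
  intro z
  obtain ⟨k, hk⟩ := exists_nat_gt (-z.re)
  obtain ⟨u, hu, hb⟩ := level_term_bound he k
  have hopen : IsOpen {w : ℂ | -(k : ℝ) < w.re} :=
    isOpen_lt continuous_const Complex.continuous_re
  refine (Complex.differentiableOn_tsum_of_summable_norm hu (fun n => ?_) hopen
    fun n w hw => hb n w hw).differentiableAt (hopen.mem_nhds (by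
      change -(k : ℝ) < z.re
      linarith))
  have hn : (n : ℂ) + 3 / 2 ≠ 0 := by
    have : (((n : ℝ) + 3 / 2 : ℝ) : ℂ) ≠ 0 := Complex.ofReal_ne_zero.mpr (by positivity)
    simpa using this
  intro w _
  exact ((differentiableAt_id.neg.const_cpow (Or.inl hn)).const_mul (e n)).differentiableWithinAt

/-- Multiplying the expansion by D^{-z} gives c₂ζ(z−2) + c₁ζ(z−1) + c₀ζ(z) plus an entire function,
with ζ = `levelZeta`. The only possible poles are at 3, 2 and 1, so each translate has just one term
that can be singular near 0. -/
theorem HasLevelExpansion.exists_continuation {t : ℕ → ℂ} {c₂ c₁ : ℂ}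
    (h : HasLevelExpansion t c₂ c₁) :
    ∃ F : ℂ → ℂ, (∀ z a, MeromorphicAt (fun z => F (z + a)) z) ∧
      (∀ z : ℂ, 3 < z.re → HasSum (fun n : ℕ => t n * ((n : ℂ) + 3 / 2) ^ (-z)) (F z)) ∧
      HasResidue (fun z => F (z + 3)) 0 c₂ ∧ HasResidue (fun z => F (z + 2)) 0 c₁ := by
  obtain ⟨c₀, he⟩ := h
  set e : ℕ → ℂ := fun n => t n - (c₂ * ((n : ℂ) + 3 / 2) ^ 2 + c₁ * ((n : ℂ) + 3 / 2) + c₀)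
  set E : ℂ → ℂ := fun z => ∑' n : ℕ, e n * ((n : ℂ) + 3 / 2) ^ (-z)
  have hE : Differentiable ℂ E := he.differentiable_tsum
  have hEa : ∀ a, Differentiable ℂ fun z => E (z + a) := fun a =>
    hE.comp (differentiable_id.add_const a)
  -- The pole of the translate by a is at 1 − a, which lies outside the open unit disc for these a.
  have hne : ∀ z ∈ Metric.ball (0 : ℂ) 1, ∀ a : ℝ, (a ≤ 0 ∨ 2 ≤ a) →
      DifferentiableAt ℂ (fun z => levelZeta (z + a)) z := by
    intro z hz a ha
    have h1 : z + a ≠ 1 := by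
      intro h1
      have h2 : z = ((1 - a : ℝ) : ℂ) := by push_cast; linear_combination h1
      rw [mem_ball_zero_iff, h2, Complex.norm_real, Real.norm_eq_abs, abs_lt] at hz
      rcases ha with ha | ha <;> linarith
    exact (differentiableAt_levelZeta h1).comp z (differentiableAt_id.add_const _)
  refine ⟨fun z => c₂ * levelZeta (z - 2) + c₁ * levelZeta (z - 1) + c₀ * levelZeta z + E z,
    fun z a => ?_, fun z hz => ?_, ?_, ?_⟩
  · have hm := fun b => meromorphicAt_levelZeta_add b z
    have h1 : ∀ (c b : ℂ), MeromorphicAt (fun z => c * levelZeta (z + b)) z := fun c b =>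
      (MeromorphicAt.const c z).mul (hm b)
    have h2 := (((h1 c₂ (a - 2)).add (h1 c₁ (a - 1))).add (h1 c₀ a)).add
      ((hEa a).analyticAt z).meromorphicAt
    convert! h2 using 1
    funext z
    simp only [Pi.add_apply, add_sub_assoc]
  · obtain ⟨u, hu, hb⟩ := level_term_bound he 0
    have hsum : HasSum (fun n : ℕ => e n * ((n : ℂ) + 3 / 2) ^ (-z)) (E z) :=
      (Summable.of_norm_bounded hu fun n => hb n z (by simp; linarith)).hasSum
    have h2 := (hasSum_levelZeta (s := z - 2) (by simp; linarith)).mul_left c₂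
    have h1 := (hasSum_levelZeta (s := z - 1) (by simp; linarith)).mul_left c₁
    have h0 := (hasSum_levelZeta (s := z) (by linarith)).mul_left c₀
    convert! ((h2.add h1).add h0).add hsum using 1
    funext n
    have hn : (n : ℂ) + 3 / 2 ≠ 0 := by
      have : (((n : ℝ) + 3 / 2 : ℝ) : ℂ) ≠ 0 := Complex.ofReal_ne_zero.mpr (by positivity)
      simpa using this
    rw [neg_sub, neg_sub, sub_eq_add_neg, sub_eq_add_neg, Complex.cpow_add _ _ hn,
      Complex.cpow_add _ _ hn, Complex.cpow_one, Complex.cpow_ofNat]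
    simp only [e]
    ring
  · refine hasResidue_levelZeta
      (g := fun z => c₁ * levelZeta (z + (2 : ℝ)) + c₀ * levelZeta (z + (3 : ℝ)) + E (z + 3))
      (fun z => ?_) fun z hz => ?_
    · push_cast
      rw [show z + 3 - 2 = z + 1 by ring, show z + 3 - 1 = z + 2 by ring]
      ring
    · exact ((((hne z hz 2 (by norm_num)).const_mul c₁).add
        ((hne z hz 3 (by norm_num)).const_mul c₀)).add (hEa 3 z)).differentiableWithinAt
  · refine hasResidue_levelZeta
      (g := fun z => c₂ * levelZeta (z + (0 : ℝ)) + c₀ * levelZeta (z + (2 : ℝ)) + E (z + 2))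
      (fun z => ?_) fun z hz => ?_
    · push_cast
      rw [show z + 2 - 2 = z + 0 by ring, show z + 2 - 1 = z + 1 by ring]
      ring
    · exact ((((hne z hz 0 (by norm_num)).const_mul c₂).add
        ((hne z hz 2 (by norm_num)).const_mul c₀)).add (hEa 2 z)).differentiableWithinAt

/-! ### Matrix entries of bounded operators -/

theorem basisVec_apply_self (i : Label) : basisVec i i = 1 := by
  classical
  simp [basisVec]

theorem basisVec_apply_ne {i k : Label} (h : k ≠ i) : basisVec i k = 0 := by
  classical
  simp [basisVec, h]

theorem norm_basisVec (i : Label) : ‖basisVec i‖ = 1 := by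
  classical
  rw [basisVec, lp.norm_single (by norm_num)]
  simp

theorem hasSum_basisVec (v : Spinor) : HasSum (fun i => v i • basisVec i) v := by
  classical
  convert! lp.hasSum_single (p := 2) (by norm_num) v using 2 with i
  rw [basisVec, ← lp.single_smul, smul_eq_mul, mul_one]

/-- The matrix entry `⟨k|T|i⟩`. -/
noncomputable def ent (T : Spinor →L[ℂ] Spinor) (k i : Label) : ℂ := T (basisVec i) k

theorem ent_eq_inner (T : Spinor →L[ℂ] Spinor) (k i : Label) :
    ent T k i = ⟪basisVec k, T (basisVec i)⟫_ℂ := (inner_basisVec_left _ _).symm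

theorem ent_ext {T S : Spinor →L[ℂ] Spinor} (h : ∀ k i, ent T k i = ent S k i) : T = S :=
  ext_basisVec fun i => lp.ext (funext fun k => h k i)

theorem ent_add (T S : Spinor →L[ℂ] Spinor) (k i : Label) :
    ent (T + S) k i = ent T k i + ent S k i := rfl

theorem ent_smul (c : ℂ) (T : Spinor →L[ℂ] Spinor) (k i : Label) :
    ent (c • T) k i = c * ent T k i := rfl

theorem ent_zero (k i : Label) : ent 0 k i = 0 := rfl

theorem norm_ent_le (T : Spinor →L[ℂ] Spinor) (k i : Label) : ‖ent T k i‖ ≤ ‖T‖ := by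
  rw [ent_eq_inner]
  refine (norm_inner_le_norm _ _).trans ?_
  rw [norm_basisVec, one_mul]
  simpa [norm_basisVec] using T.le_opNorm (basisVec i)

theorem ent_star (T : Spinor →L[ℂ] Spinor) (k i : Label) : ent (star T) k i = conj (ent T i k) := by
  rw [ent_eq_inner, ent_eq_inner, ContinuousLinearMap.star_eq_adjoint,
    ContinuousLinearMap.adjoint_inner_right, inner_conj_symm]

theorem hasSum_apply (T : Spinor →L[ℂ] Spinor) (v : Spinor) (k : Label) :
    HasSum (fun i => ent T k i * v i) (T v k) := by
  have h := ((hasSum_basisVec v).mapL T).mapL (innerSL ℂ (basisVec k))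
  simp only [innerSL_apply_apply, map_smul, inner_basisVec_left] at h
  convert! h using 2
  exact mul_comm _ _

theorem hasSum_ent_mul (T S : Spinor →L[ℂ] Spinor) (k i : Label) :
    HasSum (fun j => ent T k j * ent S j i) (ent (T * S) k i) :=
  hasSum_apply T (S (basisVec i)) k

theorem ent_mul_of_unique {T S : Spinor →L[ℂ] Spinor} {k i : Label} (j : Label)
    (h : ∀ j', j' ≠ j → ent T k j' * ent S j' i = 0) :
    ent (T * S) k i = ent T k j * ent S j i :=
  (hasSum_ent_mul T S k i).unique (hasSum_single j h)

theorem ent_mul_eq_zero {T S : Spinor →L[ℂ] Spinor} {k i : Label}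
    (h : ∀ j, ent T k j * ent S j i = 0) : ent (T * S) k i = 0 := by
  rw [(hasSum_ent_mul T S k i).unique (hasSum_zero.congr_fun h)]

theorem realityJ_symm_basisVec (i : Label) :
    realityJ.symm (basisVec i) = phase (negLabel i) • basisVec (negLabel i) := by
  ext k
  change phase k * conj (basisVec i (negLabel k)) = phase (negLabel i) * basisVec (negLabel i) k
  by_cases h : k = negLabel i
  · subst h
    simp [negLabel_negLabel, basisVec_apply_self]
  · have h' : negLabel k ≠ i := fun hk => h (by rw [← hk, negLabel_negLabel])
    simp [basisVec_apply_ne h, basisVec_apply_ne h']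

theorem ent_conjJ (B : Spinor →L[ℂ] Spinor) (k i : Label) :
    ent (conjJ B) k i = phase (negLabel k) * conj (phase (negLabel i)) *
      conj (ent B (negLabel k) (negLabel i)) := by
  rw [ent, conjJ_apply, realityJ_symm_basisVec, map_smul]
  change phase (negLabel k) * conj (phase (negLabel i) * ent B (negLabel k) (negLabel i)) = _
  rw [map_mul, mul_assoc]

theorem conjJ_add (B B' : Spinor →L[ℂ] Spinor) : conjJ (B + B') = conjJ B + conjJ B' := by
  refine ent_ext fun k i => ?_
  simp only [ent_add, ent_conjJ, map_add, mul_add]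

theorem conjJ_smul (c : ℂ) (B : Spinor →L[ℂ] Spinor) : conjJ (c • B) = conj c • conjJ B := by
  refine ent_ext fun k i => ?_
  simp only [ent_smul, ent_conjJ, map_mul]
  ring

theorem conjJ_zero : conjJ 0 = 0 := by
  refine ent_ext fun k i => ?_
  simp only [ent_zero, ent_conjJ, map_zero, mul_zero]

/-- The commutator with `|D|` in terms of matrix entries. -/
theorem isDelta_iff {T S : Spinor →L[ℂ] Spinor} :
    IsDelta T S ↔
      ∀ k i, ent S k i = ((|diracEigenvalue k| - |diracEigenvalue i| : ℝ) : ℂ) * ent T k i := by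
  constructor
  · intro h k i
    have hmem : basisVec i ∈ absDirac.domain := by
      change Memℓp (fun k => ((|diracEigenvalue k| : ℝ) : ℂ) * basisVec i k) 2
      convert! lp.memℓp (((|diracEigenvalue i| : ℝ) : ℂ) • basisVec i) using 1
      funext k
      by_cases hk : k = i
      · subst hk
        rfl
      · change _ = ((|diracEigenvalue i| : ℝ) : ℂ) * basisVec i k
        simp [basisVec_apply_ne hk]
    obtain ⟨h1, h2⟩ := h ⟨basisVec i, hmem⟩
    have h3 : absDirac ⟨basisVec i, hmem⟩ = ((|diracEigenvalue i| : ℝ) : ℂ) • basisVec i := by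
      ext k
      change ((|diracEigenvalue k| : ℝ) : ℂ) * basisVec i k =
        ((|diracEigenvalue i| : ℝ) : ℂ) * basisVec i k
      by_cases hk : k = i
      · rw [hk]
      · simp [basisVec_apply_ne hk]
    rw [h3, map_smul] at h2
    have h4 : ((|diracEigenvalue k| : ℝ) : ℂ) * ent T k i -
        ((|diracEigenvalue i| : ℝ) : ℂ) * ent T k i = ent S k i :=
      congrArg (fun v : Spinor => v k) h2
    rw [← h4]
    push_cast
    ring
  · intro h v
    set w : Spinor := absDirac v with hw
    -- The identity |D|Tv = Sv + T|D|v, read entry by entry, shows that Tv lies in the domain: the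
    -- right side is square summable.
    have key : ∀ k, ((|diracEigenvalue k| : ℝ) : ℂ) * T v k = (S v + T w) k := by
      intro k
      have h1 := (hasSum_apply S v k).add (hasSum_apply T w k)
      have h2 := (hasSum_apply T v k).mul_left ((|diracEigenvalue k| : ℝ) : ℂ)
      refine h2.unique (h1.congr_fun fun i => ?_)
      have hwi : w i = ((|diracEigenvalue i| : ℝ) : ℂ) * (v : Spinor) i := rfl
      rw [h, hwi]
      push_cast
      ring
    have hmem : T v ∈ absDirac.domain := by
      change Memℓp (fun k => ((|diracEigenvalue k| : ℝ) : ℂ) * T v k) 2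
      rw [funext key]
      exact lp.memℓp (S v + T w)
    refine ⟨hmem, ?_⟩
    ext k
    change ((|diracEigenvalue k| : ℝ) : ℂ) * T v k - T w k = S v k
    rw [key]
    exact add_sub_cancel_right _ _

/-! ### Coordinates adapted to the level sets of `|D|` -/

/-- The coordinates `(d, m, l, s)` of a label: `|D|` has eigenvalue `d + 1/2`, and
`m`, `l` count from `0`. -/
def pos (i : Label) : ℤ × ℤ × ℤ × Fin 2 :=
  (i.1.1 + 1 - (i.1.2.2.2 : ℕ), (i.1.1 + i.1.2.1) / 2,
    (i.1.1 + i.1.2.2.1 + 1) / 2 - (i.1.2.2.2 : ℕ), i.1.2.2.2)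

/-- The range of the coordinates. -/
def Valid (x : ℤ × ℤ × ℤ × Fin 2) : Prop :=
  0 ≤ x.2.1 ∧ x.2.1 < x.1 + (x.2.2.2 : ℕ) ∧ 0 ≤ x.2.2.1 ∧ x.2.2.1 < x.1 + 1 - (x.2.2.2 : ℕ)

theorem isLabel_iff {J M N : ℤ} {s : Fin 2} : IsLabel (J, M, N, s) ↔
    0 ≤ J ∧ |M| ≤ J ∧ 2 ∣ J - M ∧ |N| ≤ J + 1 - 2 * (s : ℕ) ∧ 2 ∣ J + 1 - N := by
  have : (J + if s = 0 then 1 else -1) = J + 1 - 2 * ((s : ℕ) : ℤ) := by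
    fin_cases s
    · simp
    · simp
      ring
  simp only [IsLabel]
  rw [this]

theorem valid_pos (i : Label) : Valid (pos i) := by
  obtain ⟨⟨J, M, N, s⟩, h⟩ := i
  rw [isLabel_iff, abs_le, abs_le] at h
  have := s.isLt
  simp only [Valid, pos]
  omega

theorem pos_injective : Function.Injective pos := by
  rintro ⟨⟨J, M, N, s⟩, h⟩ ⟨⟨J', M', N', s'⟩, h'⟩ e
  rw [isLabel_iff] at h h'
  simp only [pos, Prod.mk.injEq] at e
  obtain ⟨e1, e2, e3, rfl⟩ := e
  simp only [Subtype.mk.injEq, Prod.mk.injEq, and_true]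
  omega

theorem exists_pos_eq {x : ℤ × ℤ × ℤ × Fin 2} (h : Valid x) : ∃ i, pos i = x := by
  obtain ⟨d, m, l, s⟩ := x
  simp only [Valid] at h
  have := s.isLt
  refine ⟨⟨(d - 1 + (s : ℕ), 2 * m - (d - 1 + (s : ℕ)), 2 * l - d + (s : ℕ), s), ?_⟩, ?_⟩
  · rw [isLabel_iff, abs_le, abs_le]
    omega
  · simp only [pos, Prod.mk.injEq, and_true]
    omega

/-- The label change made by J keeps d and s and replaces m and l by their distances from the upper
ends of their ranges. This is what turns products with J B J⁻¹ into convolutions. -/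
theorem pos_negLabel (i : Label) : pos (negLabel i) =
    ((pos i).1, (pos i).1 - 1 + ((pos i).2.2.2 : ℕ) - (pos i).2.1,
      (pos i).1 - ((pos i).2.2.2 : ℕ) - (pos i).2.2.1, (pos i).2.2.2) := by
  obtain ⟨⟨J, M, N, s⟩, h⟩ := i
  rw [isLabel_iff] at h
  simp only [negLabel, pos, Prod.mk.injEq, and_true, true_and]
  omega

theorem abs_diracEigenvalue (i : Label) : |diracEigenvalue i| = ((pos i).1 : ℝ) + 1 / 2 := by
  obtain ⟨⟨J, M, N, s⟩, h⟩ := i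
  have hJ : (0 : ℝ) ≤ J := by exact_mod_cast h.1
  fin_cases s
  · simp only [diracEigenvalue, pos, Fin.zero_eta, Fin.isValue, ↓reduceIte]
    rw [abs_of_nonneg (by positivity)]
    push_cast
    simp
    ring
  · simp only [diracEigenvalue, pos, Fin.mk_one, Fin.isValue, one_ne_zero, ↓reduceIte]
    rw [abs_neg, abs_of_nonneg (by positivity)]
    push_cast
    simp

/-! ### Eigenspaces of |D|, level traces and the zeta function -/

/-- The index type of the labels with `d = n + 1`. -/
abbrev LevelIndex (n : ℕ) : Type := Σ s : Fin 2, Fin (n + 1 + s) × Fin (n + 2 - s)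

theorem valid_level (n : ℕ) (x : LevelIndex n) :
    Valid ((n : ℤ) + 1, ((x.2.1 : ℕ) : ℤ), ((x.2.2 : ℕ) : ℤ), x.1) := by
  obtain ⟨s, m, l⟩ := x
  have := m.isLt
  have := l.isLt
  have := s.isLt
  simp only [Valid]
  omega

/-- The labels with `d = n + 1`. -/
noncomputable def levelLabel (n : ℕ) (x : LevelIndex n) : Label :=
  (exists_pos_eq (valid_level n x)).choose

theorem pos_levelLabel (n : ℕ) (x : LevelIndex n) :
    pos (levelLabel n x) = ((n : ℤ) + 1, ((x.2.1 : ℕ) : ℤ), ((x.2.2 : ℕ) : ℤ), x.1) :=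
  (exists_pos_eq (valid_level n x)).choose_spec

theorem levelLabel_bijective :
    Function.Bijective fun x : Σ n, LevelIndex n => levelLabel x.1 x.2 := by
  constructor
  · rintro ⟨n, s, m, l⟩ ⟨n', s', m', l'⟩ h
    have h1 := congrArg pos h
    simp only [pos_levelLabel, Prod.mk.injEq] at h1
    obtain ⟨h2, h3, h4, rfl⟩ := h1
    have h5 : n = n' := by omega
    subst h5
    have h6 : m = m' := by ext; omega
    have h7 : l = l' := by ext; omega
    rw [h6, h7]
  · intro i
    have h := valid_pos i
    generalize hx : pos i = x at h
    obtain ⟨d, m, l, s⟩ := x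
    simp only [Valid] at h
    have := s.isLt
    refine ⟨⟨(d - 1).toNat, s, ⟨m.toNat, by omega⟩, ⟨l.toNat, by omega⟩⟩, pos_injective ?_⟩
    rw [pos_levelLabel, hx]
    simp only [Prod.mk.injEq, and_true]
    omega

/-- The trace of `T` over the eigenspace of `|D|` for the eigenvalue `n + 3/2`. -/
noncomputable def levelTrace (T : Spinor →L[ℂ] Spinor) (n : ℕ) : ℂ :=
  ∑ x : LevelIndex n, ent T (levelLabel n x) (levelLabel n x)

theorem card_levelIndex (n : ℕ) : Fintype.card (LevelIndex n) = 2 * ((n + 1) * (n + 2)) := by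
  simp only [Fintype.card_sigma, Fintype.card_prod, Fintype.card_fin, Fin.sum_univ_two,
    Fin.val_zero, Fin.val_one]
  rw [show n + 2 - 1 = n + 1 by omega, Nat.sub_zero]
  ring

theorem dirac_levelLabel (n : ℕ) (x : LevelIndex n) :
    |diracEigenvalue (levelLabel n x)| = (n : ℝ) + 3 / 2 := by
  rw [abs_diracEigenvalue, pos_levelLabel]
  push_cast
  ring

theorem absDiracPow_mul {s t : ℂ} (hs : 0 ≤ s.re) (ht : 0 ≤ t.re) :
    absDiracPow s * absDiracPow t = absDiracPow (s + t) := by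
  refine ext_basisVec fun i => ?_
  have h1 : (((|diracEigenvalue i| : ℝ)) : ℂ) ≠ 0 := by
    have := one_le_abs_diracEigenvalue i
    exact Complex.ofReal_ne_zero.mpr (by linarith)
  rw [mul_apply_eq_comp, absDiracPow_basisVec ht, map_smul, absDiracPow_basisVec hs,
    absDiracPow_basisVec (by simp; linarith), smul_smul, ← Complex.cpow_add _ _ h1]
  congr 2
  ring

/-- Level n carries 2(n+1)(n+2) ≤ 4(n + 3/2)² labels, so the sum is dominated by a multiple of Σ (n
+ 3/2)^{2−σ}. -/
theorem summable_diracEigenvalue {σ : ℝ} (hσ : 3 < σ) :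
    Summable fun i => |diracEigenvalue i| ^ (-σ) := by
  rw [← (Equiv.ofBijective _ levelLabel_bijective).summable_iff, summable_sigma_of_nonneg
    (fun x => by simp only [Function.comp]; positivity)]
  refine ⟨fun n => (hasSum_fintype _).summable, ?_⟩
  have h1 := (hasSum_levelZeta (s := ((σ - 2 : ℝ) : ℂ)) (by simp; linarith)).summable.norm
  refine Summable.of_nonneg_of_le (fun n => tsum_nonneg fun x => by
    simp only [Function.comp]; positivity) (fun n => ?_) (h1.mul_left 4)
  rw [tsum_fintype, norm_level_cpow]
  simp only [Function.comp, Equiv.ofBijective_apply, dirac_levelLabel]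
  rw [Finset.sum_const, Finset.card_univ, card_levelIndex, nsmul_eq_mul]
  have h2 : (0 : ℝ) < (n : ℝ) + 3 / 2 := by positivity
  have h3 : ((n : ℝ) + 3 / 2) ^ (-((σ - 2 : ℝ) : ℂ)).re =
      ((n : ℝ) + 3 / 2) ^ 2 * ((n : ℝ) + 3 / 2) ^ (-σ) := by
    rw [← Real.rpow_natCast, ← Real.rpow_add h2]
    congr 1
    simp
    ring
  rw [h3, ← mul_assoc 4]
  refine mul_le_mul_of_nonneg_right ?_ (Real.rpow_nonneg h2.le _)
  push_cast
  nlinarith [n.cast_nonneg (α := ℝ)]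

theorem hasTrace_mul_absDiracPow {T : Spinor →L[ℂ] Spinor} {F : ℂ → ℂ} {z : ℂ} (hz : 3 < z.re)
    (hF : HasSum (fun n : ℕ => levelTrace T n * ((n : ℂ) + 3 / 2) ^ (-z)) (F z)) :
    HasTrace (T * absDiracPow z) (F z) := by
  have hz0 : 0 ≤ z.re := by linarith
  have happ : ∀ i, (T * absDiracPow z) (basisVec i) =
      ((|diracEigenvalue i| : ℝ) : ℂ) ^ (-z) • T (basisVec i) := fun i => by
    rw [mul_apply_eq_comp, absDiracPow_basisVec hz0, map_smul]
  have hnorm : ∀ i, ‖((|diracEigenvalue i| : ℝ) : ℂ) ^ (-z)‖ = |diracEigenvalue i| ^ (-z.re) :=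
    fun i => by
      rw [Complex.norm_cpow_eq_rpow_re_of_pos
        (by linarith [one_le_abs_diracEigenvalue i]), Complex.neg_re]
  have hsum : Summable fun i => ‖(T * absDiracPow z) (basisVec i)‖ := by
    refine Summable.of_nonneg_of_le (fun i => norm_nonneg _) (fun i => ?_)
      ((summable_diracEigenvalue hz).mul_left ‖T‖)
    rw [happ, norm_smul, hnorm, mul_comm]
    gcongr
    simpa [norm_basisVec] using T.le_opNorm (basisVec i)
  -- The rank-one decomposition is R = Σ ⟨e_i, ·⟩ R e_i over the basis, whose norms are dominated by
  -- ‖T‖ times the eigenvalues of |D|^{−Re z}.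
  refine ⟨Label, fun i => (T * absDiracPow z) (basisVec i), basisVec, ?_, fun v => ?_, ?_⟩
  · simpa [norm_basisVec] using hsum
  · simpa [inner_basisVec_left] using (hasSum_basisVec v).mapL (T * absDiracPow z)
  · rw [← (Equiv.ofBijective _ levelLabel_bijective).hasSum_iff]
    have hs : Summable fun i => ⟪basisVec i, (T * absDiracPow z) (basisVec i)⟫_ℂ := by
      refine Summable.of_norm_bounded hsum fun i => ?_
      simpa [norm_basisVec] using norm_inner_le_norm (basisVec i)
        ((T * absDiracPow z) (basisVec i))
    refine hF.sigma_of_hasSum (fun n => ?_)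
      ((Equiv.ofBijective _ levelLabel_bijective).summable_iff.mpr hs)
    have e : ∀ x : LevelIndex n, ⟪basisVec (levelLabel n x),
        (T * absDiracPow z) (basisVec (levelLabel n x))⟫_ℂ =
        ent T (levelLabel n x) (levelLabel n x) * ((n : ℂ) + 3 / 2) ^ (-z) := by
      intro x
      rw [happ, inner_smul_right, ← ent_eq_inner, dirac_levelLabel, mul_comm]
      push_cast
      rfl
    simp only [Function.comp, Equiv.ofBijective_apply, e, levelTrace, Finset.sum_mul]
    exact hasSum_fintype _

theorem HasLevelExpansion.hasNCIntegral {T : Spinor →L[ℂ] Spinor} {c₂ c₁ : ℂ}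
    (h : HasLevelExpansion (levelTrace T) c₂ c₁) :
    HasNCIntegral (T * absDiracPow 3) c₂ ∧ HasNCIntegral (T * absDiracPow 2) c₁ := by
  obtain ⟨F, hm, hF, h3, h2⟩ := h.exists_continuation
  -- For Re s > 1 both s + 3 and s + 2 have real part greater than 3, where the Dirichlet series
  -- converges.
  refine ⟨⟨_, fun z => hm z 3, ⟨1, fun s hs => ?_⟩, h3⟩,
    ⟨_, fun z => hm z 2, ⟨1, fun s hs => ?_⟩, h2⟩⟩
  · rw [mul_assoc, absDiracPow_mul (by norm_num) (by linarith), add_comm]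
    have h4 : 3 < (s + 3).re := by simp; linarith
    exact hasTrace_mul_absDiracPow h4 (hF _ h4)
  · rw [mul_assoc, absDiracPow_mul (by norm_num) (by linarith), add_comm]
    have h4 : 3 < (s + 2).re := by simp; linarith
    exact hasTrace_mul_absDiracPow h4 (hF _ h4)

/-! ### Symbols of shift operators -/

/-- A coefficient function in one coordinate of a shift by `b` in that coordinate and by `a` in
`d`: it converges exponentially fast to `L`, it vanishes where the shift leaves `[0, ∞)`, and
its limit is zero unless the shift preserves the distance to the upper end of the range. -/
structure Symb (q : ℝ) (a b : ℤ) (f : ℤ → ℂ) (L : ℂ) : Prop where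
  bdd : ∃ K : ℝ, ∀ m, ‖f m‖ ≤ K
  lim : ∃ C : ℝ, ∀ m, ‖f m - L‖ ≤ C * q ^ m
  supp : ∀ m, m < 0 ∨ m + b < 0 → f m = 0
  off : a ≠ b → L = 0

theorem norm_mul_sub_mul_le {x F y G : ℂ} {X Y A B : ℝ} (hx : ‖x‖ ≤ X) (hG : ‖G‖ ≤ Y)
    (hxF : ‖x - F‖ ≤ A) (hyG : ‖y - G‖ ≤ B) : ‖x * y - F * G‖ ≤ X * B + A * Y := by
  have hX : 0 ≤ X := (norm_nonneg _).trans hx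
  have hA : 0 ≤ A := (norm_nonneg _).trans hxF
  calc ‖x * y - F * G‖ = ‖x * (y - G) + (x - F) * G‖ := by ring_nf
    _ ≤ ‖x‖ * ‖y - G‖ + ‖x - F‖ * ‖G‖ := by
        simpa only [norm_mul] using norm_add_le (x * (y - G)) ((x - F) * G)
    _ ≤ X * B + A * Y := by gcongr

section

variable {q : ℝ}

theorem nonneg_of_norm_le_zpow (hq0 : 0 < q) {z : ℂ} {C : ℝ} {m : ℤ} (h : ‖z‖ ≤ C * q ^ m) :
    0 ≤ C :=
  nonneg_of_mul_nonneg_left ((norm_nonneg _).trans h) (zpow_pos hq0 m)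

/-- If the total shift moves relative to the upper end, at least one factor does, and its limit is
zero. -/
theorem Symb.mul (hq0 : 0 < q) {a b a' b' : ℤ} {f f' : ℤ → ℂ} {L L' : ℂ}
    (h' : Symb q a' b' f' L') (h : Symb q a b f L) :
    Symb q (a' + a) (b' + b) (fun m => f' (m + b) * f m) (L' * L) := by
  obtain ⟨K, hK⟩ := h.bdd
  obtain ⟨K', hK'⟩ := h'.bdd
  obtain ⟨C, hC⟩ := h.lim
  obtain ⟨C', hC'⟩ := h'.lim
  refine ⟨⟨K' * K, fun m => ?_⟩, ⟨K' * C + C' * q ^ b * ‖L‖, fun m => ?_⟩, fun m hm => ?_,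
    fun hab => ?_⟩
  · rw [norm_mul]
    exact mul_le_mul (hK' _) (hK _) (norm_nonneg _) ((norm_nonneg _).trans (hK' 0))
  · refine (norm_mul_sub_mul_le (hK' _) le_rfl (hC' _) (hC m)).trans (le_of_eq ?_)
    rw [zpow_add₀ hq0.ne']
    ring
  · rcases hm with hm | hm
    · rw [h.supp m (Or.inl hm), mul_zero]
    · rw [h'.supp (m + b) (Or.inr (by omega)), zero_mul]
  · by_cases hab' : a = b
    · rw [h'.off (by omega), zero_mul]
    · rw [h.off hab', mul_zero]

theorem Symb.conj_symm (hq0 : 0 < q) {a b : ℤ} {f : ℤ → ℂ} {L : ℂ} (h : Symb q a b f L) :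
    Symb q (-a) (-b) (fun m => conj (f (m - b))) (conj L) := by
  obtain ⟨K, hK⟩ := h.bdd
  obtain ⟨C, hC⟩ := h.lim
  refine ⟨⟨K, fun m => by simpa using hK _⟩, ⟨C * q ^ (-b), fun m => ?_⟩, fun m hm => ?_,
    fun hab => ?_⟩
  · rw [← map_sub, RCLike.norm_conj, mul_assoc, ← zpow_add₀ hq0.ne', neg_add_eq_sub]
    exact hC _
  · rw [h.supp (m - b) (by omega), map_zero]
  · rw [h.off (by omega), map_zero]

/-- The coefficient is negligible where the shift leaves the range of the coordinate. -/
theorem Symb.boundary (hq0 : 0 < q) (hq1 : q < 1) {a b : ℤ} {f : ℤ → ℂ} {L : ℂ}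
    (h : Symb q a b f L) :
    ∃ C : ℝ, 0 ≤ C ∧ ∀ d m s : ℤ, s ≤ 1 → 0 ≤ s → m < d + s →
      ¬ (0 ≤ m + b ∧ m + b < d + a + s) → ‖f m‖ ≤ C * q ^ d := by
  obtain ⟨C, hC⟩ := h.lim
  have hC0 := nonneg_of_norm_le_zpow hq0 (hC 0)
  refine ⟨C * q ^ (a - b), by positivity, fun d m s hs hs0 hm hv => ?_⟩
  by_cases hmb : m + b < 0
  · rw [h.supp m (Or.inr hmb), norm_zero]
    positivity
  -- Here the shift leaves through the upper end, which is impossible when a = b. Hence L = 0 and ‖f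
  -- m‖ ≤ C q^m with m ≥ d + a − b.
  · have hab : a ≠ b := by
      rintro rfl
      omega
    have h1 := hC m
    rw [h.off hab, sub_zero] at h1
    refine h1.trans ?_
    rw [mul_assoc, ← zpow_add₀ hq0.ne']
    gcongr 1
    exact zpow_le_zpow_right_of_le_one₀ hq0 hq1.le (by omega)

theorem symb_zero (q : ℝ) (a b : ℤ) : Symb q a b (fun _ => 0) 0 :=
  ⟨⟨0, by simp⟩, ⟨0, by simp⟩, fun _ _ => rfl, fun _ => rfl⟩

/-! ### Shift operators with a symbol -/

/-- `T` moves the coordinates of the basis vectors by `σ`, and up to terms `O(q^d)` its coefficients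
are products `f m * g l`. -/
structure IsElem (q : ℝ) (σ : ℤ × ℤ × ℤ × Fin 2) (f g : ℤ → ℂ) (L M : ℂ)
    (T : Spinor →L[ℂ] Spinor) : Prop where
  shift : ∀ i k, pos k ≠ pos i + σ → ent T k i = 0
  approx : ∃ C : ℝ, ∀ i k, pos k = pos i + σ →
    ‖ent T k i - f (pos i).2.1 * g (pos i).2.2.1‖ ≤ C * q ^ (pos i).1
  symb_fst : Symb q σ.1 σ.2.1 f L
  symb_snd : Symb q σ.1 σ.2.2.1 g M
  flip : σ.2.2.2 ≠ 0 → f = 0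

/-- Where the shift leaves the set of labels the operator has no matrix entry, while f and g still
predict one. The prediction is O(q^d), so symbols can be multiplied without boundary corrections. -/
theorem symb_mul_boundary (hq0 : 0 < q) (hq1 : q < 1) {σ : ℤ × ℤ × ℤ × Fin 2} {f g : ℤ → ℂ}
    {L M : ℂ}
    (hf : Symb q σ.1 σ.2.1 f L) (hg : Symb q σ.1 σ.2.2.1 g M) (hflip : σ.2.2.2 ≠ 0 → f = 0) :
    ∃ C : ℝ, 0 ≤ C ∧ ∀ x, Valid x → ¬ Valid (x + σ) →
      ‖f x.2.1 * g x.2.2.1‖ ≤ C * q ^ x.1 := by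
  obtain ⟨K, hK⟩ := hf.bdd
  obtain ⟨K', hK'⟩ := hg.bdd
  obtain ⟨C, hC0, hC⟩ := hf.boundary hq0 hq1
  obtain ⟨C', hC0', hC'⟩ := hg.boundary hq0 hq1
  have hK0 : 0 ≤ K := (norm_nonneg _).trans (hK 0)
  have hK0' : 0 ≤ K' := (norm_nonneg _).trans (hK' 0)
  refine ⟨C * K' + K * C', by positivity, fun x hx hv => ?_⟩
  obtain ⟨d, m, l, s⟩ := x
  obtain ⟨a, b, c, ε⟩ := σ
  simp only at hK hK' hC hC' hflip ⊢
  by_cases hε : ε = 0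
  · subst hε
    have := s.isLt
    simp only [Valid, Prod.mk_add_mk, add_zero] at hx hv
    have h1 : ¬ (0 ≤ m + b ∧ m + b < d + a + (s : ℕ)) ∨
        ¬ (0 ≤ l + c ∧ l + c < d + a + (1 - (s : ℕ))) := by omega
    rw [norm_mul, add_mul]
    rcases h1 with h1 | h1
    · have h2 := mul_le_mul (hC d m (s : ℕ) (by omega) (by omega) (by omega) h1) (hK' l)
        (norm_nonneg _) (by positivity)
      have h3 : 0 ≤ K * C' * q ^ d := by positivity
      nlinarith
    · have h2 := mul_le_mul (hK m) (hC' d l (1 - (s : ℕ)) (by omega) (by omega) (by omega) h1)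
        (norm_nonneg _) (by positivity)
      have h3 : 0 ≤ C * K' * q ^ d := by positivity
      nlinarith
  · rw [hflip hε]
    simp only [Pi.zero_apply, zero_mul, norm_zero]
    positivity

/-- A shift leaves at most one intermediate label, so an entry of the product is a product of two
entries. If the intermediate label does not exist, the entry is zero and its symbol is negligible by
`symb_mul_boundary`. -/
theorem IsElem.mul (hq0 : 0 < q) (hq1 : q < 1) {σ σ' : ℤ × ℤ × ℤ × Fin 2} {f g f' g' : ℤ → ℂ}
    {L M L' M' : ℂ} {T T' : Spinor →L[ℂ] Spinor} (h' : IsElem q σ' f' g' L' M' T')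
    (h : IsElem q σ f g L M T) :
    IsElem q (σ' + σ) (fun m => f' (m + σ.2.1) * f m) (fun l => g' (l + σ.2.2.1) * g l)
      (L' * L) (M' * M) (T' * T) := by
  have hent : ∀ i j k, pos j = pos i + σ → ent (T' * T) k i = ent T' k j * ent T j i := by
    intro i j k hj
    refine ent_mul_of_unique j fun j' hj' => ?_
    rw [h.shift i j' (fun he => hj' (pos_injective (he.trans hj.symm))), mul_zero]
  have hent0 : ∀ i k, ¬ Valid (pos i + σ) → ent (T' * T) k i = 0 := by
    intro i k hv
    refine ent_mul_eq_zero fun j => ?_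
    rw [h.shift i j (fun he => hv (he ▸ valid_pos j)), mul_zero]
  refine ⟨fun i k hk => ?_, ?_, h'.symb_fst.mul hq0 h.symb_fst, h'.symb_snd.mul hq0 h.symb_snd,
    fun hε => ?_⟩
  · by_cases hv : Valid (pos i + σ)
    · obtain ⟨j, hj⟩ := exists_pos_eq hv
      rw [hent i j k hj, h'.shift j k, zero_mul]
      rw [hj]
      rw [add_comm σ', ← add_assoc] at hk
      exact hk
    · exact hent0 i k hv
  · obtain ⟨C, hC⟩ := h.approx
    obtain ⟨C', hC'⟩ := h'.approx
    obtain ⟨K, hK⟩ := h.symb_fst.bdd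
    obtain ⟨N, hN⟩ := h.symb_snd.bdd
    obtain ⟨K', hK'⟩ := h'.symb_fst.bdd
    obtain ⟨N', hN'⟩ := h'.symb_snd.bdd
    obtain ⟨B, hB0, hB⟩ := symb_mul_boundary hq0 hq1 h.symb_fst h.symb_snd h.flip
    have hK0 : 0 ≤ K := (norm_nonneg _).trans (hK 0)
    have hN0 : 0 ≤ N := (norm_nonneg _).trans (hN 0)
    have hK0' : 0 ≤ K' := (norm_nonneg _).trans (hK' 0)
    have hN0' : 0 ≤ N' := (norm_nonneg _).trans (hN' 0)
    refine ⟨max (‖T'‖ * C + C' * q ^ σ.1 * (K * N)) (K' * N' * B), fun i k hk => ?_⟩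
    rw [mul_mul_mul_comm]
    by_cases hv : Valid (pos i + σ)
    · obtain ⟨j, hj⟩ := exists_pos_eq hv
      rw [hent i j k hj]
      have h1 := hC' j k (by rw [hj, hk, add_comm σ', add_assoc])
      rw [hj] at h1
      have h2 : ‖f (pos i).2.1 * g (pos i).2.2.1‖ ≤ K * N := by
        rw [norm_mul]
        exact mul_le_mul (hK _) (hN _) (norm_nonneg _) hK0
      refine (norm_mul_sub_mul_le (norm_ent_le T' k j) h2 h1 (hC i j hj)).trans ?_
      refine le_trans (le_of_eq ?_) (mul_le_mul_of_nonneg_right (le_max_left _ _)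
        (zpow_nonneg hq0.le _))
      rw [Prod.fst_add, zpow_add₀ hq0.ne']
      ring
    · rw [hent0 i k hv, zero_sub, norm_neg, norm_mul]
      have h2 : ‖f' ((pos i).2.1 + σ.2.1) * g' ((pos i).2.2.1 + σ.2.2.1)‖ ≤ K' * N' := by
        rw [norm_mul]
        exact mul_le_mul (hK' _) (hN' _) (norm_nonneg _) hK0'
      refine (mul_le_mul h2 (hB _ (valid_pos i) hv) (norm_nonneg _) (by positivity)).trans ?_
      rw [← mul_assoc]
      exact mul_le_mul_of_nonneg_right (le_max_right _ _) (zpow_nonneg hq0.le _)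
  · funext m
    by_cases h1 : σ.2.2.2 = 0
    · have h2 : σ'.2.2.2 ≠ 0 := by
        intro h2
        exact hε (by simp [h1, h2])
      simp [h'.flip h2]
    · simp [h.flip h1]

theorem IsElem.star (hq0 : 0 < q) {σ : ℤ × ℤ × ℤ × Fin 2} {f g : ℤ → ℂ} {L M : ℂ}
    {T : Spinor →L[ℂ] Spinor} (h : IsElem q σ f g L M T) :
    IsElem q (-σ) (fun m => conj (f (m - σ.2.1))) (fun l => conj (g (l - σ.2.2.1))) (conj L)
      (conj M) (star T) := by
  refine ⟨fun i k hk => ?_, ?_, h.symb_fst.conj_symm hq0, h.symb_snd.conj_symm hq0, fun hε => ?_⟩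
  · rw [ent_star, h.shift k i, map_zero]
    rintro he
    exact hk (by rw [he]; abel)
  · obtain ⟨C, hC⟩ := h.approx
    refine ⟨C * q ^ (-σ.1), fun i k hk => ?_⟩
    have h1 := hC k i (by rw [hk]; abel)
    rw [ent_star, ← map_mul, ← map_sub, RCLike.norm_conj]
    rw [hk, ← sub_eq_add_neg] at h1
    refine h1.trans (le_of_eq ?_)
    rw [mul_assoc, ← zpow_add₀ hq0.ne', neg_add_eq_sub]
    rfl
  · have h1 : σ.2.2.2 ≠ 0 := fun h0 => hε (by simp [h0])
    funext m
    simp [h.flip h1]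

/-- The operator changes the eigenvalue of |D| by exactly σ.1, so the commutator multiplies it by
this integer. In particular the commutator is bounded. -/
theorem IsElem.isDelta {σ : ℤ × ℤ × ℤ × Fin 2} {f g : ℤ → ℂ} {L M : ℂ}
    {T : Spinor →L[ℂ] Spinor} (h : IsElem q σ f g L M T) : IsDelta T ((σ.1 : ℂ) • T) := by
  rw [isDelta_iff]
  intro k i
  rw [ent_smul]
  by_cases hk : pos k = pos i + σ
  · congr 1
    rw [abs_diracEigenvalue, abs_diracEigenvalue, hk, Prod.fst_add]
    push_cast
    ring
  · rw [h.shift i k hk, mul_zero, mul_zero]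

/-! ### The algebra spanned by the shift operators with a symbol -/

/-- The span of the shift operators with a symbol. -/
noncomputable def symbolSpan (q : ℝ) : Submodule ℂ (Spinor →L[ℂ] Spinor) :=
  Submodule.span ℂ {T | ∃ σ f g L M, IsElem q σ f g L M T}

theorem IsElem.mem {σ : ℤ × ℤ × ℤ × Fin 2} {f g : ℤ → ℂ} {L M : ℂ}
    {T : Spinor →L[ℂ] Spinor} (h : IsElem q σ f g L M T) : T ∈ symbolSpan q :=
  Submodule.subset_span ⟨σ, f, g, L, M, h⟩

theorem mul_mem_symbolSpan (hq0 : 0 < q) (hq1 : q < 1) {T S : Spinor →L[ℂ] Spinor}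
    (hT : T ∈ symbolSpan q) (hS : S ∈ symbolSpan q) : T * S ∈ symbolSpan q := by
  induction hT, hS using Submodule.span_induction₂ with
  | mem_mem x y hx hy =>
    obtain ⟨σ, f, g, L, M, hx⟩ := hx
    obtain ⟨σ', f', g', L', M', hy⟩ := hy
    exact (hx.mul hq0 hq1 hy).mem
  | zero_left y hy => simp
  | zero_right x hx => simp
  | add_left x y z _ _ _ h1 h2 => rw [add_mul]; exact add_mem h1 h2
  | add_right x y z _ _ _ h1 h2 => rw [mul_add]; exact add_mem h1 h2
  | smul_left r x y _ _ h => rw [smul_mul_assoc]; exact Submodule.smul_mem _ _ h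
  | smul_right r x y _ _ h => rw [mul_smul_comm]; exact Submodule.smul_mem _ _ h

theorem star_mem_symbolSpan (hq0 : 0 < q) {T : Spinor →L[ℂ] Spinor} (hT : T ∈ symbolSpan q) :
    star T ∈ symbolSpan q := by
  induction hT using Submodule.span_induction with
  | mem x hx =>
    obtain ⟨σ, f, g, L, M, hx⟩ := hx
    exact (hx.star hq0).mem
  | zero => simp
  | add x y _ _ h1 h2 => rw [star_add]; exact add_mem h1 h2
  | smul r x _ h => rw [star_smul]; exact Submodule.smul_mem _ _ h

/-- The support condition forces a cut-off at negative m even for the identity. It costs nothing,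
since 1 ≤ q^m there. -/
theorem symb_one (hq0 : 0 < q) (hq1 : q < 1) : Symb q 0 0 (fun m => if 0 ≤ m then 1 else 0) 1 := by
  refine ⟨⟨1, fun m => ?_⟩, ⟨1, fun m => ?_⟩, fun m hm => if_neg (by omega), fun h => absurd rfl h⟩
  · split_ifs <;> simp
  · split_ifs with h
    · simp only [sub_self, norm_zero]
      positivity
    · simp only [zero_sub, norm_neg, norm_one, one_mul]
      exact one_le_zpow_of_nonpos₀ hq0 hq1.le (by omega)

theorem one_mem_symbolSpan (hq0 : 0 < q) (hq1 : q < 1) : 1 ∈ symbolSpan q := by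
  refine IsElem.mem (σ := 0) ⟨fun i k hk => ?_, ⟨0, fun i k hk => ?_⟩, symb_one hq0 hq1,
    symb_one hq0 hq1, fun h => absurd rfl h⟩
  · rw [add_zero] at hk
    exact basisVec_apply_ne fun h => hk (by rw [h])
  · rw [add_zero] at hk
    obtain rfl := pos_injective hk
    have h := valid_pos k
    rw [if_pos h.1, if_pos h.2.2.1]
    simp [ent, basisVec_apply_self]

theorem exists_isDelta {T : Spinor →L[ℂ] Spinor} (hT : T ∈ symbolSpan q) :
    ∃ S ∈ symbolSpan q, IsDelta T S := by
  simp only [isDelta_iff]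
  induction hT using Submodule.span_induction with
  | mem x hx =>
    obtain ⟨σ, f, g, L, M, hx⟩ := hx
    exact ⟨_, Submodule.smul_mem _ _ hx.mem, isDelta_iff.mp hx.isDelta⟩
  | zero => exact ⟨0, zero_mem _, by simp [ent_zero]⟩
  | add x y _ _ h1 h2 =>
    obtain ⟨S, hS, h1⟩ := h1
    obtain ⟨S', hS', h2⟩ := h2
    exact ⟨S + S', add_mem hS hS', fun k i => by rw [ent_add, ent_add, h1, h2]; ring⟩
  | smul r x _ h =>
    obtain ⟨S, hS, h⟩ := h
    exact ⟨r • S, Submodule.smul_mem _ _ hS, fun k i => by rw [ent_smul, ent_smul, h]; ring⟩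

theorem IsDelta.unique {T S S' : Spinor →L[ℂ] Spinor} (h : IsDelta T S) (h' : IsDelta T S') :
    S = S' := by
  rw [isDelta_iff] at h h'
  exact ent_ext fun k i => by rw [h, h']

/-- Translation by σ is a partial injection of the labels and the entries of T are bounded by ‖T‖,
so the part of T that moves by σ is again bounded. The generators are split into such parts. -/
theorem exists_shift_part (T : Spinor →L[ℂ] Spinor) (σ : ℤ × ℤ × ℤ × Fin 2) :
    ∃ S : Spinor →L[ℂ] Spinor, ∀ k i, ent S k i = if pos k = pos i + σ then ent T k i else 0 := by
  classical
  let p : Label → Option Label := fun i =>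
    if h : Valid (pos i + σ) then some (exists_pos_eq h).choose else none
  have hp : ∀ i k, p i = some k ↔ pos k = pos i + σ := by
    intro i k
    simp only [p, Option.dite_none_right_eq_some, Option.some.injEq]
    constructor
    · rintro ⟨h, rfl⟩
      exact (exists_pos_eq h).choose_spec
    · intro h
      have hv : Valid (pos i + σ) := h ▸ valid_pos k
      exact ⟨hv, pos_injective ((exists_pos_eq hv).choose_spec.trans h.symm)⟩
  obtain ⟨S, hS⟩ := exists_weightedShift (fun i => (p i).elim 0 fun k => ent T k i) ‖T‖ p
    (fun i => by
      rcases p i with _ | k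
      · simp
      · exact norm_ent_le T k i)
    (fun i i' k h h' => by
      rw [hp] at h h'
      exact pos_injective (add_right_cancel (h.symm.trans h')))
  refine ⟨S, fun k i => ?_⟩
  rw [ent, hS]
  rcases hpi : p i with _ | j
  · rw [if_neg fun h => by rw [← hp, hpi] at h; cases h]
    simp
  · have hj := (hp i j).mp hpi
    change ent T j i * basisVec j k = _
    by_cases hk : k = j
    · subst hk
      rw [if_pos hj, basisVec_apply_self, mul_one]
    · rw [if_neg fun h => hk (pos_injective (h.trans hj.symm)), basisVec_apply_ne hk, mul_zero]

end

/-! ### Sums of exponentially convergent functions -/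

/-- Exponentially fast convergence to `L` at infinity. -/
def ExpLim (q : ℝ) (f : ℤ → ℂ) (L : ℂ) : Prop := ∃ C : ℝ, ∀ m, ‖f m - L‖ ≤ C * q ^ m

/-- The regularized sum `∑_{m ≥ 0} (f m - L)`. -/
noncomputable def regSum (f : ℤ → ℂ) (L : ℂ) : ℂ := ∑' m : ℕ, (f m - L)

section

variable {q : ℝ}

/-- The error is a tail dominated by a geometric series. -/
theorem ExpLim.sum_range (hq0 : 0 < q) (hq1 : q < 1) {f : ℤ → ℂ} {L : ℂ} (h : ExpLim q f L) :
    ∃ C : ℝ, ∀ N : ℕ, ‖∑ m ∈ Finset.range N, (f m - L) - regSum f L‖ ≤ C * q ^ N := by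
  obtain ⟨C, hC⟩ := h
  have hb : ∀ m : ℕ, ‖f m - L‖ ≤ C * q ^ m := fun m => by simpa using hC m
  have hg := summable_geometric_of_lt_one hq0.le hq1
  have hs : Summable fun m : ℕ => f m - L := Summable.of_norm_bounded (hg.mul_left C) hb
  refine ⟨C * (1 - q)⁻¹, fun N => ?_⟩
  rw [regSum, ← hs.sum_add_tsum_nat_add N, sub_add_cancel_left, norm_neg]
  have h2 : Summable fun m : ℕ => C * q ^ N * q ^ m := hg.mul_left _
  refine (tsum_of_norm_bounded h2.hasSum fun m => ?_).trans (le_of_eq ?_)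
  · refine (hb (m + N)).trans (le_of_eq ?_)
    ring
  · rw [tsum_mul_left, tsum_geometric_of_lt_one hq0.le hq1]
    ring

/-- Expand the product around LL'. The linear terms give regularized sums, the second one after
reversing the order of summation. In the quadratic term (f − L)(h − L') the factors q^m and
q^{N−1−m} combine to q^{N−1} for each of the N values of m. -/
theorem ExpLim.sum_convolution (hq0 : 0 < q) (hq1 : q < 1) {f h : ℤ → ℂ} {L L' : ℂ}
    (hf : ExpLim q f L) (hh : ExpLim q h L') :
    ∃ C : ℝ, ∀ N : ℕ, ‖∑ m ∈ Finset.range N, f m * h (N - 1 - m) -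
      (N * (L * L') + (L' * regSum f L + L * regSum h L'))‖ ≤ C * ((N : ℝ) + 1) * q ^ N := by
  obtain ⟨A, hA⟩ := hf.sum_range hq0 hq1
  obtain ⟨B, hB⟩ := hh.sum_range hq0 hq1
  obtain ⟨C, hC⟩ := hf
  obtain ⟨C', hC'⟩ := hh
  have hC0 := nonneg_of_norm_le_zpow hq0 (hC 0)
  have hC0' := nonneg_of_norm_le_zpow hq0 (hC' 0)
  have hA0 : 0 ≤ A := by simpa using (norm_nonneg _).trans (hA 0)
  have hB0 : 0 ≤ B := by simpa using (norm_nonneg _).trans (hB 0)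
  refine ⟨‖L'‖ * A + ‖L‖ * B + C * C' * q⁻¹, fun N => ?_⟩
  have hrefl : ∑ m ∈ Finset.range N, (h (N - 1 - m) - L') =
      ∑ m ∈ Finset.range N, (h m - L') := by
    rw [← Finset.sum_range_reflect (fun m : ℕ => h m - L') N]
    refine Finset.sum_congr rfl fun m hm => ?_
    rw [Finset.mem_range] at hm
    congr 2
    omega
  have hsplit : ∑ m ∈ Finset.range N, f m * h (N - 1 - m) = N * (L * L') +
      (L' * ∑ m ∈ Finset.range N, (f m - L) + L * ∑ m ∈ Finset.range N, (h m - L')) +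
      ∑ m ∈ Finset.range N, (f m - L) * (h (N - 1 - m) - L') := by
    have hconst : (N : ℂ) * (L * L') = ∑ m ∈ Finset.range N, L * L' := by simp
    rw [← hrefl, hconst, Finset.mul_sum, Finset.mul_sum, ← Finset.sum_add_distrib,
      ← Finset.sum_add_distrib, ← Finset.sum_add_distrib]
    exact Finset.sum_congr rfl fun m _ => by ring
  have hlast : ‖∑ m ∈ Finset.range N, (f m - L) * (h (N - 1 - m) - L')‖ ≤
      C * C' * q⁻¹ * N * q ^ N := by
    have h1 : ∀ m ∈ Finset.range N, ‖(f m - L) * (h (N - 1 - m) - L')‖ ≤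
        C * C' * q⁻¹ * q ^ N := by
      intro m _
      rw [norm_mul]
      refine (mul_le_mul (hC m) (hC' _) (norm_nonneg _) (by positivity)).trans (le_of_eq ?_)
      rw [show (N : ℤ) - 1 - m = N + (-1) + (-m) by ring, zpow_add₀ hq0.ne', zpow_add₀ hq0.ne',
        zpow_neg_one, zpow_neg, zpow_natCast, zpow_natCast]
      field_simp
    refine (norm_sum_le_of_le _ h1).trans (le_of_eq ?_)
    rw [Finset.sum_const, Finset.card_range, nsmul_eq_mul]
    ring
  set U := ∑ m ∈ Finset.range N, (f m - L)
  set V := ∑ m ∈ Finset.range N, (h m - L')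
  set W := ∑ m ∈ Finset.range N, (f m - L) * (h (N - 1 - m) - L')
  have e : ∑ m ∈ Finset.range N, f m * h (N - 1 - m) -
      (N * (L * L') + (L' * regSum f L + L * regSum h L')) =
      L' * (U - regSum f L) + L * (V - regSum h L') + W := by
    rw [hsplit]
    ring
  have hqN : 0 < q ^ N := by positivity
  rw [e]
  calc _ ≤ ‖L'‖ * ‖U - regSum f L‖ + ‖L‖ * ‖V - regSum h L'‖ + ‖W‖ := by
        simpa only [norm_mul] using norm_add₃_le (a := L' * (U - regSum f L))
          (b := L * (V - regSum h L')) (c := W)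
    _ ≤ ‖L'‖ * (A * q ^ N) + ‖L‖ * (B * q ^ N) + C * C' * q⁻¹ * N * q ^ N := by
        gcongr
        · exact hA N
        · exact hB N
    _ ≤ _ := by
        have h1 : 0 ≤ (‖L'‖ * A + ‖L‖ * B) * N * q ^ N := by positivity
        have h2 : 0 ≤ C * C' * q⁻¹ * q ^ N := by positivity
        linarith

/-- Uses xy − XY = X(y − Y) + Y(x − X) + (x − X)(y − Y); linear growth of X and Y does not spoil
rapid decay. -/
theorem RapidDecay.mul_sub {x y X Y : ℕ → ℂ} {K : ℝ} (hX : ∀ n, ‖X n‖ ≤ K * ((n : ℝ) + 1))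
    (hY : ∀ n, ‖Y n‖ ≤ K * ((n : ℝ) + 1)) (hx : RapidDecay fun n => x n - X n)
    (hy : RapidDecay fun n => y n - Y n) : RapidDecay fun n => x n * y n - X n * Y n := by
  have h1 : RapidDecay fun n => X n * (y n - Y n) :=
    hy.mono (K := K) 1 fun n => by
      rw [norm_mul, pow_one]
      gcongr
      exact hX n
  have h2 : RapidDecay fun n => Y n * (x n - X n) :=
    hx.mono (K := K) 1 fun n => by
      rw [norm_mul, pow_one]
      gcongr
      exact hY n
  have h3 : RapidDecay fun n => (x n - X n) * (y n - Y n) := by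
    obtain ⟨C, hC⟩ := hx 0
    refine hy.mono (K := C) 0 fun n => ?_
    rw [norm_mul, pow_zero, mul_one]
    gcongr
    simpa using hC n
  convert! (h1.add h2).add h3 using 2
  ring

theorem RapidDecay.comp_add {e : ℕ → ℂ} (h : RapidDecay e) (a : ℕ) :
    RapidDecay fun n => e (n + a) := by
  intro k
  obtain ⟨C, hC⟩ := h k
  refine ⟨C, fun n => le_trans ?_ (hC (n + a))⟩
  gcongr
  omega

/-! ### Level traces as products of convolution sums -/

/-- The diagonal entries of `T` are products of coefficients in the coordinates `m`, `l` and in the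
distances to the upper ends of their ranges, up to terms `O(q^d)`. -/
def DiagApprox (q : ℝ) (f h g k : ℤ → ℂ) (T : Spinor →L[ℂ] Spinor) : Prop :=
  ∃ C : ℝ, ∀ i, ‖ent T i i - f (pos i).2.1 * h (pos (negLabel i)).2.1 *
    (g (pos i).2.2.1 * k (pos (negLabel i)).2.2.1)‖ ≤ C * q ^ (pos i).1

/-- At d = n + 1 the pairs (m, l) fill an (n+1) × (n+2) rectangle for ↑ and an (n+2) × (n+1)
rectangle for ↓, so the sum of the approximating products factors for each spin. The accumulated
error is at most about n² q^n. -/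
theorem DiagApprox.levelTrace_sub (hq0 : 0 < q) (hq1 : q < 1) {f h g k : ℤ → ℂ}
    {T : Spinor →L[ℂ] Spinor} (hT : DiagApprox q f h g k T) :
    RapidDecay fun n => levelTrace T n -
      ((∑ m ∈ Finset.range (n + 1), f m * h ((n + 1 : ℕ) - 1 - m)) *
        (∑ l ∈ Finset.range (n + 2), g l * k ((n + 2 : ℕ) - 1 - l)) +
       (∑ m ∈ Finset.range (n + 2), f m * h ((n + 2 : ℕ) - 1 - m)) *
        (∑ l ∈ Finset.range (n + 1), g l * k ((n + 1 : ℕ) - 1 - l))) := by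
  obtain ⟨C, hC⟩ := hT
  have hC0 : 0 ≤ C := nonneg_of_norm_le_zpow hq0 (hC (levelLabel 0 ⟨0, ⟨0, by simp⟩, ⟨0, by simp⟩⟩))
  refine RapidDecay.of_le_geometric hq0 hq1 (K := 4 * C * q) 2 fun n => ?_
  have hval : ∀ x : LevelIndex n, f (pos (levelLabel n x)).2.1 *
      h (pos (negLabel (levelLabel n x))).2.1 * (g (pos (levelLabel n x)).2.2.1 *
      k (pos (negLabel (levelLabel n x))).2.2.1) =
      f (x.2.1 : ℕ) * h ((n + 1 + x.1 : ℕ) - 1 - (x.2.1 : ℕ)) *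
      (g (x.2.2 : ℕ) * k ((n + 2 - x.1 : ℕ) - 1 - (x.2.2 : ℕ))) := by
    intro x
    have := x.1.isLt
    rw [pos_negLabel, pos_levelLabel]
    simp only
    congr 3
    · push_cast
      ring
    · congr 1
      omega
  have hsum : (∑ m ∈ Finset.range (n + 1), f m * h ((n + 1 : ℕ) - 1 - m)) *
        (∑ l ∈ Finset.range (n + 2), g l * k ((n + 2 : ℕ) - 1 - l)) +
       (∑ m ∈ Finset.range (n + 2), f m * h ((n + 2 : ℕ) - 1 - m)) *
        (∑ l ∈ Finset.range (n + 1), g l * k ((n + 1 : ℕ) - 1 - l)) =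
      ∑ x : LevelIndex n, f (x.2.1 : ℕ) * h ((n + 1 + x.1 : ℕ) - 1 - (x.2.1 : ℕ)) *
      (g (x.2.2 : ℕ) * k ((n + 2 - x.1 : ℕ) - 1 - (x.2.2 : ℕ))) := by
    rw [Fintype.sum_sigma, Fin.sum_univ_two]
    simp only [Fintype.sum_prod_type, ← Finset.mul_sum, ← Finset.sum_mul]
    simp only [Finset.sum_range]
    rfl
  rw [hsum, levelTrace, ← Finset.sum_sub_distrib]
  have hle : ∀ x ∈ (Finset.univ : Finset (LevelIndex n)),
      ‖ent T (levelLabel n x) (levelLabel n x) -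
        f (x.2.1 : ℕ) * h ((n + 1 + x.1 : ℕ) - 1 - (x.2.1 : ℕ)) *
        (g (x.2.2 : ℕ) * k ((n + 2 - x.1 : ℕ) - 1 - (x.2.2 : ℕ)))‖ ≤ C * q ^ (n + 1) := by
    intro x _
    rw [← hval]
    refine (hC (levelLabel n x)).trans (le_of_eq ?_)
    rw [pos_levelLabel, ← zpow_natCast]
    push_cast
    rfl
  refine (norm_sum_le_of_le _ hle).trans ?_
  rw [Finset.sum_const, Finset.card_univ, card_levelIndex, nsmul_eq_mul]
  have h1 : ((2 * ((n + 1) * (n + 2)) : ℕ) : ℝ) ≤ 4 * ((n : ℝ) + 1) ^ 2 := by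
    push_cast
    nlinarith [n.cast_nonneg (α := ℝ)]
  calc _ ≤ 4 * ((n : ℝ) + 1) ^ 2 * (C * q ^ (n + 1)) := by gcongr
    _ = _ := by ring

theorem DiagApprox.hasLevelExpansion (hq0 : 0 < q) (hq1 : q < 1) {f h g k : ℤ → ℂ}
    {L L' M M' : ℂ} {T : Spinor →L[ℂ] Spinor} (hT : DiagApprox q f h g k T)
    (hf : ExpLim q f L) (hh : ExpLim q h L') (hg : ExpLim q g M) (hk : ExpLim q k M') :
    HasLevelExpansion (levelTrace T) (2 * (L * L' * (M * M')))
      (2 * (L * L' * (M' * regSum g M + M * regSum k M') +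
        M * M' * (L' * regSum f L + L * regSum h L'))) := by
  set u := L * L'
  set v := M * M'
  set x₀ := L' * regSum f L + L * regSum h L'
  set y₀ := M' * regSum g M + M * regSum k M'
  have key : ∀ {f h : ℤ → ℂ} {L L' : ℂ}, ExpLim q f L → ExpLim q h L' →
      RapidDecay fun N : ℕ => ∑ m ∈ Finset.range N, f m * h (N - 1 - m) -
        (N * (L * L') + (L' * regSum f L + L * regSum h L')) := by
    intro f h L L' hf hh
    obtain ⟨C, hC⟩ := hf.sum_convolution hq0 hq1 hh
    exact RapidDecay.of_le_geometric hq0 hq1 (K := C) 1 fun N => by simpa using hC N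
  have hlin : ∀ (u x : ℂ) (a : ℕ), a ≤ 2 → ∀ n : ℕ, ‖((n + a : ℕ) : ℂ) * u + x‖ ≤
      (3 * ‖u‖ + ‖x‖) * ((n : ℝ) + 1) := by
    intro u x a ha n
    have ha' : (a : ℝ) ≤ 2 := by exact_mod_cast ha
    have h1 := norm_add_le (((n + a : ℕ) : ℂ) * u) x
    rw [norm_mul, Complex.norm_natCast] at h1
    push_cast at h1 ⊢
    have h2 := norm_nonneg u
    have h3 := norm_nonneg x
    have h4 : (0 : ℝ) ≤ n := n.cast_nonneg
    nlinarith [mul_nonneg h2 h4, mul_nonneg h3 h4, mul_le_mul_of_nonneg_right ha' h2]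
  have hpair : ∀ a b : ℕ, a ≤ 2 → b ≤ 2 → RapidDecay fun n =>
      (∑ m ∈ Finset.range (n + a), f m * h ((n + a : ℕ) - 1 - m)) *
        (∑ l ∈ Finset.range (n + b), g l * k ((n + b : ℕ) - 1 - l)) -
      (((n + a : ℕ) : ℂ) * u + x₀) * (((n + b : ℕ) : ℂ) * v + y₀) := by
    intro a b ha hb
    refine RapidDecay.mul_sub (K := max (3 * ‖u‖ + ‖x₀‖) (3 * ‖v‖ + ‖y₀‖)) (fun n => ?_)
      (fun n => ?_) ((key hf hh).comp_add a) ((key hg hk).comp_add b)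
    · exact (hlin u x₀ a ha n).trans (by gcongr; exact le_max_left _ _)
    · exact (hlin v y₀ b hb n).trans (by gcongr; exact le_max_right _ _)
  -- With D = n + 3/2 the side lengths are D ∓ 1/2. Adding ((D − 1/2)u + x₀)((D + 1/2)v + y₀) and
  -- the term with the signs exchanged cancels the half-integer corrections to the coefficient of D.
  -- They leave only −uv/2 in the constant term.
  refine ⟨2 * x₀ * y₀ - u * v / 2, ?_⟩
  convert! ((hT.levelTrace_sub hq0 hq1).add (hpair 1 2 (by norm_num) le_rfl)).add
    (hpair 2 1 le_rfl (by norm_num)) using 2 with n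
  push_cast
  ring

theorem Symb.expLim {a b : ℤ} {f : ℤ → ℂ} {L : ℂ} (h : Symb q a b f L) : ExpLim q f L := h.lim

theorem expLim_const (q : ℝ) (c : ℂ) : ExpLim q (fun _ => c) c := ⟨0, by simp⟩

theorem regSum_const (c : ℂ) : regSum (fun _ => c) c = 0 := by simp [regSum]

/-! ### Leading coefficients on the span of shift operators -/

theorem hasLevelExpansion_of_diag_eq_zero {T : Spinor →L[ℂ] Spinor} (h : ∀ i, ent T i i = 0) :
    HasLevelExpansion (levelTrace T) 0 0 := by
  refine RapidDecay.hasLevelExpansion fun k => ⟨0, fun n => ?_⟩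
  simp [levelTrace, h]

theorem IsElem.diag_eq_zero {σ : ℤ × ℤ × ℤ × Fin 2} {f g : ℤ → ℂ} {L M : ℂ}
    {T : Spinor →L[ℂ] Spinor} (h : IsElem q σ f g L M T) (hσ : σ ≠ 0) (i : Label) :
    ent T i i = 0 :=
  h.shift i i fun he => hσ (left_eq_add.mp he)

theorem IsElem.hasLevelExpansion (hq0 : 0 < q) (hq1 : q < 1) {f g : ℤ → ℂ} {L M : ℂ}
    {T : Spinor →L[ℂ] Spinor} (h : IsElem q 0 f g L M T) :
    HasLevelExpansion (levelTrace T) (2 * (L * M))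
      (2 * (L * regSum g M + M * regSum f L)) := by
  have hT : DiagApprox q f (fun _ => 1) g (fun _ => 1) T := by
    obtain ⟨C, hC⟩ := h.approx
    exact ⟨C, fun i => by simpa using hC i i (add_zero _).symm⟩
  simpa [regSum_const] using hT.hasLevelExpansion hq0 hq1 h.symb_fst.expLim (expLim_const q 1)
    h.symb_snd.expLim (expLim_const q 1)

theorem levelTrace_add (T S : Spinor →L[ℂ] Spinor) :
    levelTrace (T + S) = fun n => levelTrace T n + levelTrace S n := by
  funext n
  simp [levelTrace, ent_add, Finset.sum_add_distrib]

theorem levelTrace_smul (c : ℂ) (T : Spinor →L[ℂ] Spinor) :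
    levelTrace (c • T) = fun n => c * levelTrace T n := by
  funext n
  simp [levelTrace, ent_smul, Finset.mul_sum]

/-- The level traces of `T` have an asymptotic expansion with coefficients `c₂`, `c₁`. -/
def HasExpansion (T : Spinor →L[ℂ] Spinor) (c₂ c₁ : ℂ) : Prop :=
  HasLevelExpansion (levelTrace T) c₂ c₁

theorem HasExpansion.add {T S : Spinor →L[ℂ] Spinor} {c₂ c₁ d₂ d₁ : ℂ} (h : HasExpansion T c₂ c₁)
    (h' : HasExpansion S d₂ d₁) : HasExpansion (T + S) (c₂ + d₂) (c₁ + d₁) := by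
  rw [HasExpansion, levelTrace_add]
  exact HasLevelExpansion.add h h'

theorem HasExpansion.smul {T : Spinor →L[ℂ] Spinor} {c₂ c₁ : ℂ} (h : HasExpansion T c₂ c₁) (a : ℂ) :
    HasExpansion (a • T) (a * c₂) (a * c₁) := by
  rw [HasExpansion, levelTrace_smul]
  exact HasLevelExpansion.const_mul h a

/-- The coefficients are residues of the same zeta function, and residues are unique. -/
theorem HasExpansion.unique {T : Spinor →L[ℂ] Spinor} {c₂ c₁ d₂ d₁ : ℂ} (h : HasExpansion T c₂ c₁)
    (h' : HasExpansion T d₂ d₁) : c₂ = d₂ ∧ c₁ = d₁ :=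
  ⟨(HasLevelExpansion.hasNCIntegral h).1.unique (HasLevelExpansion.hasNCIntegral h').1,
    (HasLevelExpansion.hasNCIntegral h).2.unique (HasLevelExpansion.hasNCIntegral h').2⟩

theorem exists_hasExpansion (hq0 : 0 < q) (hq1 : q < 1) {T : Spinor →L[ℂ] Spinor}
    (hT : T ∈ symbolSpan q) : ∃ c₂ c₁, HasExpansion T c₂ c₁ := by
  induction hT using Submodule.span_induction with
  | mem x hx =>
    obtain ⟨σ, f, g, L, M, hx⟩ := hx
    by_cases hσ : σ = 0
    · subst hσ
      exact ⟨_, _, hx.hasLevelExpansion hq0 hq1⟩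
    · exact ⟨0, 0, hasLevelExpansion_of_diag_eq_zero (hx.diag_eq_zero hσ)⟩
  | zero => exact ⟨0, 0, hasLevelExpansion_of_diag_eq_zero fun i => rfl⟩
  | add x y _ _ h1 h2 =>
    obtain ⟨_, _, h1⟩ := h1
    obtain ⟨_, _, h2⟩ := h2
    exact ⟨_, _, h1.add h2⟩
  | smul r x _ h =>
    obtain ⟨_, _, h⟩ := h
    exact ⟨_, _, h.smul r⟩

/-- The leading coefficient is a trace. -/
theorem hasExpansion_commutator (hq0 : 0 < q) (hq1 : q < 1) {T S : Spinor →L[ℂ] Spinor}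
    (hT : T ∈ symbolSpan q) (hS : S ∈ symbolSpan q) :
    ∃ c₁, HasExpansion (T * S - S * T) 0 c₁ := by
  have hneg : ∀ {A B : Spinor →L[ℂ] Spinor} {c a b : ℂ}, HasExpansion A c a → HasExpansion B c b →
      ∃ c₁, HasExpansion (A - B) 0 c₁ := by
    intro A B c a b hA hB
    have h := hA.add (hB.smul (-1))
    rw [neg_one_smul, ← sub_eq_add_neg, neg_one_mul, add_neg_cancel] at h
    exact ⟨_, h⟩
  have hzero : HasExpansion (0 : Spinor →L[ℂ] Spinor) 0 0 :=
    hasLevelExpansion_of_diag_eq_zero fun i => rfl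
  induction hT, hS using Submodule.span_induction₂ with
  | mem_mem x y hx hy =>
    obtain ⟨σ, f, g, L, M, hx⟩ := hx
    obtain ⟨σ', f', g', L', M', hy⟩ := hy
    have h1 := hx.mul hq0 hq1 hy
    have h2 := hy.mul hq0 hq1 hx
    -- Opposite shifts give diagonal products, and both orders have leading coefficient 2LL'MM'.
    -- Otherwise both products have zero diagonal.
    by_cases hσ : σ + σ' = 0
    · rw [hσ] at h1
      rw [add_comm, hσ, mul_comm L', mul_comm M'] at h2
      exact hneg (h1.hasLevelExpansion hq0 hq1) (h2.hasLevelExpansion hq0 hq1)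
    · exact hneg (hasLevelExpansion_of_diag_eq_zero (h1.diag_eq_zero hσ))
        (hasLevelExpansion_of_diag_eq_zero (h2.diag_eq_zero (by rwa [add_comm])))
  | zero_left y hy => exact ⟨0, by simpa using hzero⟩
  | zero_right x hx => exact ⟨0, by simpa using hzero⟩
  | add_left x y z _ _ _ h1 h2 =>
    obtain ⟨_, h1⟩ := h1
    obtain ⟨_, h2⟩ := h2
    have h := h1.add h2
    rw [add_zero] at h
    exact ⟨_, by convert! h using 1; noncomm_ring⟩
  | add_right x y z _ _ _ h1 h2 =>
    obtain ⟨_, h1⟩ := h1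
    obtain ⟨_, h2⟩ := h2
    have h := h1.add h2
    rw [add_zero] at h
    exact ⟨_, by convert! h using 1; noncomm_ring⟩
  | smul_left r x y _ _ h =>
    obtain ⟨_, h⟩ := h
    have h := h.smul r
    rw [mul_zero] at h
    exact ⟨_, by rwa [smul_mul_assoc, mul_smul_comm, ← smul_sub]⟩
  | smul_right r x y _ _ h =>
    obtain ⟨_, h⟩ := h
    have h := h.smul r
    rw [mul_zero] at h
    exact ⟨_, by rwa [smul_mul_assoc, mul_smul_comm, ← smul_sub]⟩

end

/-! ### Products with operators `J B J⁻¹` -/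

/-- The exponent is 2(m + l) − 1 for ↑ and 2(2·(2j) − (m + l)) − 1 for ↓, so in these coordinates
the two spins have the same formula. Along a fixed shift the phase therefore changes by a constant
sign. -/
theorem phase_eq (i : Label) :
    phase i = (-1 : ℂ) ^ ((pos i).2.1 + (pos i).2.2.1) * Complex.I⁻¹ := by
  have hI : ∀ x : ℤ, Complex.I ^ (2 * x - 1) = (-1 : ℂ) ^ x * Complex.I⁻¹ := fun x => by
    rw [zpow_sub₀ Complex.I_ne_zero, zpow_mul, zpow_one, div_eq_mul_inv]
    congr 2
    exact Complex.I_sq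
  obtain ⟨⟨J, M, N, s⟩, h⟩ := i
  rw [isLabel_iff] at h
  fin_cases s
  · simp only [phase, pos, Fin.zero_eta, Fin.isValue, ↓reduceIte] at h ⊢
    rw [← hI]
    congr 1
    omega
  · simp only [phase, pos, Fin.mk_one, Fin.isValue, one_ne_zero, ↓reduceIte] at h ⊢
    have h1 : (-1 : ℂ) ^ ((J + M) / 2 + ((J + N + 1) / 2 - ((1 : ℕ) : ℤ))) =
        (-1 : ℂ) ^ (2 * J - ((J + M) / 2 + ((J + N + 1) / 2 - ((1 : ℕ) : ℤ)))) := by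
      rw [zpow_sub₀ (by norm_num), zpow_mul]
      generalize (J + M) / 2 + ((J + N + 1) / 2 - ((1 : ℕ) : ℤ)) = y
      rcases Int.even_or_odd y with hy | hy
      · simp [hy.neg_one_zpow]
      · simp [hy.neg_one_zpow]
    rw [h1, ← hI]
    congr 1
    omega

theorem phase_mul_conj_phase {i j : Label} {x : ℤ}
    (h : (pos j).2.1 + (pos j).2.2.1 = (pos i).2.1 + (pos i).2.2.1 + x) :
    phase j * conj (phase i) = (-1 : ℂ) ^ x := by
  have h1 : phase j = (-1 : ℂ) ^ x * phase i := by
    rw [phase_eq, phase_eq, h, zpow_add₀ (by norm_num)]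
    ring
  rw [h1, mul_assoc, phase_mul_conj, mul_one]

theorem regSum_conj (f : ℤ → ℂ) (L : ℂ) :
    regSum (fun m => conj (f m)) (conj L) = conj (regSum f L) := by
  rw [regSum, regSum, Complex.conj_tsum]
  simp

section

variable {q : ℝ}

theorem ExpLim.conj_symm {f : ℤ → ℂ} {L : ℂ} (h : ExpLim q f L) :
    ExpLim q (fun m => conj (f m)) (conj L) := by
  obtain ⟨C, hC⟩ := h
  exact ⟨C, fun m => by simpa only [← map_sub, RCLike.norm_conj] using hC m⟩

theorem ExpLim.const_mul {f : ℤ → ℂ} {L : ℂ} (h : ExpLim q f L) (c : ℂ) :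
    ExpLim q (fun m => c * f m) (c * L) := by
  obtain ⟨C, hC⟩ := h
  refine ⟨‖c‖ * C, fun m => ?_⟩
  rw [← mul_sub, norm_mul, mul_assoc]
  gcongr
  exact hC m

theorem ExpLim.comp_sub (hq0 : 0 < q) {f : ℤ → ℂ} {L : ℂ} (h : ExpLim q f L) (b : ℤ) :
    ExpLim q (fun m => f (m - b)) L := by
  obtain ⟨C, hC⟩ := h
  refine ⟨C * q ^ (-b), fun m => ?_⟩
  rw [mul_assoc, ← zpow_add₀ hq0.ne', neg_add_eq_sub]
  exact hC _

variable {σ τ : ℤ × ℤ × ℤ × Fin 2} {f g f' g' : ℤ → ℂ} {L M L' M' : ℂ}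
  {A B : Spinor →L[ℂ] Spinor}

theorem IsElem.ent_mul_conjJ (hA : IsElem q σ f g L M A) {i j : Label} (hj : pos i = pos j + σ) :
    ent (A * conjJ B) i i = ent A i j * (phase (negLabel j) * conj (phase (negLabel i)) *
      conj (ent B (negLabel j) (negLabel i))) := by
  rw [← ent_conjJ]
  refine ent_mul_of_unique j fun j' hj' => ?_
  rw [hA.shift j' i fun he => hj' (pos_injective (add_right_cancel (he.symm.trans hj))), zero_mul]

theorem IsElem.ent_mul_conjJ_eq_zero (hA : IsElem q σ f g L M A) {i : Label}
    (h : ¬ Valid (pos i + -σ)) : ent (A * conjJ B) i i = 0 := by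
  refine ent_mul_eq_zero fun j => ?_
  rw [hA.shift j i fun he => h (by rw [he]; simpa using valid_pos j), zero_mul]

/-- The shift of `B` for which `A J B J⁻¹` can have diagonal entries. -/
def conjShift (σ : ℤ × ℤ × ℤ × Fin 2) : ℤ × ℤ × ℤ × Fin 2 :=
  (-σ.1, σ.2.1 - σ.1, σ.2.2.1 - σ.1, 0)

/-- Reflection turns a shift (a, b, c) into (a, a − b, a − c). To return to the diagonal the other
factor must undo this, which is `conjShift`. -/
theorem pos_negLabel_eq {i j : Label} (hσ : σ.2.2.2 = 0) (hj : pos i = pos j + σ) :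
    pos (negLabel j) = pos (negLabel i) + conjShift σ := by
  obtain ⟨a, b, c, ε⟩ := σ
  simp only at hσ
  subst hσ
  rw [pos_negLabel, pos_negLabel, hj]
  obtain ⟨d, m, l, s⟩ := pos j
  simp only [conjShift, Prod.mk_add_mk, add_zero, Prod.mk.injEq, and_true]
  omega

/-- The entry of A starts at the label j with `pos i = pos j + σ`, hence the arguments m − σ.2.1 and
l − σ.2.2.1. The entry of B starts at the reflected label of i, hence the dependence on the
distances to the upper ends. The phases of J contribute only the sign. -/
theorem IsElem.diagApprox_mul_conjJ (hq0 : 0 < q) (hq1 : q < 1) (hA : IsElem q σ f g L M A)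
    (hB : IsElem q (conjShift σ) f' g' L' M' B) (hσ : σ.2.2.2 = 0) :
    DiagApprox q (fun m => (-1 : ℂ) ^ ((σ.2.1 - σ.1) + (σ.2.2.1 - σ.1)) * f (m - σ.2.1))
      (fun m => conj (f' m)) (fun l => g (l - σ.2.2.1)) (fun l => conj (g' l)) (A * conjJ B) := by
  obtain ⟨C, hC⟩ := hA.approx
  obtain ⟨C', hC'⟩ := hB.approx
  obtain ⟨K, hK⟩ := hB.symb_fst.bdd
  obtain ⟨N, hN⟩ := hB.symb_snd.bdd
  have hA' := hA.star hq0
  -- The label j is reached from i by the shift −σ, so the boundary estimate is needed for the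
  -- symbol of A*.
  obtain ⟨D, hD0, hD⟩ := symb_mul_boundary hq0 hq1 hA'.symb_fst hA'.symb_snd hA'.flip
  have hK0 : 0 ≤ K := (norm_nonneg _).trans (hK 0)
  have hN0 : 0 ≤ N := (norm_nonneg _).trans (hN 0)
  have hbd : ∀ m l, ‖conj (f' m * g' l)‖ ≤ K * N := fun m l => by
    rw [RCLike.norm_conj, norm_mul]
    exact mul_le_mul (hK _) (hN _) (norm_nonneg _) hK0
  set ω : ℂ := (-1 : ℂ) ^ ((σ.2.1 - σ.1) + (σ.2.2.1 - σ.1)) with hω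
  have hω1 : ‖ω‖ = 1 := by rw [hω, norm_zpow, norm_neg, norm_one, one_zpow]
  refine ⟨max (‖A‖ * C' + C * q ^ (-σ.1) * (K * N)) (D * (K * N)), fun i => ?_⟩
  have hform : ∀ m m' l l' : ℤ, ω * f m * conj (f' m') * (g l * conj (g' l')) =
      ω * (f m * g l * conj (f' m' * g' l')) := by
    intros
    rw [map_mul]
    ring
  rw [hform]
  have hqi : 0 ≤ q ^ (pos i).1 := zpow_nonneg hq0.le _
  by_cases hv : Valid (pos i + -σ)
  · obtain ⟨j, hj⟩ := exists_pos_eq hv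
    have hij : pos i = pos j + σ := by rw [hj]; abel
    have hneg := pos_negLabel_eq hσ hij
    have hph : phase (negLabel j) * conj (phase (negLabel i)) = ω := by
      refine phase_mul_conj_phase ?_
      rw [hneg]
      simp only [conjShift, Prod.fst_add, Prod.snd_add]
      ring
    rw [hA.ent_mul_conjJ hij, hph, mul_left_comm, ← mul_sub, norm_mul, hω1, one_mul]
    have h1 := hC j i hij
    have h2 := hC' _ _ hneg
    rw [← RCLike.norm_conj, map_sub] at h2
    have h3 : pos j = pos i - σ := by rw [hj, sub_eq_add_neg]
    rw [h3] at h1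
    refine (norm_mul_sub_mul_le (norm_ent_le A i j) (hbd _ _) h1 h2).trans ?_
    refine le_trans (le_of_eq ?_) (mul_le_mul_of_nonneg_right (le_max_left _ _) hqi)
    rw [pos_negLabel, show (pos i - σ).1 = -σ.1 + (pos i).1 from sub_eq_neg_add _ _,
      zpow_add₀ hq0.ne']
    ring
  · rw [hA.ent_mul_conjJ_eq_zero hv, zero_sub, norm_neg, norm_mul, hω1, one_mul, norm_mul]
    have h1 := hD _ (valid_pos i) hv
    rw [← map_mul, RCLike.norm_conj] at h1
    refine (mul_le_mul h1 (hbd _ _) (norm_nonneg _) (by positivity)).trans (le_trans (le_of_eq ?_)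
      (mul_le_mul_of_nonneg_right (le_max_right _ _) hqi))
    ring

/-- A spin-flipping A has entries O(q^d), and boundedness of B suffices to keep the product
negligible. -/
theorem IsElem.diagApprox_mul_conjJ_of_flip (hq0 : 0 < q) (hA : IsElem q σ f g L M A)
    (hσ : σ.2.2.2 ≠ 0) :
    DiagApprox q (fun _ => 0) (fun _ => 0) (fun _ => 0) (fun _ => 0) (A * conjJ B) := by
  obtain ⟨C, hC⟩ := hA.approx
  have hf := hA.flip hσ
  refine ⟨|C| * q ^ (-σ.1) * ‖B‖, fun i => ?_⟩
  simp only [mul_zero, sub_zero]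
  by_cases hv : Valid (pos i + -σ)
  · obtain ⟨j, hj⟩ := exists_pos_eq hv
    have hij : pos i = pos j + σ := by rw [hj]; abel
    have h1 := hC j i hij
    rw [hf, Pi.zero_apply, zero_mul, sub_zero, hj] at h1
    rw [hA.ent_mul_conjJ hij, norm_mul, norm_mul, norm_mul, RCLike.norm_conj, RCLike.norm_conj,
      norm_phase, norm_phase, one_mul, one_mul]
    calc _ ≤ C * q ^ (pos i + -σ).1 * ‖B‖ := by
          refine mul_le_mul h1 (norm_ent_le B _ _) (norm_nonneg _) ((norm_nonneg _).trans h1)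
      _ ≤ |C| * q ^ (pos i + -σ).1 * ‖B‖ := by gcongr; exact le_abs_self C
      _ = _ := by
          rw [show (pos i + -σ).1 = -σ.1 + (pos i).1 from add_comm _ _, zpow_add₀ hq0.ne']
          ring
  · rw [hA.ent_mul_conjJ_eq_zero hv, norm_zero]
    have := zpow_nonneg hq0.le (pos i).1
    positivity

theorem IsElem.diag_mul_conjJ_eq_zero (hA : IsElem q σ f g L M A) (hB : IsElem q τ f' g' L' M' B)
    (hσ : σ.2.2.2 = 0) (hτ : τ ≠ conjShift σ) (i : Label) : ent (A * conjJ B) i i = 0 := by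
  by_cases hv : Valid (pos i + -σ)
  · obtain ⟨j, hj⟩ := exists_pos_eq hv
    have hij : pos i = pos j + σ := by rw [hj]; abel
    rw [hA.ent_mul_conjJ hij, hB.shift, map_zero, mul_zero, mul_zero]
    rw [pos_negLabel_eq hσ hij]
    exact fun h => hτ (add_left_cancel h).symm
  · exact hA.ent_mul_conjJ_eq_zero hv

/-- For LL' ≠ 0 both shifts must preserve the distance to the upper end of m. With τ = `conjShift σ`
this forces σ.1 = σ.2.1 = 0; the same holds for MM' and l. A nonzero shift thus kills at least one
product, and the cases below show that the remaining terms vanish too. -/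
theorem IsElem.hasExpansion_mul_conjJ_zero (hq0 : 0 < q) (hq1 : q < 1)
    (hA : IsElem q σ f g L M A) (hB : IsElem q τ f' g' L' M' B) (h : ¬ (σ = 0 ∧ τ = 0)) :
    HasExpansion (A * conjJ B) 0 0 := by
  by_cases hσ : σ.2.2.2 = 0
  swap
  · have h0 := expLim_const q 0
    have h1 := (hA.diagApprox_mul_conjJ_of_flip (B := B) hq0 hσ).hasLevelExpansion hq0 hq1
      h0 h0 h0 h0
    simp only [mul_zero, zero_mul, add_zero] at h1
    exact h1
  by_cases hτ : τ = conjShift σ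
  swap
  · exact hasLevelExpansion_of_diag_eq_zero (hA.diag_mul_conjJ_eq_zero hB hσ hτ)
  subst hτ
  have h1 := (hA.diagApprox_mul_conjJ hq0 hq1 hB hσ).hasLevelExpansion hq0 hq1
    ((hA.symb_fst.expLim.comp_sub hq0 _).const_mul _) hB.symb_fst.expLim.conj_symm
    (hA.symb_snd.expLim.comp_sub hq0 _) hB.symb_snd.expLim.conj_symm
  have hL : σ.1 ≠ σ.2.1 ∨ σ.2.1 ≠ 0 → L * conj L' = 0 := by
    rintro (h | h)
    · rw [hA.symb_fst.off h, zero_mul]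
    · rw [hB.symb_fst.off (by simp only [conjShift]; omega), map_zero, mul_zero]
  have hM : σ.1 ≠ σ.2.2.1 ∨ σ.2.2.1 ≠ 0 → M * conj M' = 0 := by
    rintro (h | h)
    · rw [hA.symb_snd.off h, zero_mul]
    · rw [hB.symb_snd.off (by simp only [conjShift]; omega), map_zero, mul_zero]
  have hne : ¬ (σ.1 = 0 ∧ σ.2.1 = 0 ∧ σ.2.2.1 = 0) := by
    rintro ⟨e1, e2, e3⟩
    refine h ⟨?_, ?_⟩
    · exact Prod.ext e1 (Prod.ext e2 (Prod.ext e3 hσ))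
    · simp [conjShift, e1, e2, e3]
  set ω : ℂ := (-1 : ℂ) ^ ((σ.2.1 - σ.1) + (σ.2.2.1 - σ.1))
  -- Here LL' may survive, but l moves while d does not. Then M and M' are zero separately, which
  -- also removes the terms of c₁ containing LL' and a regularized sum in l.
  by_cases e1 : σ.1 = σ.2.1 ∧ σ.2.1 = 0
  · have hM0 : M = 0 := hA.symb_snd.off (by omega)
    have hM0' : M' = 0 := hB.symb_snd.off (by simp only [conjShift]; omega)
    simp only [hM0, hM0', map_zero, mul_zero, zero_mul, add_zero] at h1
    exact h1
  by_cases e2 : σ.1 = σ.2.2.1 ∧ σ.2.2.1 = 0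
  · have hL0 : L = 0 := hA.symb_fst.off (by omega)
    have hL0' : L' = 0 := hB.symb_fst.off (by simp only [conjShift]; omega)
    simp only [hL0, hL0', map_zero, mul_zero, zero_mul, add_zero] at h1
    exact h1
  · rw [hM (by omega), mul_assoc ω, hL (by omega)] at h1
    simp only [mul_zero, zero_mul, add_zero] at h1
    exact h1

theorem IsElem.hasExpansion_mul_conjJ (hq0 : 0 < q) (hq1 : q < 1)
    (hA : IsElem q σ f g L M A) (hB : IsElem q τ f' g' L' M' B) :
    ∃ c₂ c₁ d₂ d₁ : ℂ, HasExpansion A c₂ c₁ ∧ HasExpansion B d₂ d₁ ∧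
      HasExpansion (A * conjJ B) (1 / 2 * c₂ * conj d₂)
        (1 / 2 * c₁ * conj d₂ + 1 / 2 * c₂ * conj d₁) := by
  by_cases h : σ = 0 ∧ τ = 0
  · obtain ⟨rfl, rfl⟩ := h
    have h0 : conjShift 0 = 0 := by simp [conjShift]
    refine ⟨_, _, _, _, hA.hasLevelExpansion hq0 hq1, hB.hasLevelExpansion hq0 hq1, ?_⟩
    have h1 := (hA.diagApprox_mul_conjJ hq0 hq1 (h0.symm ▸ hB) rfl).hasLevelExpansion hq0 hq1
      ((hA.symb_fst.expLim.comp_sub hq0 _).const_mul _) hB.symb_fst.expLim.conj_symm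
      (hA.symb_snd.expLim.comp_sub hq0 _) hB.symb_snd.expLim.conj_symm
    simp only [Prod.fst_zero, Prod.snd_zero, sub_zero, add_zero, zpow_zero, one_mul, regSum_conj]
      at h1
    convert! h1 using 1
    · simp only [map_mul, Complex.conj_ofNat]
      ring
    · simp only [map_mul, map_add, Complex.conj_ofNat]
      ring
  · have h1 := hA.hasExpansion_mul_conjJ_zero hq0 hq1 hB h
    obtain ⟨c₂, c₁, hc⟩ := exists_hasExpansion hq0 hq1 hA.mem
    obtain ⟨d₂, d₁, hd⟩ := exists_hasExpansion hq0 hq1 hB.mem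
    refine ⟨c₂, c₁, d₂, d₁, hc, hd, ?_⟩
    -- The factor with nonzero shift has zero diagonal, so both its coefficients vanish, and every
    -- term of the predicted coefficients contains one of them.
    by_cases hσ : σ = 0
    · have h2 := hd.unique (hasLevelExpansion_of_diag_eq_zero
        (hB.diag_eq_zero fun hτ => h ⟨hσ, hτ⟩))
      simpa [h2.1, h2.2] using h1
    · have h2 := hc.unique (hasLevelExpansion_of_diag_eq_zero (hA.diag_eq_zero hσ))
      simpa [h2.1, h2.2] using h1

end

/-- The expansion of `A J B J⁻¹` in terms of those of `A` and `B`. -/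
theorem hasExpansion_mul_conjJ {q : ℝ} (hq0 : 0 < q) (hq1 : q < 1) {A B : Spinor →L[ℂ] Spinor}
    (hA : A ∈ symbolSpan q) (hB : B ∈ symbolSpan q) :
    ∃ c₂ c₁ d₂ d₁ : ℂ, HasExpansion A c₂ c₁ ∧ HasExpansion B d₂ d₁ ∧
      HasExpansion (A * conjJ B) (1 / 2 * c₂ * conj d₂)
        (1 / 2 * c₁ * conj d₂ + 1 / 2 * c₂ * conj d₁) := by
  have hzero : HasExpansion (0 : Spinor →L[ℂ] Spinor) 0 0 :=
    hasLevelExpansion_of_diag_eq_zero fun i => rfl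
  induction hA, hB using Submodule.span_induction₂ with
  | mem_mem x y hx hy =>
    obtain ⟨σ, f, g, L, M, hx⟩ := hx
    obtain ⟨σ', f', g', L', M', hy⟩ := hy
    exact hx.hasExpansion_mul_conjJ hq0 hq1 hy
  | zero_left y hy =>
    obtain ⟨d₂, d₁, hd⟩ := exists_hasExpansion hq0 hq1 hy
    exact ⟨0, 0, d₂, d₁, hzero, hd, by simpa using hzero⟩
  | zero_right x hx =>
    obtain ⟨c₂, c₁, hc⟩ := exists_hasExpansion hq0 hq1 hx
    exact ⟨c₂, c₁, 0, 0, hc, hzero, by simpa [conjJ_zero] using hzero⟩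
  | add_left x y z _ _ _ h1 h2 =>
    obtain ⟨c₂, c₁, d₂, d₁, hc, hd, h1⟩ := h1
    obtain ⟨c₂', c₁', d₂', d₁', hc', hd', h2⟩ := h2
    -- The two induction hypotheses supply coefficients of the common factor separately; uniqueness
    -- identifies them, as bilinearity requires.
    obtain ⟨rfl, rfl⟩ := hd.unique hd'
    refine ⟨_, _, _, _, hc.add hc', hd, ?_⟩
    convert! h1.add h2 using 1
    · ring
    · ring
  | add_right x y z _ _ _ h1 h2 =>
    obtain ⟨c₂, c₁, d₂, d₁, hc, hd, h1⟩ := h1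
    obtain ⟨c₂', c₁', d₂', d₁', hc', hd', h2⟩ := h2
    obtain ⟨rfl, rfl⟩ := hc.unique hc'
    refine ⟨_, _, _, _, hc, hd.add hd', ?_⟩
    convert! h1.add h2 using 1
    · rw [conjJ_add, mul_add]
    · rw [map_add]
      ring
    · rw [map_add, map_add]
      ring
  | smul_left r x y _ _ h =>
    obtain ⟨c₂, c₁, d₂, d₁, hc, hd, h⟩ := h
    refine ⟨_, _, _, _, hc.smul r, hd, ?_⟩
    convert! h.smul r using 1
    · ring
    · ring
  | smul_right r x y _ _ h =>
    obtain ⟨c₂, c₁, d₂, d₁, hc, hd, h⟩ := h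
    refine ⟨_, _, _, _, hc, hd.smul r, ?_⟩
    convert! h.smul (conj r) using 1
    · rw [conjJ_smul, mul_smul_comm]
    · rw [map_mul]
      ring
    · rw [map_mul, map_mul]
      ring

/-! ### The generators have symbols -/

theorem ket_apply (x : ℤ × ℤ × ℤ × Fin 2) (k : Label) : ket x k = if k.1 = x then 1 else 0 := by
  rw [ket]
  split_ifs with h h' h'
  · subst h'
    exact basisVec_apply_self k
  · exact basisVec_apply_ne fun he => h' (by rw [he])
  · exact absurd (h' ▸ k.2) h
  · rfl

theorem ent_of_stepVec {T : Spinor →L[ℂ] Spinor} {cp cm : ℝ → ℝ → ℝ → Matrix (Fin 2) (Fin 2) ℝ}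
    {ν : ℤ} (hT : ∀ i, T (basisVec i) = stepVec cp cm ν i) (k i : Label) :
    ent T k i =
      (if k.1 = (i.1.1 + 1, i.1.2.1 + 1, i.1.2.2.1 + ν, k.1.2.2.2) then
        ((cp (i.1.1 / 2) (i.1.2.1 / 2) (i.1.2.2.1 / 2) k.1.2.2.2 i.1.2.2.2 : ℝ) : ℂ) else 0) +
      (if k.1 = (i.1.1 - 1, i.1.2.1 + 1, i.1.2.2.1 + ν, k.1.2.2.2) then
        ((cm (i.1.1 / 2) (i.1.2.1 / 2) (i.1.2.2.1 / 2) k.1.2.2.2 i.1.2.2.2 : ℝ) : ℂ) else 0) := by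
  have hne : ∀ {t : Fin 2} {J M N : ℤ}, t ≠ k.1.2.2.2 → k.1 ≠ (J, M, N, t) := by
    rintro t J M N ht he
    exact ht (by rw [he])
  have happ : ∀ c c' : ℂ, ∀ x y : ℤ × ℤ × ℤ × Fin 2, (c • ket x + c' • ket y) k =
      c * ket x k + c' * ket y k := fun _ _ _ _ => rfl
  rw [ent, hT, stepVec]
  simp only [lp.coeFn_sum, Finset.sum_apply]
  rw [Finset.sum_eq_single k.1.2.2.2]
  · rw [happ, ket_apply, ket_apply]
    simp only [mul_ite, mul_one, mul_zero]
  · intro t _ ht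
    rw [happ, ket_apply, ket_apply, if_neg (hne ht), if_neg (hne ht), mul_zero, mul_zero, add_zero]
  · simp

/-- The step ν in 2n is written 2e − 1, with e = 1 for a and e = 0 for b. The spin values enter
because d and l depend on the spin. -/
theorem step_up_iff {e : ℤ} (k i : Label) :
    k.1 = (i.1.1 + 1, i.1.2.1 + 1, i.1.2.2.1 + (2 * e - 1), k.1.2.2.2) ↔
      (pos k).1 = (pos i).1 + 1 + (i.1.2.2.2 : ℕ) - (k.1.2.2.2 : ℕ) ∧
      (pos k).2.1 = (pos i).2.1 + 1 ∧
      (pos k).2.2.1 = (pos i).2.2.1 + e + (i.1.2.2.2 : ℕ) - (k.1.2.2.2 : ℕ) := by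
  obtain ⟨⟨J, M, N, s⟩, h⟩ := i
  obtain ⟨⟨J', M', N', s'⟩, h'⟩ := k
  rw [isLabel_iff] at h h'
  simp only [pos, Prod.mk.injEq, and_true]
  omega

theorem step_down_iff {e : ℤ} (k i : Label) :
    k.1 = (i.1.1 - 1, i.1.2.1 + 1, i.1.2.2.1 + (2 * e - 1), k.1.2.2.2) ↔
      (pos k).1 = (pos i).1 - 1 + (i.1.2.2.2 : ℕ) - (k.1.2.2.2 : ℕ) ∧
      (pos k).2.1 = (pos i).2.1 ∧
      (pos k).2.2.1 = (pos i).2.2.1 + e - 1 + (i.1.2.2.2 : ℕ) - (k.1.2.2.2 : ℕ) := by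
  obtain ⟨⟨J, M, N, s⟩, h⟩ := i
  obtain ⟨⟨J', M', N', s'⟩, h'⟩ := k
  rw [isLabel_iff] at h h'
  simp only [pos, Prod.mk.injEq, and_true]
  omega

theorem pos_eq_add_iff {k i : Label} {a b c : ℤ} {ε : Fin 2} : pos k = pos i + (a, b, c, ε) ↔
    (pos k).1 = (pos i).1 + a ∧ (pos k).2.1 = (pos i).2.1 + b ∧
      (pos k).2.2.1 = (pos i).2.2.1 + c ∧ k.1.2.2.2 = i.1.2.2.2 + ε := by
  rw [Prod.ext_iff, Prod.ext_iff, Prod.ext_iff]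
  rfl

/-- The matrices are triangular, so a step operator has four parts: two spin-preserving shifts with
symbols f ⊗ g and f' ⊗ g', and one flip from each matrix, of size O(q^d) and hence with symbol zero.
-/
theorem mem_symbolSpan_of_stepVec {q : ℝ} {T : Spinor →L[ℂ] Spinor}
    {cp cm : ℝ → ℝ → ℝ → Matrix (Fin 2) (Fin 2) ℝ} {e : ℤ} {f g f' g' : ℤ → ℝ} {L M L' M' : ℂ}
    (hT : ∀ i, T (basisVec i) = stepVec cp cm (2 * e - 1) i)
    (hcp : ∀ j μ n, cp j μ n 0 1 = 0) (hcm : ∀ j μ n, cm j μ n 1 0 = 0)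
    (hf : Symb q 1 1 (fun m => (f m : ℂ)) L) (hg : Symb q 1 e (fun m => (g m : ℂ)) M)
    (hf' : Symb q (-1) 0 (fun m => (f' m : ℂ)) L')
    (hg' : Symb q (-1) (e - 1) (fun m => (g' m : ℂ)) M')
    {C : ℝ}
    (hp : ∀ i : Label, |cp (i.1.1 / 2) (i.1.2.1 / 2) (i.1.2.2.1 / 2) i.1.2.2.2 i.1.2.2.2 -
      f (pos i).2.1 * g (pos i).2.2.1| ≤ C * q ^ (pos i).1)
    (hm : ∀ i : Label, |cm (i.1.1 / 2) (i.1.2.1 / 2) (i.1.2.2.1 / 2) i.1.2.2.2 i.1.2.2.2 -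
      f' (pos i).2.1 * g' (pos i).2.2.1| ≤ C * q ^ (pos i).1)
    (hp' : ∀ i : Label, i.1.2.2.2 = 0 →
      |cp (i.1.1 / 2) (i.1.2.1 / 2) (i.1.2.2.1 / 2) 1 0| ≤ C * q ^ (pos i).1)
    (hm' : ∀ i : Label, i.1.2.2.2 = 1 →
      |cm (i.1.1 / 2) (i.1.2.1 / 2) (i.1.2.2.1 / 2) 0 1| ≤ C * q ^ (pos i).1) :
    T ∈ symbolSpan q := by
  have hent := ent_of_stepVec hT
  simp only [step_up_iff, step_down_iff] at hent
  have hspin : ∀ s : Fin 2, s = 0 ∨ s = 1 := by decide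
  have hC : ∀ i : Label, 0 ≤ C * q ^ (pos i).1 := fun i => (abs_nonneg _).trans (hp i)
  obtain ⟨S₁, h₁⟩ := exists_shift_part T (1, 1, e, 0)
  obtain ⟨S₂, h₂⟩ := exists_shift_part T (-1, 0, e - 1, 0)
  obtain ⟨S₃, h₃⟩ := exists_shift_part T (0, 1, e - 1, 1)
  obtain ⟨S₄, h₄⟩ := exists_shift_part T (0, 0, e, 1)
  have e₁ : IsElem q (1, 1, e, 0) (fun m => (f m : ℂ)) (fun m => (g m : ℂ)) L M S₁ := by
    refine ⟨fun i k hk => by rw [h₁, if_neg hk], ⟨C, fun i k hk => ?_⟩, hf, hg,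
      fun h => absurd rfl h⟩
    obtain ⟨hd, hm₁, hl, hs⟩ := pos_eq_add_iff.mp hk
    rw [add_zero] at hs
    rw [h₁, if_pos hk, hent, hs, if_pos (by omega), if_neg (by omega), add_zero]
    simpa only [← Complex.ofReal_mul, ← Complex.ofReal_sub, Complex.norm_real,
      Real.norm_eq_abs] using hp i
  have e₂ : IsElem q (-1, 0, e - 1, 0) (fun m => (f' m : ℂ)) (fun m => (g' m : ℂ)) L' M' S₂ := by
    refine ⟨fun i k hk => by rw [h₂, if_neg hk], ⟨C, fun i k hk => ?_⟩, hf', hg',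
      fun h => absurd rfl h⟩
    obtain ⟨hd, hm₁, hl, hs⟩ := pos_eq_add_iff.mp hk
    rw [add_zero] at hs
    rw [h₂, if_pos hk, hent, hs, if_neg (by omega), if_pos (by omega), zero_add]
    simpa only [← Complex.ofReal_mul, ← Complex.ofReal_sub, Complex.norm_real,
      Real.norm_eq_abs] using hm i
  have e₃ : IsElem q (0, 1, e - 1, 1) 0 0 0 0 S₃ := by
    refine ⟨fun i k hk => by rw [h₃, if_neg hk], ⟨C, fun i k hk => ?_⟩, symb_zero _ _ _,
      symb_zero _ _ _, fun _ => rfl⟩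
    obtain ⟨hd, hm₁, hl, hs⟩ := pos_eq_add_iff.mp hk
    rw [h₃, if_pos hk, hent]
    simp only [Pi.zero_apply, mul_zero, sub_zero]
    rcases hspin i.1.2.2.2 with h0 | h0
    · have h1 : k.1.2.2.2 = 1 := by rw [hs, h0]; rfl
      rw [h0, h1, if_pos (by simp; omega), if_neg (by simp; omega), add_zero, Complex.norm_real]
      exact hp' i h0
    -- Adding 1 in `Fin 2` also allows the opposite flip, but with these integer coordinates it
    -- matches neither step, so the entry is zero.
    · have h1 : k.1.2.2.2 = 0 := by rw [hs, h0]; rfl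
      rw [h0, h1, if_neg (by simp; omega), if_neg (by simp; omega), add_zero, norm_zero]
      exact hC i
  have e₄ : IsElem q (0, 0, e, 1) 0 0 0 0 S₄ := by
    refine ⟨fun i k hk => by rw [h₄, if_neg hk], ⟨C, fun i k hk => ?_⟩, symb_zero _ _ _,
      symb_zero _ _ _, fun _ => rfl⟩
    obtain ⟨hd, hm₁, hl, hs⟩ := pos_eq_add_iff.mp hk
    rw [h₄, if_pos hk, hent]
    simp only [Pi.zero_apply, mul_zero, sub_zero]
    rcases hspin i.1.2.2.2 with h0 | h0
    · have h1 : k.1.2.2.2 = 1 := by rw [hs, h0]; rfl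
      rw [h0, h1, if_neg (by simp; omega), if_neg (by simp; omega), add_zero, norm_zero]
      exact hC i
    · have h1 : k.1.2.2.2 = 0 := by rw [hs, h0]; rfl
      rw [h0, h1, if_neg (by simp; omega), if_pos (by simp; omega), zero_add, Complex.norm_real]
      exact hm' i h0
  -- The four shifts are distinct, and the two triangularity conditions exclude every other entry.
  have hsum : T = S₁ + S₂ + S₃ + S₄ := by
    refine ent_ext fun k i => ?_
    simp only [ent_add, h₁, h₂, h₃, h₄]
    have hdis : ∀ {σ σ' : ℤ × ℤ × ℤ × Fin 2}, σ ≠ σ' → pos k = pos i + σ → pos k ≠ pos i + σ' :=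
      fun hσ h h' => hσ (add_left_cancel (h.symm.trans h'))
    by_cases c₁ : pos k = pos i + (1, 1, e, 0)
    · rw [if_pos c₁, if_neg (hdis (by simp) c₁), if_neg (hdis (by simp) c₁),
        if_neg (hdis (by simp) c₁)]
      ring
    by_cases c₂ : pos k = pos i + (-1, 0, e - 1, 0)
    · rw [if_neg c₁, if_pos c₂, if_neg (hdis (by simp) c₂), if_neg (hdis (by simp) c₂)]
      ring
    by_cases c₃ : pos k = pos i + (0, 1, e - 1, 1)
    · rw [if_neg c₁, if_neg c₂, if_pos c₃, if_neg (hdis (by simp) c₃)]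
      ring
    by_cases c₄ : pos k = pos i + (0, 0, e, 1)
    · rw [if_neg c₁, if_neg c₂, if_neg c₃, if_pos c₄]
      ring
    rw [if_neg c₁, if_neg c₂, if_neg c₃, if_neg c₄, hent]
    rw [pos_eq_add_iff] at c₁ c₂ c₃ c₄
    rcases hspin i.1.2.2.2 with h0 | h0 <;> rcases hspin k.1.2.2.2 with h1 | h1 <;>
      simp only [h0, h1, hcp, hcm, Fin.isValue, Fin.val_zero, Fin.val_one, Complex.ofReal_zero,
        ite_self, add_zero, zero_add, and_true, not_and, Fin.reduceAdd, Fin.reduceEq,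
        Nat.cast_zero, Nat.cast_one, sub_zero, not_false_eq_true, implies_true] at c₁ c₂ c₃ c₄ ⊢
    · rw [if_neg (by omega), if_neg (by omega), add_zero]
    · rw [if_neg (by omega)]
    · rw [if_neg (by omega)]
    · rw [if_neg (by omega), if_neg (by omega), add_zero]
  rw [hsum]
  exact add_mem (add_mem (add_mem e₁.mem e₂.mem) e₃.mem) e₄.mem

/-! ### Estimates for the coefficients of the generators -/

section

variable {q : ℝ}

/-- With K = (q⁻¹ − q)⁻¹ one has [w] = K q^{−w}(1 − q^{2w}). The constant K cancels between the two
square roots and the denominator, leaving a power of q times factors close to 1. -/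
theorem coef_eq (hq0 : 0 < q) (hq1 : q < 1) (e f x y z : ℝ) :
    √(q ^ e * qnum q x) * (q ^ f * √(qnum q y) * (qnum q z)⁻¹) =
      q ^ ((e - x) / 2 + f - y / 2 + z) * √(1 - q ^ (2 * x)) * √(1 - q ^ (2 * y)) *
        (1 - q ^ (2 * z))⁻¹ := by
  have hqi : 1 < q⁻¹ := (one_lt_inv₀ hq0).mpr hq1
  have hd : 0 < q⁻¹ - q := by linarith
  set K := (q⁻¹ - q)⁻¹ with hK
  have hK0 : 0 < K := by positivity
  have hnum : ∀ w, qnum q w = K * q ^ (-w) * (1 - q ^ (2 * w)) := by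
    intro w
    have h2 : q ^ (-w) * q ^ (2 * w) = q ^ w := by
      rw [← Real.rpow_add hq0]
      ring_nf
    rw [mul_sub, mul_one, mul_assoc, h2, qnum, hK, ← neg_sub (q ^ (-w)), ← neg_sub q⁻¹ q,
      neg_div_neg_eq]
    field_simp
  have hroot : ∀ w : ℝ, √(q ^ w) = q ^ (w / 2) := by
    intro w
    rw [Real.sqrt_eq_rpow, ← Real.rpow_mul hq0.le]
    ring_nf
  have h1 : √(q ^ e * qnum q x) = √K * q ^ ((e - x) / 2) * √(1 - q ^ (2 * x)) := by
    rw [hnum, ← hroot, ← Real.sqrt_mul hK0.le, ← Real.sqrt_mul (by positivity),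
      sub_eq_add_neg e, Real.rpow_add hq0]
    ring_nf
  have h2 : √(qnum q y) = √K * q ^ (-y / 2) * √(1 - q ^ (2 * y)) := by
    rw [hnum, ← hroot, ← Real.sqrt_mul hK0.le, ← Real.sqrt_mul (by positivity)]
  have h3 : (qnum q z)⁻¹ = K⁻¹ * q ^ z * (1 - q ^ (2 * z))⁻¹ := by
    rw [hnum, mul_inv, mul_inv, ← Real.rpow_neg hq0.le, neg_neg]
  have h4 : q ^ ((e - x) / 2 + f - y / 2 + z) =
      q ^ ((e - x) / 2) * q ^ f * q ^ (-y / 2) * q ^ z := by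
    rw [← Real.rpow_add hq0, ← Real.rpow_add hq0, ← Real.rpow_add hq0]
    ring_nf
  rw [h1, h2, h3, h4]
  have h5 : √K * √K * K⁻¹ = 1 := by rw [Real.mul_self_sqrt hK0.le, mul_inv_cancel₀ hK0.ne']
  linear_combination (q ^ ((e - x) / 2) * √(1 - q ^ (2 * x)) * q ^ f * q ^ (-y / 2) *
    √(1 - q ^ (2 * y)) * q ^ z * (1 - q ^ (2 * z))⁻¹) * h5

/-- The constant in the estimates for the coefficients of the generators. -/
noncomputable def coefConst (q : ℝ) : ℝ := (2 + (1 - q ^ (2 : ℝ))⁻¹) * q ^ (-1 : ℝ)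

theorem one_sub_sqrt_bound (hq0 : 0 < q) (hq1 : q < 1) {x : ℝ} (hx : 0 ≤ x) :
    0 ≤ √(1 - q ^ (2 * x)) ∧ √(1 - q ^ (2 * x)) ≤ 1 ∧ 1 - √(1 - q ^ (2 * x)) ≤ q ^ (2 * x) := by
  have h0 : 0 < q ^ (2 * x) := by positivity
  have h1 : q ^ (2 * x) ≤ 1 := Real.rpow_le_one hq0.le hq1.le (by linarith)
  refine ⟨Real.sqrt_nonneg _, Real.sqrt_le_one.mpr (by linarith), ?_⟩
  have h2 : 1 - q ^ (2 * x) ≤ √(1 - q ^ (2 * x)) := by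
    refine Real.le_sqrt_of_sq_le ?_
    nlinarith
  linarith

theorem inv_one_sub_bound (hq0 : 0 < q) (hq1 : q < 1) {z : ℝ} (hz : 1 ≤ z) :
    1 ≤ (1 - q ^ (2 * z))⁻¹ ∧ (1 - q ^ (2 * z))⁻¹ ≤ (1 - q ^ (2 : ℝ))⁻¹ ∧
      (1 - q ^ (2 * z))⁻¹ - 1 ≤ (1 - q ^ (2 : ℝ))⁻¹ * q ^ z := by
  have h0 : 0 < q ^ (2 * z) := by positivity
  have h1 : q ^ (2 * z) ≤ q ^ (2 : ℝ) :=
    Real.rpow_le_rpow_of_exponent_ge hq0 hq1.le (by linarith)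
  have h2 : q ^ (2 : ℝ) < 1 := Real.rpow_lt_one hq0.le hq1 (by norm_num)
  have h3 : 0 < 1 - q ^ (2 : ℝ) := by linarith
  have h4 : 0 < 1 - q ^ (2 * z) := by linarith
  have h5 : (1 - q ^ (2 * z))⁻¹ ≤ (1 - q ^ (2 : ℝ))⁻¹ := inv_anti₀ h3 (by linarith)
  refine ⟨(one_le_inv₀ h4).mpr (by linarith), h5, ?_⟩
  have h6 : (1 - q ^ (2 * z))⁻¹ - 1 = (1 - q ^ (2 * z))⁻¹ * q ^ (2 * z) := by
    field_simp
    ring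
  rw [h6]
  have h7 : q ^ (2 * z) ≤ q ^ z := Real.rpow_le_rpow_of_exponent_ge hq0 hq1.le (by linarith)
  gcongr

/-- The difference telescopes into three replacements: the denominator factor by 1, then each square
root by X and Y. A root may be replaced by 1 when q^E times its deviation q^{2x} is already
O(q^{d−1}). The three errors and the slack of one power of q account for `coefConst`. -/
theorem coef_approx (hq0 : 0 < q) (hq1 : q < 1) {e f x y z E X Y V W d : ℝ}
    (hV : V = √(q ^ e * qnum q x) * (q ^ f * √(qnum q y) * (qnum q z)⁻¹))
    (hW : W = q ^ E * X * Y) (hE : (e - x) / 2 + f - y / 2 + z = E) (hE0 : 0 ≤ E)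
    (hx : 0 ≤ x) (hy : 0 ≤ y) (hz : 1 ≤ z) (hdz : d - 1 ≤ z)
    (hX : X = √(1 - q ^ (2 * x)) ∨ X = 1 ∧ d - 1 ≤ E + 2 * x)
    (hY : Y = √(1 - q ^ (2 * y)) ∨ Y = 1 ∧ d - 1 ≤ E + 2 * y) :
    |V - W| ≤ coefConst q * q ^ d := by
  obtain ⟨hx0, hx1, hx2⟩ := one_sub_sqrt_bound hq0 hq1 hx
  obtain ⟨hy0, hy1, hy2⟩ := one_sub_sqrt_bound hq0 hq1 hy
  obtain ⟨hw1, -, hw2⟩ := inv_one_sub_bound hq0 hq1 hz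
  rw [hV, hW, coef_eq hq0 hq1, hE]
  have hq2 : q ^ (2 : ℝ) < 1 := Real.rpow_lt_one hq0.le hq1 (by norm_num)
  have hQ : 0 < q ^ (d - 1) := by positivity
  have hP0 : 0 < q ^ E := by positivity
  have hP1 : q ^ E ≤ 1 := Real.rpow_le_one hq0.le hq1.le hE0
  have hdiff : ∀ {w R Z : ℝ}, R ≤ 1 → 1 - R ≤ q ^ (2 * w) →
      (Z = R ∨ Z = 1 ∧ d - 1 ≤ E + 2 * w) → |q ^ E * (R - Z)| ≤ q ^ (d - 1) := by
    rintro w R Z h1 h2 (rfl | ⟨rfl, h3⟩)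
    · simpa using hQ.le
    · rw [abs_mul, abs_of_pos hP0, abs_sub_comm, abs_of_nonneg (by linarith)]
      calc q ^ E * (1 - R) ≤ q ^ E * q ^ (2 * w) := by gcongr
        _ = q ^ (E + 2 * w) := (Real.rpow_add hq0 _ _).symm
        _ ≤ q ^ (d - 1) := Real.rpow_le_rpow_of_exponent_ge hq0 hq1.le h3
  have hXd := hdiff hx1 hx2 hX
  have hYd := hdiff hy1 hy2 hY
  have hX1 : |X| ≤ 1 := by
    rcases hX with rfl | ⟨rfl, -⟩
    · rwa [abs_of_nonneg hx0]
    · simp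
  set w := (1 - q ^ (2 * z))⁻¹
  set R := √(1 - q ^ (2 * x))
  set S := √(1 - q ^ (2 * y))
  have hK : 0 ≤ (1 - q ^ (2 : ℝ))⁻¹ := inv_nonneg.mpr (by linarith)
  have hw3 : w - 1 ≤ (1 - q ^ (2 : ℝ))⁻¹ * q ^ (d - 1) :=
    hw2.trans (mul_le_mul_of_nonneg_left
      (Real.rpow_le_rpow_of_exponent_ge hq0 hq1.le hdz) hK)
  have h1 : |q ^ E * R * S * (w - 1)| ≤ (1 - q ^ (2 : ℝ))⁻¹ * q ^ (d - 1) := by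
    rw [abs_of_nonneg (mul_nonneg (by positivity) (by linarith))]
    have : q ^ E * R * S ≤ 1 := mul_le_one₀ (mul_le_one₀ hP1 hx0 hx1) hy0 hy1
    calc q ^ E * R * S * (w - 1) ≤ 1 * (w - 1) :=
          mul_le_mul_of_nonneg_right this (by linarith)
      _ ≤ _ := by rw [one_mul]; exact hw3
  have h2 : |q ^ E * (R - X) * S| ≤ q ^ (d - 1) := by
    rw [abs_mul, abs_of_nonneg hy0]
    exact (mul_le_of_le_one_right (abs_nonneg _) hy1).trans hXd
  have h3 : |X * (q ^ E * (S - Y))| ≤ q ^ (d - 1) := by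
    rw [abs_mul]
    exact (mul_le_of_le_one_left (abs_nonneg _) hX1).trans hYd
  have h4 : coefConst q * q ^ d = (2 + (1 - q ^ (2 : ℝ))⁻¹) * q ^ (d - 1) := by
    rw [coefConst, mul_assoc, ← Real.rpow_add hq0]
    ring_nf
  rw [h4, show q ^ E * R * S * w - q ^ E * X * Y =
    q ^ E * R * S * (w - 1) + q ^ E * (R - X) * S + X * (q ^ E * (S - Y)) by ring]
  refine (abs_add_three _ _ _).trans ?_
  linarith

/-- Spin-flipping entries have a second denominator [z'], whose extra factor q^{z'} brings them down
to O(q^d). -/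
theorem coef_small (hq0 : 0 < q) (hq1 : q < 1) {e f x y z z' V d : ℝ}
    (hV : V = √(q ^ e * qnum q x) * (q ^ f * √(qnum q y) * (qnum q z * qnum q z')⁻¹))
    (hx : 0 ≤ x) (hy : 0 ≤ y) (hz : 1 ≤ z) (hz' : 1 ≤ z')
    (hd : d ≤ (e - x) / 2 + f - y / 2 + z + z') : |V| ≤ coefConst q * q ^ d := by
  obtain ⟨hx0, hx1, -⟩ := one_sub_sqrt_bound hq0 hq1 hx
  obtain ⟨hy0, hy1, -⟩ := one_sub_sqrt_bound hq0 hq1 hy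
  obtain ⟨hw1, hw2, -⟩ := inv_one_sub_bound hq0 hq1 hz
  obtain ⟨hv0, hv1⟩ := one_div_qnum hq0 hq1 hz'
  have hV' : V = q ^ ((e - x) / 2 + f - y / 2 + z) * √(1 - q ^ (2 * x)) * √(1 - q ^ (2 * y)) *
      (1 - q ^ (2 * z))⁻¹ * (qnum q z')⁻¹ := by
    rw [hV, ← coef_eq hq0 hq1, mul_inv]
    ring
  have hq2 : q ^ (2 : ℝ) < 1 := Real.rpow_lt_one hq0.le hq1 (by norm_num)
  have hK : 0 ≤ (1 - q ^ (2 : ℝ))⁻¹ := inv_nonneg.mpr (by linarith)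
  have hw0 : 0 ≤ (1 - q ^ (2 * z))⁻¹ := by linarith
  rw [hV', abs_of_nonneg (by positivity)]
  calc _ ≤ q ^ ((e - x) / 2 + f - y / 2 + z) * 1 * 1 * (1 - q ^ (2 : ℝ))⁻¹ * q ^ (z' - 1) := by
        gcongr
    _ = (1 - q ^ (2 : ℝ))⁻¹ * q ^ ((e - x) / 2 + f - y / 2 + z + z' - 1) := by
        rw [mul_one, mul_one, mul_right_comm, ← Real.rpow_add hq0, mul_comm]
        ring_nf
    _ ≤ (2 + (1 - q ^ (2 : ℝ))⁻¹) * q ^ (-1 + d) := by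
        refine mul_le_mul (by linarith) ?_ (by positivity) (by positivity)
        exact Real.rpow_le_rpow_of_exponent_ge hq0 hq1.le (by linarith)
    _ = coefConst q * q ^ d := by rw [coefConst, mul_assoc, ← Real.rpow_add hq0]

/-- The coefficient `√(1 - q^{2(m+1)})` of the weighted unilateral shift. -/
noncomputable def sqrtSymb (q : ℝ) (m : ℤ) : ℝ :=
  if 0 ≤ m then √(1 - q ^ (2 * ((m : ℝ) + 1))) else 0

/-- The sequence `c q^m`. -/
noncomputable def powSymb (q c : ℝ) (m : ℤ) : ℝ := if 0 ≤ m then c * q ^ (m : ℝ) else 0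

theorem symb_sqrt (hq0 : 0 < q) (hq1 : q < 1) : Symb q 1 1 (fun m => (sqrtSymb q m : ℂ)) 1 := by
  refine ⟨⟨1, fun m => ?_⟩, ⟨1, fun m => ?_⟩, fun m hm => ?_, fun h => absurd rfl h⟩
  · rw [Complex.norm_real, sqrtSymb]
    split_ifs with h
    · have h0 : (0 : ℝ) ≤ m := by exact_mod_cast h
      obtain ⟨h1, h2, -⟩ := one_sub_sqrt_bound hq0 hq1 (x := (m : ℝ) + 1) (by linarith)
      rwa [Real.norm_of_nonneg h1]
    · simp
  · rw [← Complex.ofReal_one, ← Complex.ofReal_sub, Complex.norm_real, Real.norm_eq_abs,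
      abs_sub_comm, sqrtSymb, one_mul]
    split_ifs with h
    · have h0 : (0 : ℝ) ≤ m := by exact_mod_cast h
      obtain ⟨h1, h2, h3⟩ := one_sub_sqrt_bound hq0 hq1 (x := (m : ℝ) + 1) (by linarith)
      rw [abs_of_nonneg (by linarith), ← Real.rpow_intCast]
      exact h3.trans (Real.rpow_le_rpow_of_exponent_ge hq0 hq1.le (by linarith))
    · rw [sub_zero, abs_one]
      exact one_le_zpow_of_nonpos₀ hq0 hq1.le (by omega)
  · rw [sqrtSymb, if_neg (by omega), Complex.ofReal_zero]

theorem symb_pow (hq0 : 0 < q) (hq1 : q < 1) (a : ℤ) (c : ℝ) :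
    Symb q a 0 (fun m => (powSymb q c m : ℂ)) 0 := by
  refine ⟨⟨|c|, fun m => ?_⟩, ⟨|c|, fun m => ?_⟩, fun m hm => ?_, fun _ => rfl⟩
  · rw [Complex.norm_real, powSymb]
    split_ifs with h
    · have h0 : (0 : ℝ) ≤ m := by exact_mod_cast h
      rw [Real.norm_eq_abs, abs_mul, abs_of_nonneg (a := q ^ (m : ℝ)) (by positivity)]
      exact mul_le_of_le_one_right (abs_nonneg _) (Real.rpow_le_one hq0.le hq1.le h0)
    · simp
  · rw [sub_zero, Complex.norm_real, powSymb]
    split_ifs with h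
    · rw [Real.norm_eq_abs, abs_mul, abs_of_nonneg (a := q ^ (m : ℝ)) (by positivity),
        Real.rpow_intCast]
    · rw [norm_zero]
      positivity
  · rw [powSymb, if_neg (by omega), Complex.ofReal_zero]

theorem symb_sqrt_pred (hq0 : 0 < q) (hq1 : q < 1) :
    Symb q (-1) (-1) (fun m => (sqrtSymb q (m - 1) : ℂ)) 1 := by
  simpa only [Complex.conj_ofReal, map_one] using (symb_sqrt hq0 hq1).conj_symm hq0

theorem sqrtSymb_pred {m : ℤ} (hm : 0 ≤ m) : sqrtSymb q (m - 1) = √(1 - q ^ (2 * (m : ℝ))) := by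
  rw [sqrtSymb]
  split_ifs with h
  · push_cast
    ring_nf
  -- At m = 0 the cut-off agrees with the formula, since √(1 − q⁰) = 0.
  · obtain rfl : m = 0 := by omega
    simp

/-- The coordinates of a label in terms of `j`, `μ`, `n`. -/
theorem pos_real (i : Label) :
    ((pos i).1 : ℝ) = 2 * ((i.1.1 : ℝ) / 2) + 1 - ((i.1.2.2.2 : ℕ) : ℝ) ∧
    ((pos i).2.1 : ℝ) = (i.1.1 : ℝ) / 2 + (i.1.2.1 : ℝ) / 2 ∧
    ((pos i).2.2.1 : ℝ) = (i.1.1 : ℝ) / 2 + (i.1.2.2.1 : ℝ) / 2 + 1 / 2 -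
      ((i.1.2.2.2 : ℕ) : ℝ) := by
  obtain ⟨⟨J, M, N, s⟩, h⟩ := i
  rw [isLabel_iff] at h
  simp only [pos]
  have h1 : 2 * ((J + M) / 2) = J + M := by omega
  have h2 : 2 * ((J + N + 1) / 2 - ((s : ℕ) : ℤ)) = J + N + 1 - 2 * ((s : ℕ) : ℤ) := by omega
  have h1' : (2 : ℝ) * (((J + M) / 2 : ℤ) : ℝ) = J + M := by exact_mod_cast h1
  have h2' : (2 : ℝ) * (((J + N + 1) / 2 - ((s : ℕ) : ℤ) : ℤ) : ℝ) = J + N + 1 - 2 * (s : ℕ) := by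
    exact_mod_cast h2
  refine ⟨?_, by linarith, by linarith⟩
  push_cast
  ring

theorem pos_bounds (i : Label) :
    (0 : ℝ) ≤ (pos i).2.1 ∧ ((pos i).2.1 : ℝ) ≤ (pos i).1 + ((i.1.2.2.2 : ℕ) : ℝ) - 1 ∧
    (0 : ℝ) ≤ (pos i).2.2.1 ∧ ((pos i).2.2.1 : ℝ) ≤ (pos i).1 - ((i.1.2.2.2 : ℕ) : ℝ) := by
  have h := valid_pos i
  have h0 : (pos i).2.2.2 = i.1.2.2.2 := rfl
  simp only [Valid, h0] at h
  obtain ⟨h1, h2, h3, h4⟩ := h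
  have h2' : (pos i).2.1 ≤ (pos i).1 + ((i.1.2.2.2 : ℕ) : ℤ) - 1 := by omega
  have h4' : (pos i).2.2.1 ≤ (pos i).1 - ((i.1.2.2.2 : ℕ) : ℤ) := by omega
  exact ⟨by exact_mod_cast h1, by exact_mod_cast h2', by exact_mod_cast h3, by exact_mod_cast h4'⟩

/-- Modulo O(q^d), a is the shift (1, 1, 1) with weight √(1−q^{2(m+1)})√(1−q^{2(l+1)}) plus the
shift (−1, 0, 0) with weight q^{m+l+1}. -/
theorem piA_mem (hq0 : 0 < q) (hq1 : q < 1) : piA q ∈ symbolSpan q := by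
  refine mem_symbolSpan_of_stepVec (e := 1) (piA_basisVec hq0 hq1) (by simp [alphaPlus])
    (by simp [alphaMinus]) (symb_sqrt hq0 hq1) (symb_sqrt hq0 hq1) (symb_pow hq0 hq1 (-1) q)
    (symb_pow hq0 hq1 (-1) 1) (C := coefConst q) ?_ ?_ ?_ ?_
  all_goals
    intro i
    obtain ⟨hd, hm, hl⟩ := pos_real i
    obtain ⟨hm0, hm1, hl0, hl1⟩ := pos_bounds i
    have hm0' : 0 ≤ (pos i).2.1 := by exact_mod_cast hm0
    have hl0' : 0 ≤ (pos i).2.2.1 := by exact_mod_cast hl0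
    simp only [sqrtSymb, powSymb, if_pos hm0', if_pos hl0', ← Real.rpow_intCast]
    generalize ((pos i).1 : ℝ) = d at *
    generalize ((pos i).2.1 : ℝ) = m at *
    generalize ((pos i).2.2.1 : ℝ) = l at *
    generalize (i.1.1 : ℝ) / 2 = j at *
    generalize (i.1.2.1 : ℝ) / 2 = μ at *
    generalize (i.1.2.2.1 : ℝ) / 2 = n at *
    generalize i.1.2.2.2 = s at *
  · fin_cases s <;>
      simp only [alphaPlus, Matrix.smul_apply, Matrix.of_apply, Matrix.cons_val',
        Matrix.cons_val_zero, Matrix.cons_val_one, Matrix.cons_val_fin_one, smul_eq_mul,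
        Fin.zero_eta, Fin.mk_one, Fin.isValue, Nat.cast_zero,
        Nat.cast_one, sub_zero, add_zero, div_eq_mul_inv _ (qnum _ _)] at *
    · exact coef_approx hq0 hq1 (E := 0) (X := √(1 - q ^ (2 * (m + 1))))
        (Y := √(1 - q ^ (2 * (l + 1)))) rfl (by rw [Real.rpow_zero, one_mul]) (by linarith) le_rfl
        (by linarith) (by linarith) (by linarith) (by linarith) (Or.inl (by rw [hm]))
        (Or.inl (by rw [hl]; ring_nf))
    · exact coef_approx hq0 hq1 (E := 0) (X := √(1 - q ^ (2 * (m + 1))))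
        (Y := √(1 - q ^ (2 * (l + 1)))) rfl (by rw [Real.rpow_zero, one_mul]) (by linarith) le_rfl
        (by linarith) (by linarith) (by linarith) (by linarith) (Or.inl (by rw [hm]))
        (Or.inl (by rw [hl]; ring_nf))
  · have hW : q * q ^ m * (1 * q ^ l) = q ^ (m + l + 1) * 1 * 1 := by
      rw [Real.rpow_add hq0, Real.rpow_add hq0, Real.rpow_one]
      ring
    fin_cases s <;>
      simp only [alphaMinus, Matrix.smul_apply, Matrix.of_apply, Matrix.cons_val',
        Matrix.cons_val_zero, Matrix.cons_val_one, Matrix.cons_val_fin_one, smul_eq_mul,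
        Fin.zero_eta, Fin.mk_one, Fin.isValue, Nat.cast_zero,
        Nat.cast_one, sub_zero, add_zero, div_eq_mul_inv _ (qnum _ _)] at *
    · exact coef_approx hq0 hq1 rfl hW (by linarith) (by linarith)
        (by linarith) (by linarith) (by linarith) (by linarith) (Or.inr ⟨rfl, by linarith⟩)
        (Or.inr ⟨rfl, by linarith⟩)
    · exact coef_approx hq0 hq1 rfl hW (by linarith) (by linarith)
        (by linarith) (by linarith) (by linarith) (by linarith) (Or.inr ⟨rfl, by linarith⟩)
        (Or.inr ⟨rfl, by linarith⟩)
  · rintro rfl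
    simp only [alphaPlus, Matrix.smul_apply, Matrix.of_apply, Matrix.cons_val',
        Matrix.cons_val_zero, Matrix.cons_val_one, Matrix.cons_val_fin_one, smul_eq_mul,
        Fin.isValue, Fin.val_zero, Nat.cast_zero, sub_zero, add_zero, div_eq_mul_inv _ (_ * _)] at *
    exact coef_small hq0 hq1 rfl (by linarith) (by linarith) (by linarith) (by linarith)
      (by linarith)
  · rintro rfl
    simp only [alphaMinus, Matrix.smul_apply, Matrix.of_apply, Matrix.cons_val',
        Matrix.cons_val_zero, Matrix.cons_val_one, Matrix.cons_val_fin_one, smul_eq_mul,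
        Fin.isValue, Fin.val_one, Nat.cast_one, mul_neg, abs_neg, div_eq_mul_inv _ (_ * _)] at *
    exact coef_small hq0 hq1 rfl (by linarith) (by linarith) (by linarith) (by linarith)
      (by linarith)

/-- Modulo O(q^d), b is the shift (1, 1, 0) with weight √(1−q^{2(m+1)}) q^l plus the shift (−1, 0,
−1) with weight −q^m √(1−q^{2l}). -/
theorem piB_mem (hq0 : 0 < q) (hq1 : q < 1) : piB q ∈ symbolSpan q := by
  have hz : ∀ y : ℝ, √y = q ^ (0 : ℝ) * √y := fun y => by rw [Real.rpow_zero, one_mul]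
  refine mem_symbolSpan_of_stepVec (e := 0) (piB_basisVec hq0 hq1) (by simp [betaPlus])
    (by simp [betaMinus]) (symb_sqrt hq0 hq1) (symb_pow hq0 hq1 1 1) (symb_pow hq0 hq1 (-1) (-1))
    (symb_sqrt_pred hq0 hq1) (C := coefConst q) ?_ ?_ ?_ ?_
  all_goals
    intro i
    obtain ⟨hd, hm, hl⟩ := pos_real i
    obtain ⟨hm0, hm1, hl0, hl1⟩ := pos_bounds i
    have hm0' : 0 ≤ (pos i).2.1 := by exact_mod_cast hm0
    have hl0' : 0 ≤ (pos i).2.2.1 := by exact_mod_cast hl0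
    try rw [sqrtSymb_pred hl0']
    simp only [sqrtSymb, powSymb, if_pos hm0', if_pos hl0',
      ← Real.rpow_intCast]
    generalize ((pos i).1 : ℝ) = d at *
    generalize ((pos i).2.1 : ℝ) = m at *
    generalize ((pos i).2.2.1 : ℝ) = l at *
    generalize (i.1.1 : ℝ) / 2 = j at *
    generalize (i.1.2.1 : ℝ) / 2 = μ at *
    generalize (i.1.2.2.1 : ℝ) / 2 = n at *
    generalize i.1.2.2.2 = s at *
  · have hW : √(1 - q ^ (2 * (m + 1))) * (1 * q ^ l) =
        q ^ l * √(1 - q ^ (2 * (m + 1))) * 1 := by ring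
    fin_cases s <;>
      simp only [betaPlus, Matrix.smul_apply, Matrix.of_apply, Matrix.cons_val',
        Matrix.cons_val_zero, Matrix.cons_val_one, Matrix.cons_val_fin_one, smul_eq_mul,
        Fin.zero_eta, Fin.mk_one, Fin.isValue, Nat.cast_zero,
        Nat.cast_one, sub_zero, add_zero, div_eq_mul_inv _ (qnum _ _)] at *
    · rw [hz (qnum q (j - n + 3 / 2))]
      exact coef_approx hq0 hq1 rfl hW (by linarith)
        (by linarith) (by linarith) (by linarith) (by linarith) (by linarith)
        (Or.inl (by rw [hm])) (Or.inr ⟨rfl, by linarith⟩)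
    · exact coef_approx hq0 hq1 rfl hW (by linarith) (by linarith)
        (by linarith) (by linarith) (by linarith) (by linarith) (Or.inl (by rw [hm]))
        (Or.inr ⟨rfl, by linarith⟩)
  · have hW : q ^ m * √(1 - q ^ (2 * l)) = q ^ m * 1 * √(1 - q ^ (2 * l)) := by ring
    fin_cases s <;>
      simp only [betaMinus, Matrix.smul_apply, Matrix.of_apply, Matrix.cons_val',
        Matrix.cons_val_zero, Matrix.cons_val_one, Matrix.cons_val_fin_one, smul_eq_mul,
        Fin.zero_eta, Fin.mk_one, Fin.isValue, Nat.cast_zero,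
        Nat.cast_one, sub_zero, add_zero, div_eq_mul_inv _ (qnum _ _), mul_neg, neg_mul, one_mul,
        neg_sub_neg] at *
    · rw [abs_sub_comm]
      exact coef_approx hq0 hq1 rfl hW (by linarith) (by linarith)
        (by linarith) (by linarith) (by linarith) (by linarith) (Or.inr ⟨rfl, by linarith⟩)
        (Or.inl (by rw [hl]))
    · rw [abs_sub_comm, hz (qnum q (j + n - 1 / 2))]
      exact coef_approx hq0 hq1 rfl hW (by linarith)
        (by linarith) (by linarith) (by linarith) (by linarith) (by linarith)
        (Or.inr ⟨rfl, by linarith⟩) (Or.inl (by rw [hl]; ring_nf))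
  · rintro rfl
    simp only [betaPlus, Matrix.smul_apply, Matrix.of_apply, Matrix.cons_val',
        Matrix.cons_val_zero, Matrix.cons_val_one, Matrix.cons_val_fin_one, smul_eq_mul, mul_neg,
        abs_neg, Fin.isValue, Fin.val_zero, Nat.cast_zero, sub_zero, add_zero,
        div_eq_mul_inv _ (_ * _)] at *
    exact coef_small hq0 hq1 rfl (by linarith) (by linarith) (by linarith) (by linarith)
      (by linarith)
  · rintro rfl
    simp only [betaMinus, Matrix.smul_apply, Matrix.of_apply, Matrix.cons_val',
        Matrix.cons_val_zero, Matrix.cons_val_one, Matrix.cons_val_fin_one, smul_eq_mul,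
        Fin.isValue, Fin.val_one, Nat.cast_one, mul_neg, abs_neg, div_eq_mul_inv _ (_ * _)] at *
    exact coef_small hq0 hq1 rfl (by linarith) (by linarith) (by linarith) (by linarith)
      (by linarith)

end

/-! ### One-forms lie in the span; the integral formulas -/

theorem piAlgebra_subset_symbolSpan {q : ℝ} (hq0 : 0 < q) (hq1 : q < 1)
    {T : Spinor →L[ℂ] Spinor} (hT : T ∈ piAlgebra q) : T ∈ symbolSpan q := by
  induction hT using StarAlgebra.adjoin_induction with
  | mem x hx =>
    rcases hx with rfl | rfl
    · exact piA_mem hq0 hq1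
    · exact piB_mem hq0 hq1
  | algebraMap r =>
    rw [Algebra.algebraMap_eq_smul_one]
    exact Submodule.smul_mem _ _ (one_mem_symbolSpan hq0 hq1)
  | add x y _ _ hx hy => exact add_mem hx hy
  | mul x y _ _ hx hy => exact mul_mem_symbolSpan hq0 hq1 hx hy
  | star x _ hx => exact star_mem_symbolSpan hq0 hx

theorem IsDeltaOneForm.mem_symbolSpan {q : ℝ} (hq0 : 0 < q) (hq1 : q < 1)
    {A : Spinor →L[ℂ] Spinor} (hA : IsDeltaOneForm q A) : A ∈ symbolSpan q := by
  obtain ⟨n, x, y, d, hx, hy, hd, rfl⟩ := hA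
  refine sum_mem fun k _ => mul_mem_symbolSpan hq0 hq1
    (piAlgebra_subset_symbolSpan hq0 hq1 (hx k)) ?_
  obtain ⟨S, hS, h⟩ := exists_isDelta (piAlgebra_subset_symbolSpan hq0 hq1 (hy k))
  rwa [(hd k).unique h]

theorem HasExpansion.hasNCIntegral {T : Spinor →L[ℂ] Spinor} {c₂ c₁ : ℂ}
    (h : HasExpansion T c₂ c₁) :
    HasNCIntegral (T * absDiracPow 3) c₂ ∧ HasNCIntegral (T * absDiracPow 2) c₁ :=
  HasLevelExpansion.hasNCIntegral h

theorem ncIntegral_mul_conjJ {q : ℝ} (hq0 : 0 < q) (hq1 : q < 1) {A B : Spinor →L[ℂ] Spinor}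
    (hA : A ∈ symbolSpan q) (hB : B ∈ symbolSpan q) :
    HasNCIntegral (A * conjJ B * absDiracPow 3)
      (1 / 2 * ncIntegral (A * absDiracPow 3) * conj (ncIntegral (B * absDiracPow 3))) ∧
    HasNCIntegral (A * conjJ B * absDiracPow 2)
      (1 / 2 * ncIntegral (A * absDiracPow 2) * conj (ncIntegral (B * absDiracPow 3)) +
        1 / 2 * ncIntegral (A * absDiracPow 3) * conj (ncIntegral (B * absDiracPow 2))) := by
  obtain ⟨c₂, c₁, d₂, d₁, hc, hd, h⟩ := hasExpansion_mul_conjJ hq0 hq1 hA hB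
  rw [hc.hasNCIntegral.1.ncIntegral_eq, hc.hasNCIntegral.2.ncIntegral_eq,
    hd.hasNCIntegral.1.ncIntegral_eq, hd.hasNCIntegral.2.ncIntegral_eq]
  exact h.hasNCIntegral

theorem IsDelta.diag_eq_zero {T S : Spinor →L[ℂ] Spinor} (h : IsDelta T S) (i : Label) :
    ent S i i = 0 := by
  rw [isDelta_iff.mp h]
  simp

/-- By the Leibniz rule this operator is δ(T²); entrywise, the differences of eigenvalues in the two
products cancel. -/
theorem IsDelta.diag_mul_add_mul_eq_zero {T S : Spinor →L[ℂ] Spinor} (h : IsDelta T S)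
    (i : Label) : ent (S * T + T * S) i i = 0 := by
  rw [ent_add, ((hasSum_ent_mul S T i i).add (hasSum_ent_mul T S i i)).unique
    (hasSum_zero.congr_fun fun j => ?_)]
  rw [isDelta_iff.mp h, isDelta_iff.mp h]
  push_cast
  ring

/-- Write ST = ½([S, T] + (ST + TS)). The commutator has zero leading coefficient by the trace
property, and the anticommutator has zero diagonal. -/
theorem IsDelta.hasNCIntegral_mul_self {q : ℝ} (hq0 : 0 < q) (hq1 : q < 1)
    {T S : Spinor →L[ℂ] Spinor} (hT : T ∈ symbolSpan q) (hS : S ∈ symbolSpan q)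
    (h : IsDelta T S) : HasNCIntegral (S * T * absDiracPow 3) 0 := by
  obtain ⟨c, hc⟩ := hasExpansion_commutator hq0 hq1 hS hT
  have h0 : HasExpansion (S * T + T * S) 0 0 :=
    hasLevelExpansion_of_diag_eq_zero h.diag_mul_add_mul_eq_zero
  have h1 := (hc.add h0).smul (1 / 2)
  rw [add_zero, mul_zero, show (1 / 2 : ℂ) • (S * T - T * S + (S * T + T * S)) = S * T by
    module] at h1
  exact h1.hasNCIntegral.1

end SUq2

open SUq2
theorem mainTheorem3 (q : ℝ) (hq0 : 0 < q) (hq1 : q < 1)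
    (A B : Spinor →L[ℂ] Spinor) (hA : IsDeltaOneForm q A) (hB : IsDeltaOneForm q B) :
    (NCIntegrable (A * absDiracPow 3) ∧ NCIntegrable (A * absDiracPow 2) ∧
      NCIntegrable (B * absDiracPow 3) ∧ NCIntegrable (B * absDiracPow 2) ∧
      NCIntegrable (A ^ 2 * absDiracPow 3)) ∧
    HasNCIntegral (A * conjJ B * absDiracPow 3)
      (1 / 2 * ncIntegral (A * absDiracPow 3) * conj (ncIntegral (B * absDiracPow 3))) ∧
    HasNCIntegral (A * conjJ B * absDiracPow 2)
      (1 / 2 * ncIntegral (A * absDiracPow 2) * conj (ncIntegral (B * absDiracPow 3)) +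
        1 / 2 * ncIntegral (A * absDiracPow 3) * conj (ncIntegral (B * absDiracPow 2))) ∧
    HasNCIntegral (A ^ 2 * conjJ B * absDiracPow 3)
      (1 / 2 * ncIntegral (A ^ 2 * absDiracPow 3) * conj (ncIntegral (B * absDiracPow 3))) ∧
    ∃ dA : Spinor →L[ℂ] Spinor, IsDelta A dA ∧
      HasNCIntegral (dA * A * absDiracPow 3) 0 ∧
      HasNCIntegral (dA * conjJ A * absDiracPow 3) 0 := by
  have hA' := hA.mem_symbolSpan hq0 hq1
  have hB' := hB.mem_symbolSpan hq0 hq1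
  have hA2 : A ^ 2 ∈ symbolSpan q := by
    rw [sq]
    exact mul_mem_symbolSpan hq0 hq1 hA' hA'
  have hint : ∀ {T}, T ∈ symbolSpan q →
      NCIntegrable (T * absDiracPow 3) ∧ NCIntegrable (T * absDiracPow 2) := fun hT => by
    obtain ⟨_, _, h⟩ := exists_hasExpansion hq0 hq1 hT
    exact ⟨⟨_, h.hasNCIntegral.1⟩, ⟨_, h.hasNCIntegral.2⟩⟩
  obtain ⟨h1, h2⟩ := ncIntegral_mul_conjJ hq0 hq1 hA' hB'
  obtain ⟨dA, hdA, hδ⟩ := exists_isDelta hA'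
  -- Since δ(A) has zero diagonal, the product formula for the pair δ(A), A gives 0 for the last
  -- integral.
  have h0 : HasExpansion dA 0 0 := hasLevelExpansion_of_diag_eq_zero hδ.diag_eq_zero
  have h3 := (ncIntegral_mul_conjJ hq0 hq1 hdA hA').1
  rw [h0.hasNCIntegral.1.ncIntegral_eq, mul_zero, zero_mul] at h3
  exact ⟨⟨(hint hA').1, (hint hA').2, (hint hB').1, (hint hB').2, (hint hA2).1⟩, h1, h2,
    (ncIntegral_mul_conjJ hq0 hq1 hA2 hB').1, dA, hδ,
    hδ.hasNCIntegral_mul_self hq0 hq1 hA' hdA, h3⟩
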